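/- Let $G=(V,E)$ be a finite connected simple graph on $n\ge 2$ vertices, let $q\ge 2$ be an integer and $\theta\in(0,1]$. The $q$-state noisy voter model on $G$ with noise probability $\theta$ is the continuous-time Markov chain $(X_t)_{t\ge0}$ on $\{0,\dots,q-1\}^V$ in which every vertex $u$ carries an independent rate-$1$ Poisson clock; when the clock at $u$ rings, the value at $u$ is replaced, with probability $1-\theta$, by the current value at a uniformly chosen neighbor of $u$ and, with probability $\theta$, by a uniformly chosen element of $\{0,\dots,q-1\}$. Let $\mu_G$ be its (unique) stationary distribution, and for an initial state $x_0$ and $0<\epsilon<1$ let \[ t_{\mathrm{mix}}^{x_0}(\epsilon)=\inf\{t\ge 0:\ \|\mathbb P_{x_0}(X_t\in\cdot)-\mu_G\|_{\mathrm{TV}}<\epsilon\}. \] Let $d_G(v)$ be the degree of $v$, put $\pi_G(v)=d_G(v)/(2|E|)$, and define the autocorrelation function and the autocorrelation time by \[ \mathcal A^{(2)}_t(x_0)=\sum_{v\in V}\pi_G(v)\sum_{j=0}^{q-1}\Big(\mathbb P_{x_0}(X_t(v)=j)-\frac1q\Big)^2,\qquad T_{x_0}=\inf\Big\{t\ge 0:\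 \mathcal A^{(2)}_t(x_0)\le \frac1n\Big\}. \] For $c_0>0$ and $\alpha\in(0,1)$ say that $G$ satisfies the growth condition with constants $c_0,\alpha$ if \[ |B_v(r)|\le c_0\exp(r^{1-\alpha})\qquad\text{for every } v\in V \text{ and every integer } r\ge 1, \] where $B_v(r)$ is the ball of radius $r$ around $v$ in the graph distance. \textbf{Theorem.} Fix $\theta\in(0,1]$, an integer $q\ge2$, $c_0>0$ and $\alpha\in(0,1)$. (1) For every $\epsilon\in(0,1)$ there is a constant $C$, depending only on $\epsilon,\theta,q,c_0,\alpha$, such that for every connected graph $G$ on $n\ge2$ vertices that satisfies the growth condition with constants $c_0,\alpha$, and for every initial state $x_0\in\{0,\dots,q-1\}^V$, \[ t_{\mathrm{mix}}^{x_0}(\epsilon)=(1+\delta)\max\Big\{T_{x_0},\ \frac1{4\theta}\log n\Big\}\qquad\text{for some real }\delta\text{ with } |\delta|\le C(\log n)^{-\alpha/2}. \] (2) In particular, let $(G_k)$ be a sequence of connected graphs satisfying the growth condition with the same constants $c_0,\alpha$, whose numbers of vertices $n_k$ tend to infinity, and let $(x_0^{(k)})$ be any sequence of initial states. Then the $q$-state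 noisy voter model on $G_k$ with noise probability $\theta$ started from $x_0^{(k)}$ has cutoff at $\max\{T_{x_0^{(k)}},\frac1{4\theta}\log n_k\}$: for every fixed $\epsilon\in(0,1)$, \[ \frac{t_{\mathrm{mix}}^{x_0^{(k)}}(\epsilon)}{\max\{T_{x_0^{(k)}},\frac1{4\theta}\log n_k\}}\longrightarrow 1\qquad (k\to\infty). \] -/

import Mathlib

/-!
The `q`-state noisy voter model on a finite graph `G` with noise probability `θ`: its law at time `t`,
its stationary distribution, its total variation mixing time from a given initial state, and the
autocorrelation time of an initial state.
-/

universe u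

open Filter Topology Matrix

namespace NoisyVoter

noncomputable section

variable {V : Type*} [Fintype V] [DecidableEq V]

/-- The transition matrix, on configurations `x : V → Fin q`, of one update at the vertex `u`:
with probability `1 - θ` the vertex `u` adopts the colour of a uniformly chosen neighbour, and with
probability `θ` it receives a uniformly chosen colour. -/
def siteUpdate (G : SimpleGraph V) [DecidableRel G.Adj] (q : ℕ) (θ : ℝ) (u : V) :
    Matrix (V → Fin q) (V → Fin q) ℝ :=
  Matrix.of fun x y =>
    (1 - θ) * ∑ v ∈ G.neighborFinset u,
        (if y = Function.update x u (x v) then 1 / (G.degree u : ℝ) else 0)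
      + θ * ∑ c : Fin q, (if y = Function.update x u c then 1 / (q : ℝ) else 0)

/-- The generator of the noisy voter model: every vertex is updated at rate `1`, independently. -/
def generator (G : SimpleGraph V) [DecidableRel G.Adj] (q : ℕ) (θ : ℝ) :
    Matrix (V → Fin q) (V → Fin q) ℝ :=
  ∑ u : V, (siteUpdate G q θ u - 1)

/-- The transition matrix at time `t` of the continuous-time chain: `transition G q θ t x y` is the
probability of being in state `y` at time `t` when started from the state `x` at time `0`. -/
def transition (G : SimpleGraph V) [DecidableRel G.Adj] (q : ℕ) (θ : ℝ) (t : ℝ) :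
    Matrix (V → Fin q) (V → Fin q) ℝ :=
  NormedSpace.exp (t • generator G q θ)

/-- `μ` is a stationary probability distribution of the noisy voter model. -/
structure IsStationary (G : SimpleGraph V) [DecidableRel G.Adj] (q : ℕ) (θ : ℝ)
    (μ : (V → Fin q) → ℝ) : Prop where
  nonneg : ∀ x, 0 ≤ μ x
  sum_eq_one : ∑ x, μ x = 1
  invariant : ∀ t : ℝ, 0 ≤ t → μ ᵥ* transition G q θ t = μ

/-- The stationary distribution of the noisy voter model. It exists and is unique for a connected
graph on at least two vertices and `0 < θ ≤ 1`, see `existsUnique_isStationary` below. -/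
def stationary (G : SimpleGraph V) [DecidableRel G.Adj] (q : ℕ) (θ : ℝ) : (V → Fin q) → ℝ :=
  Classical.epsilon (IsStationary G q θ)

/-- Total variation distance of two probability vectors on a finite set. -/
def tvDist {S : Type*} [Fintype S] (μ ν : S → ℝ) : ℝ := (1 / 2) * ∑ s, |μ s - ν s|

/-- The total variation mixing time to within distance `ε`, from the initial state `x₀`. -/
def tmix (G : SimpleGraph V) [DecidableRel G.Adj] (q : ℕ) (θ : ℝ) (x₀ : V → Fin q) (ε : ℝ) : ℝ :=
  sInf {t : ℝ | 0 ≤ t ∧ tvDist (transition G q θ t x₀) (stationary G q θ) < ε}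

/-- The probability that the vertex `v` has colour `j` at time `t`, from the initial state `x₀`. -/
def marginal (G : SimpleGraph V) [DecidableRel G.Adj] (q : ℕ) (θ : ℝ) (x₀ : V → Fin q) (t : ℝ)
    (v : V) (j : Fin q) : ℝ :=
  ∑ y : V → Fin q, if y v = j then transition G q θ t x₀ y else 0

/-- The stationary measure `d(v) / (2|E|)` of the simple random walk on `G`. -/
def walkStationary (G : SimpleGraph V) [DecidableRel G.Adj] (v : V) : ℝ :=
  (G.degree v : ℝ) / (2 * (G.edgeFinset.card : ℝ))

/-- The `L²` autocorrelation function of the noisy voter model started at `x₀`. -/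
def autocorrelation (G : SimpleGraph V) [DecidableRel G.Adj] (q : ℕ) (θ : ℝ) (x₀ : V → Fin q)
    (t : ℝ) : ℝ :=
  ∑ v : V, walkStationary G v * ∑ j : Fin q, (marginal G q θ x₀ t v j - 1 / (q : ℝ)) ^ 2

/-- The time that the autocorrelation function started at `x₀` needs to drop to `1 / n`, where `n`
is the number of vertices. -/
def autocorrelationTime (G : SimpleGraph V) [DecidableRel G.Adj] (q : ℕ) (θ : ℝ)
    (x₀ : V → Fin q) : ℝ :=
  sInf {t : ℝ | 0 ≤ t ∧ autocorrelation G q θ x₀ t ≤ 1 / (Fintype.card V : ℝ)}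

/-- The location of the cutoff: the maximum of the autocorrelation time and `(1 / (4θ)) log n`. -/
def cutoffTime (G : SimpleGraph V) [DecidableRel G.Adj] (q : ℕ) (θ : ℝ) (x₀ : V → Fin q) : ℝ :=
  max (autocorrelationTime G q θ x₀) (1 / (4 * θ) * Real.log (Fintype.card V))

/-- Subexponential growth of balls: `|B_v(r)| ≤ c₀ exp (r ^ (1 - α))` for every vertex `v` and every
radius `r ≥ 1`. -/
def SubexpGrowth {V : Type*} (G : SimpleGraph V) (c₀ α : ℝ) : Prop :=
  ∀ (v : V) (r : ℕ), 1 ≤ r →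
    (Set.ncard {u : V | G.edist v u ≤ (r : ℕ∞)} : ℝ) ≤ c₀ * Real.exp ((r : ℝ) ^ (1 - α))

/-- A sequence of chains whose `k`-th member has mixing time `T k ε` to within distance `ε` has
cutoff at the sequence `s` if `T k ε / s k → 1` for every fixed `0 < ε < 1`. -/
def HasCutoffAt (T : ℕ → ℝ → ℝ) (s : ℕ → ℝ) : Prop :=
  ∀ ε : ℝ, 0 < ε → ε < 1 → Tendsto (fun k => T k ε / s k) atTop (𝓝 1)

/-! ### Existence and uniqueness of the stationary distribution -/

lemma sum_ite_mul {S ι : Type*} [Fintype S] [DecidableEq S] (s : Finset ι) (a : ℝ) (g : ι → S)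
    (f : S → ℝ) : ∑ y, (∑ i ∈ s, if y = g i then a else 0) * f y = ∑ i ∈ s, a * f (g i) := by
  simp only [Finset.sum_mul]
  rw [Finset.sum_comm]
  refine Finset.sum_congr rfl fun v _ => ?_
  simp [ite_mul]

lemma siteUpdate_mulVec (G : SimpleGraph V) [DecidableRel G.Adj] (q : ℕ) (θ : ℝ) (u : V)
    (f : (V → Fin q) → ℝ) (x : V → Fin q) :
    (siteUpdate G q θ u *ᵥ f) x =
      (1 - θ) * ∑ v ∈ G.neighborFinset u, 1 / (G.degree u : ℝ) * f (Function.update x u (x v))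
        + θ * ∑ c : Fin q, 1 / (q : ℝ) * f (Function.update x u c) := by
  simp only [Matrix.mulVec, dotProduct, siteUpdate, Matrix.of_apply, add_mul,
    Finset.sum_add_distrib, mul_assoc]
  rw [← Finset.mul_sum, ← Finset.mul_sum, sum_ite_mul, sum_ite_mul]

lemma siteUpdate_mulVec_const (G : SimpleGraph V) [DecidableRel G.Adj] (q : ℕ) (θ : ℝ) (u : V)
    (hq : 2 ≤ q) (hu : 0 < G.degree u) (a : ℝ) (x : V → Fin q) :
    (siteUpdate G q θ u *ᵥ fun _ => a) x = a := by
  rw [siteUpdate_mulVec]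
  have h1 : (G.degree u : ℝ) ≠ 0 := by positivity
  have h2 : (q : ℝ) ≠ 0 := by positivity
  simp
  field_simp
  ring

lemma generator_mulVec (G : SimpleGraph V) [DecidableRel G.Adj] (q : ℕ) (θ : ℝ)
    (f : (V → Fin q) → ℝ) (x : V → Fin q) :
    (generator G q θ *ᵥ f) x = ∑ u, ((siteUpdate G q θ u *ᵥ f) x - f x) := by
  simp [generator, Matrix.sum_mulVec, Matrix.sub_mulVec]

/-- A left null vector exists for every matrix with zero row sums and nonnegative off-diagonal
entries, and it can be chosen to be a probability vector. -/
lemma exists_null_of_generator {S : Type*} [Fintype S] [DecidableEq S] [Nonempty S]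
    (L : Matrix S S ℝ) (h0 : ∀ x, ∑ y, L x y = 0) (hL : ∀ x y, x ≠ y → 0 ≤ L x y) :
    ∃ μ : S → ℝ, (∀ x, 0 ≤ μ x) ∧ ∑ x, μ x = 1 ∧ μ ᵥ* L = 0 := by
  have hdet : L.det = 0 := by
    rw [← Matrix.exists_mulVec_eq_zero_iff]
    refine ⟨fun _ => 1, ?_, ?_⟩
    · intro h
      have := congrFun h (Classical.arbitrary S)
      simp at this
    · ext x
      simpa [Matrix.mulVec, dotProduct] using h0 x
  obtain ⟨w, hw0, hw⟩ := Matrix.exists_vecMul_eq_zero_iff.mpr hdet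
  have hnn : ∀ y, 0 ≤ ∑ x, |w x| * L x y := by
    intro y
    have e := congrFun hw y
    simp only [Matrix.vecMul, dotProduct, Pi.zero_apply] at e
    rw [← Finset.add_sum_erase _ _ (Finset.mem_univ y)] at e ⊢
    have hyy : L y y ≤ 0 := by
      have := h0 y
      rw [← Finset.add_sum_erase _ _ (Finset.mem_univ y)] at this
      have : 0 ≤ ∑ x ∈ Finset.univ.erase y, L y x :=
        Finset.sum_nonneg fun x hx => hL y x (Finset.ne_of_mem_erase hx).symm
      linarith
    have e2 : |w y| * -L y y = |∑ x ∈ Finset.univ.erase y, w x * L x y| := by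
      rw [← abs_of_nonneg (neg_nonneg.mpr hyy), ← abs_mul]
      congr 1
      linarith
    have e3 : |∑ x ∈ Finset.univ.erase y, w x * L x y| ≤
        ∑ x ∈ Finset.univ.erase y, |w x| * L x y := by
      refine (Finset.abs_sum_le_sum_abs _ _).trans (Finset.sum_le_sum fun x hx => ?_)
      rw [abs_mul, abs_of_nonneg (hL x y (Finset.ne_of_mem_erase hx))]
    linarith
  have hsum : ∑ y, ∑ x, |w x| * L x y = 0 := by
    rw [Finset.sum_comm]
    simp [← Finset.mul_sum, h0]
  have hz := (Finset.sum_eq_zero_iff_of_nonneg fun y _ => hnn y).mp hsum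
  obtain ⟨x₁, hx₁⟩ := Function.ne_iff.mp hw0
  have hpos : 0 < ∑ x, |w x| :=
    Finset.sum_pos' (fun x _ => abs_nonneg _) ⟨x₁, Finset.mem_univ _, abs_pos.mpr hx₁⟩
  refine ⟨fun x => |w x| / ∑ z, |w z|, fun x => by positivity, ?_, ?_⟩
  · rw [← Finset.sum_div, div_self hpos.ne']
  · ext y
    simp only [Matrix.vecMul, dotProduct, Pi.zero_apply, div_mul_eq_mul_div]
    rw [← Finset.sum_div, hz y (Finset.mem_univ y), zero_div]

/-- Left null vectors with zero sum vanish if the right null vectors are constant. -/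
lemma null_unique {S : Type*} [Fintype S] [DecidableEq S]
    (L : Matrix S S ℝ) (hc : ∀ f : S → ℝ, L *ᵥ f = 0 → ∀ x y, f x = f y)
    (μ : S → ℝ) (hμ : ∑ x, μ x = 1) (hμL : μ ᵥ* L = 0)
    (w : S → ℝ) (hw : ∑ x, w x = 0) (hwL : w ᵥ* L = 0) : w = 0 := by
  by_contra hne
  have hdet : (L + Matrix.vecMulVec (fun _ => 1) μ).det = 0 := by
    rw [← Matrix.exists_vecMul_eq_zero_iff]
    refine ⟨w, hne, ?_⟩
    rw [Matrix.vecMul_add, hwL, zero_add]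
    ext y
    simp [Matrix.vecMul, dotProduct, Matrix.vecMulVec_apply, ← Finset.sum_mul, hw]
  obtain ⟨f, hf0, hf⟩ := Matrix.exists_mulVec_eq_zero_iff.mpr hdet
  have hM : Matrix.vecMulVec (fun _ : S => (1 : ℝ)) μ *ᵥ f = fun _ => μ ⬝ᵥ f := by
    ext y
    simp [Matrix.mulVec, dotProduct, Matrix.vecMulVec_apply]
  rw [Matrix.add_mulVec, hM] at hf
  have h1 : μ ⬝ᵥ f = 0 := by
    have := congrArg (fun g => μ ⬝ᵥ g) hf
    simp only [dotProduct_add, dotProduct_zero, Matrix.dotProduct_mulVec, hμL,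
      zero_dotProduct, zero_add] at this
    rw [dotProduct, ← Finset.sum_mul, hμ, one_mul] at this
    exact this
  have h2 : L *ᵥ f = 0 := by
    rw [h1] at hf
    ext y
    simpa using congrFun hf y
  obtain ⟨x₁, hx₁⟩ := Function.ne_iff.mp hf0
  apply hx₁
  have h3 : μ ⬝ᵥ f = f x₁ := by
    rw [dotProduct, Finset.sum_congr rfl fun x _ => by rw [hc f h2 x x₁], ← Finset.sum_mul, hμ,
      one_mul]
  rw [← h3, h1]
  rfl

/-- Harmonic functions of the noisy voter model are constant. -/
lemma generator_null_const (G : SimpleGraph V) [DecidableRel G.Adj] (q : ℕ) (θ : ℝ)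
    (hq : 2 ≤ q) (hθ : 0 < θ) (hθ' : θ ≤ 1) (hd : ∀ u, 0 < G.degree u)
    (f : (V → Fin q) → ℝ) (hf : generator G q θ *ᵥ f = 0) (x y : V → Fin q) : f x = f y := by
  have : Nonempty (V → Fin q) := ⟨x⟩
  obtain ⟨m, hm⟩ := Finite.exists_max f
  have hq0 : (0 : ℝ) < q := by positivity
  have step : ∀ z, f z = f m → ∀ u c, f (Function.update z u c) = f m := by
    intro z hz u c
    have hle : ∀ u, (siteUpdate G q θ u *ᵥ f) z ≤ f m - θ * (1 / q * (f m -
        f (Function.update z u c))) := by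
      intro u
      have hcst := siteUpdate_mulVec_const G q θ u hq (hd u) (f m) z
      rw [siteUpdate_mulVec] at hcst ⊢
      have a1 : ∑ v ∈ G.neighborFinset u, 1 / (G.degree u : ℝ) * f (Function.update z u (z v)) ≤
          ∑ v ∈ G.neighborFinset u, 1 / (G.degree u : ℝ) * f m :=
        Finset.sum_le_sum fun v _ => mul_le_mul_of_nonneg_left (hm _) (by positivity)
      have a2 : ∑ c : Fin q, 1 / (q : ℝ) * f (Function.update z u c) ≤
          ∑ c : Fin q, 1 / (q : ℝ) * f m - 1 / q * (f m - f (Function.update z u c)) := by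
        have : 1 / (q : ℝ) * (f m - f (Function.update z u c)) ≤
            ∑ c : Fin q, 1 / (q : ℝ) * (f m - f (Function.update z u c)) :=
          Finset.single_le_sum (f := fun c => 1 / (q : ℝ) * (f m - f (Function.update z u c)))
            (fun c _ => mul_nonneg (by positivity) (sub_nonneg.mpr (hm _))) (Finset.mem_univ c)
        simp only [mul_sub, Finset.sum_sub_distrib] at this ⊢
        linarith
      have a3 := mul_le_mul_of_nonneg_left a1 (sub_nonneg.mpr hθ')
      have a4 := mul_le_mul_of_nonneg_left a2 hθ.le
      rw [mul_sub] at a4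
      linarith
    have h0 := congrFun hf z
    rw [generator_mulVec, hz] at h0
    have hnp : ∀ u ∈ Finset.univ, (siteUpdate G q θ u *ᵥ f) z - f m ≤ 0 := by
      intro u _
      have := hle u
      have : 0 ≤ θ * (1 / q * (f m - f (Function.update z u c))) :=
        mul_nonneg hθ.le (mul_nonneg (by positivity) (sub_nonneg.mpr (hm _)))
      linarith
    have h1 := (Finset.sum_eq_zero_iff_of_nonpos hnp).mp h0 u (Finset.mem_univ u)
    have h2 := hle u
    have h3 : θ * (1 / q * (f m - f (Function.update z u c))) ≤ 0 := by linarith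
    have h4 : 0 < θ * (1 / (q : ℝ)) := by positivity
    have h5 : f m - f (Function.update z u c) ≤ 0 := by
      by_contra hcon
      push Not at hcon
      have := mul_pos h4 hcon
      linarith
    linarith [hm (Function.update z u c)]
  have all : ∀ y, f y = f m := by
    intro y
    have : ∀ s : Finset V, f (fun v => if v ∈ s then y v else m v) = f m := by
      intro s
      induction s using Finset.induction_on with
      | empty => simp
      | insert a s ha ih =>
        rw [← step _ ih a (y a)]
        congr 1
        ext v
        by_cases hv : v = a
        · subst hv; simp
        · simp [hv]
    simpa using this Finset.univ
  rw [all x, all y]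

lemma isStationary_iff (G : SimpleGraph V) [DecidableRel G.Adj] (q : ℕ) (θ : ℝ)
    (μ : (V → Fin q) → ℝ) :
    IsStationary G q θ μ ↔
      (∀ x, 0 ≤ μ x) ∧ ∑ x, μ x = 1 ∧ μ ᵥ* generator G q θ = 0 := by
  let _ : NormedRing (Matrix (V → Fin q) (V → Fin q) ℝ) := Matrix.linftyOpNormedRing
  let _ : NormedAlgebra ℝ (Matrix (V → Fin q) (V → Fin q) ℝ) := Matrix.linftyOpNormedAlgebra
  let _ : NormedAlgebra ℚ (Matrix (V → Fin q) (V → Fin q) ℝ) := NormedAlgebra.restrictScalars ℚ ℝ _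
  have hE : ∀ (N A : Matrix (V → Fin q) (V → Fin q) ℝ), N = Matrix.of (fun _ => μ) →
      ((μ ᵥ* A = 0 → N * A = 0) ∧ (N * A = N → μ ᵥ* A = μ)) := by
    intro N A hN
    have : ∀ x, (N * A) x = μ ᵥ* A := by
      intro x
      ext y
      subst hN
      simp [Matrix.mul_apply, Matrix.vecMul, dotProduct]
    refine ⟨fun h => ?_, fun h => ?_⟩
    · ext x y
      rw [this x, h]
      rfl
    · by_cases hne : Nonempty (V → Fin q)
      · obtain ⟨x⟩ := hne
        rw [← this x, h, hN]
        rfl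
      · ext y
        exact (hne ⟨y⟩).elim
  constructor
  · rintro ⟨h1, h2, h3⟩
    refine ⟨h1, h2, ?_⟩
    have hd : HasDerivAt (fun t : ℝ => NormedSpace.exp (t • generator G q θ))
        (generator G q θ) 0 := by
      have h := hasDerivAt_exp_smul_const (𝕂 := ℝ) (generator G q θ) (0 : ℝ)
      rw [zero_smul, NormedSpace.exp_zero, one_mul] at h
      exact h
    ext y
    let ev : Matrix (V → Fin q) (V → Fin q) ℝ →ₗ[ℝ] ℝ :=
      { toFun := fun A => (μ ᵥ* A) y
        map_add' := fun A B => by simp [Matrix.vecMul_add]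
        map_smul' := fun c A => by simp [Matrix.vecMul_smul] }
    have hd2 : HasDerivAt (fun t : ℝ => (μ ᵥ* transition G q θ t) y)
        ((μ ᵥ* generator G q θ) y) 0 :=
      (LinearMap.toContinuousLinearMap ev).hasFDerivAt.comp_hasDerivAt (0 : ℝ) hd
    have hd3 : HasDerivWithinAt (fun t : ℝ => (μ ᵥ* transition G q θ t) y) 0 (Set.Ici 0) 0 :=
      (hasDerivWithinAt_const (0 : ℝ) (Set.Ici 0) (μ y)).congr
        (fun t ht => by rw [h3 t ht]) (by rw [h3 0 le_rfl])
    exact (uniqueDiffOn_Ici (0 : ℝ) 0 Set.self_mem_Ici).eq_deriv _ hd2.hasDerivWithinAt hd3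
  · rintro ⟨h1, h2, h3⟩
    refine ⟨h1, h2, fun t _ => ?_⟩
    refine (hE _ _ rfl).2 ?_
    have hs : SemiconjBy (Matrix.of fun _ : V → Fin q => μ) (t • generator G q θ) 0 := by
      rw [SemiconjBy, (hE _ _ rfl).1, zero_mul]
      rw [Matrix.vecMul_smul, h3, smul_zero]
    have := hs.exp_right
    rw [SemiconjBy, NormedSpace.exp_zero, one_mul] at this
    exact this

theorem existsUnique_isStationary (G : SimpleGraph V) [DecidableRel G.Adj] (q : ℕ) (θ : ℝ)
    (hq : 2 ≤ q) (hθ : 0 < θ) (hθ' : θ ≤ 1) (hG : G.Connected) (hV : 2 ≤ Fintype.card V) :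
    ∃! μ, IsStationary G q θ μ := by
  have : Nontrivial V := Fintype.one_lt_card_iff_nontrivial.mp hV
  have hd : ∀ u, 0 < G.degree u := fun u => hG.preconnected.degree_pos_of_nontrivial u
  have : Nonempty (V → Fin q) := ⟨fun _ => ⟨0, by omega⟩⟩
  have hrow : ∀ x, ∑ y, generator G q θ x y = 0 := by
    intro x
    have := generator_mulVec G q θ (fun _ => 1) x
    simp only [siteUpdate_mulVec_const G q θ _ hq (hd _), sub_self, Finset.sum_const_zero] at this
    simpa [Matrix.mulVec, dotProduct] using this
  have hoff : ∀ x y, x ≠ y → 0 ≤ generator G q θ x y := by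
    intro x y hxy
    rw [generator, Matrix.sum_apply]
    refine Finset.sum_nonneg fun u _ => ?_
    rw [Matrix.sub_apply, Matrix.one_apply_ne hxy, sub_zero, siteUpdate, Matrix.of_apply]
    refine add_nonneg (mul_nonneg (sub_nonneg.mpr hθ') (Finset.sum_nonneg fun v _ => ?_))
      (mul_nonneg hθ.le (Finset.sum_nonneg fun c _ => ?_)) <;> split_ifs <;> positivity
  obtain ⟨μ, h1, h2, h3⟩ := exists_null_of_generator _ hrow hoff
  refine ⟨μ, (isStationary_iff G q θ μ).mpr ⟨h1, h2, h3⟩, fun ν hν => ?_⟩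
  obtain ⟨-, h5, h6⟩ := (isStationary_iff G q θ ν).mp hν
  have := null_unique _ (generator_null_const G q θ hq hθ hθ' hd) μ h2 h3 (ν - μ)
    (by simp [Finset.sum_sub_distrib, h5, h2]) (by rw [Matrix.sub_vecMul, h6, h3, sub_zero])
  exact sub_eq_zero.mp this

theorem isStationary_stationary (G : SimpleGraph V) [DecidableRel G.Adj] (q : ℕ) (θ : ℝ)
    (hq : 2 ≤ q) (hθ : 0 < θ) (hθ' : θ ≤ 1) (hG : G.Connected) (hV : 2 ≤ Fintype.card V) :
    IsStationary G q θ (stationary G q θ) :=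
  Classical.epsilon_spec (existsUnique_isStationary G q θ hq hθ hθ' hG hV).exists

end

end NoisyVoter

set_option linter.unusedSectionVars false

namespace NoisyVoter

noncomputable section

variable {V : Type*} [Fintype V] [DecidableEq V]

/-! ### Differential inequalities and one-parameter semigroups -/

/-! Follow colours backwards in time. The colour of a vertex was copied along a walk until, at rate
`θ`, a fresh colour was drawn. A `Lineage` map records for every vertex where its colour comes from,
and `transition_mulVec_eq_lineageExp` writes the law at time `t` as the average of `Φ.eval x` over
random lineage maps. One lineage is a killed walk; several lineages coalesce on meeting. Three
estimates, all uniform in time, follow: covariances decay exponentially in space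
(`covarianceDecay_transition`), variances obey a Poincaré inequality (`variance_transition_le`), and
surviving ancestors are at most as dense as those of independent walks
(`lineageExp_subset_ancestors_le`). The first two pass to the stationary law as `t` tends to
infinity.

Lower bound. Two obstructions compete. The biases of the marginals solve the killed walk equation,
and the linear statistic weighted by the biases themselves has mean gap `N`, of order `n` times the
autocorrelation, and variance `O(N)`; so the chain is not mixed while `n` times the autocorrelation
is large (`tvDist_ge_of_autocorrelation`). Secondly, equilibrium has pair correlations that must be
built up. The missing correlation dominates a flow of two walks killed by noise or on meeting
(`semigroup_pairGen_le`), and summed against a local test function it is about `n * exp (-2θt)`, to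
be compared with fluctuations of order `√n`; this yields `log n / (4θ)` (`tvDist_ge_of_pair`). That
killing on meeting does not raise the rate `2θ` noticeably is a Rayleigh quotient estimate for a
slowly decaying function of the distance. Subexponential growth makes its boundary terms harmless
(`tvDist_ge_of_radius`). For `θ = 1` equilibrium has no pair correlations, but there the biases
alone last long enough.

Upper bound. Run to the cutoff time `T` and then for a further `s` of order `(log n) ^ (1 - α / 2)`.
The configuration at `T + s` depends on that at `T` only through the ancestors of the last stretch.
These have density `O(exp (-θs))`, so with high probability no ball of radius `k * r` contains `k`
of them. Such a sparse set splits into blocks of at most `k` points at mutual distance at least `r`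
(`Sparse.exists_block`), which decay of covariances makes nearly independent. Comparing with
equilibrium therefore reduces to a chi-square bound on each block, and these bounds multiply over
blocks (`Sparse.sq_expect_le`).

On one block the deviation of the joint law is controlled by `potential`
(`abs_deviation_leadsTo_le`), which combines the survival probability `exp (-2θt)` of two lineages,
the biases, and a `correction` transporting the biases of coalesced lineages. The squares of these,
summed over all vertices at time `T`, grow at most polynomially in `log n`: for the first because `T
≥ log n / (4θ)`, for the biases by the definition of the autocorrelation time, and for the
correction because log-convexity of the autocorrelation in time prevents the biases from having been
large earlier (`autocorrelation_le_before`, `sum_degree_mul_correction_sq_le`). The ancestor density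
`exp (-θs)` beats these sums and the block constants. Graphs with few vertices are absorbed into the
final constant. -/

lemma le_of_hasDerivAt_nonpos {φ φ' : ℝ → ℝ} {a b : ℝ} (hab : a ≤ b)
    (h : ∀ s, HasDerivAt φ (φ' s) s) (hn : ∀ s, a ≤ s → s ≤ b → φ' s ≤ 0) : φ b ≤ φ a := by
  have : AntitoneOn φ (Set.Icc a b) := by
    refine antitoneOn_of_deriv_nonpos (convex_Icc a b)
      (fun s _ => (h s).continuousAt.continuousWithinAt)
      (fun s _ => (h s).differentiableAt.differentiableWithinAt) fun s hs => ?_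
    rw [interior_Icc] at hs
    rw [(h s).deriv]
    exact hn s hs.1.le hs.2.le
  exact this ⟨le_rfl, hab⟩ ⟨hab, le_rfl⟩ hab

lemma eq_of_hasDerivAt_zero {φ : ℝ → ℝ} (h : ∀ s, HasDerivAt φ 0 s) (a b : ℝ) : φ a = φ b :=
  is_const_of_deriv_eq_zero (fun s => (h s).differentiableAt) (fun s => (h s).deriv) a b

/-- A finite system whose members cannot decrease faster than a multiple of its most negative
member stays nonnegative. -/
lemma nonneg_of_deriv_ge {ι : Type*} [Finite ι] {z z' : ℝ → ι → ℝ} {K T : ℝ}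
    (hz : ∀ s i, HasDerivAt (fun s => z s i) (z' s i) s) (h0 : ∀ i, 0 ≤ z 0 i)
    (h : ∀ s, 0 ≤ s → s ≤ T → ∀ i m, 0 ≤ m → (∀ j, -m ≤ z s j) → z s i ≤ 0 → -(K * m) ≤ z' s i)
    {t : ℝ} (ht : 0 ≤ t) (htT : t ≤ T) (i : ι) : 0 ≤ z t i := by
  -- The perturbation makes the inequality strict. At the first zero of a perturbed component, all
  -- components of `z` are at least `-E`, so that component's derivative is at least `-(K * E) + (K
  -- + 1) * E > 0`, although it is reached from above.
  have key : ∀ δ : ℝ, 0 < δ → ∀ s, 0 ≤ s → s ≤ T → ∀ i, 0 < z s i + δ * Real.exp ((K + 1) * s) := by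
    intro δ hδ
    set v : ℝ → ι → ℝ := fun s i => z s i + δ * Real.exp ((K + 1) * s) with hv
    have hvd : ∀ s i, HasDerivAt (fun s => v s i)
        (z' s i + δ * (Real.exp ((K + 1) * s) * (K + 1))) s := by
      intro s i
      have := (((hasDerivAt_id s).const_mul (K + 1)).exp).const_mul δ
      exact ((hz s i).fun_add this).congr_deriv (by simp)
    by_contra hcon
    push Not at hcon
    let S : Set ℝ := ⋃ i, {s | 0 ≤ s ∧ s ≤ T ∧ v s i ≤ 0}
    have hSc : IsClosed S := by
      refine isClosed_iUnion_of_finite fun i => ?_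
      have hc : Continuous fun s => v s i :=
        continuous_iff_continuousAt.mpr fun s => (hvd s i).continuousAt
      exact (isClosed_le continuous_const continuous_id).inter
        ((isClosed_le continuous_id continuous_const).inter (isClosed_le hc continuous_const))
    have hSne : S.Nonempty := by
      obtain ⟨s, hs0, hsT, i, hi⟩ := hcon
      exact ⟨s, Set.mem_iUnion.mpr ⟨i, hs0, hsT, hi⟩⟩
    have hSb : BddBelow S := ⟨0, by
      intro s hs
      obtain ⟨i, hi⟩ := Set.mem_iUnion.mp hs
      exact hi.1⟩
    obtain ⟨i, hs0, hsT, hi⟩ := Set.mem_iUnion.mp (hSc.csInf_mem hSne hSb)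
    set s₀ := sInf S with hs₀
    have hbefore : ∀ s, 0 ≤ s → s < s₀ → ∀ j, 0 < v s j := by
      intro s hs hlt j
      by_contra hc
      push Not at hc
      have : s₀ ≤ s := csInf_le hSb (Set.mem_iUnion.mpr ⟨j, hs, (hlt.le.trans hsT), hc⟩)
      linarith
    have hpos : 0 < s₀ := by
      rcases hs0.lt_or_eq with h' | h'
      · exact h'
      · exfalso
        rw [← h'] at hi
        have := h0 i
        simp only [hv, mul_zero, Real.exp_zero, mul_one] at hi
        linarith
    have hge : ∀ j, 0 ≤ v s₀ j := by
      intro j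
      have hc : Tendsto (fun s => v s j) (𝓝[<] s₀) (𝓝 (v s₀ j)) :=
        (hvd s₀ j).continuousAt.tendsto.mono_left nhdsWithin_le_nhds
      refine ge_of_tendsto hc ?_
      filter_upwards [Ioo_mem_nhdsLT hpos] with s hs
      exact (hbefore s hs.1.le hs.2 j).le
    have hi0 : v s₀ i = 0 := le_antisymm hi (hge i)
    set E := δ * Real.exp ((K + 1) * s₀) with hE
    have hEpos : 0 < E := by positivity
    have hd := h s₀ hs0 hsT i E hEpos.le (fun j => by have := hge j; simp only [hv] at this; linarith)
      (by simp only [hv] at hi0; linarith)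
    have hd' : 0 < z' s₀ i + δ * (Real.exp ((K + 1) * s₀) * (K + 1)) := by
      have : δ * (Real.exp ((K + 1) * s₀) * (K + 1)) = K * E + E := by rw [hE]; ring
      linarith
    have hsl := (hasDerivAt_iff_tendsto_slope.mp (hvd s₀ i)).mono_left
      (nhdsWithin_mono s₀ (fun s (hs : s < s₀) => hs.ne) : 𝓝[<] s₀ ≤ 𝓝[≠] s₀)
    have : z' s₀ i + δ * (Real.exp ((K + 1) * s₀) * (K + 1)) ≤ 0 := by
      refine le_of_tendsto hsl ?_
      filter_upwards [Ioo_mem_nhdsLT hpos] with s hs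
      rw [slope_def_field, hi0, sub_zero]
      exact div_nonpos_of_nonneg_of_nonpos (hbefore s hs.1.le hs.2 i).le (by linarith [hs.2])
    linarith
  by_contra hc
  push Not at hc
  -- This `δ` makes the perturbation at time `t` exactly cancel the supposedly negative value `z t
  -- i`.
  have := key (-(z t i) / Real.exp ((K + 1) * t)) (by have := neg_pos.mpr hc; positivity) t ht htT i
  rw [div_mul_cancel₀ _ (Real.exp_pos _).ne'] at this
  linarith

/-! ### Semigroups of bounded operators -/

section Semigroup

variable {E : Type*} [NormedAddCommGroup E] [NormedSpace ℝ E]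

/-- The semigroup generated by a bounded operator. -/
def semigroup (Λ : E →L[ℝ] E) (t : ℝ) : E →L[ℝ] E := NormedSpace.exp (t • Λ)

lemma semigroup_zero (Λ : E →L[ℝ] E) (f : E) : semigroup Λ 0 f = f := by
  simp [semigroup]

variable [CompleteSpace E]

lemma hasDerivAt_semigroup (Λ : E →L[ℝ] E) (t : ℝ) :
    HasDerivAt (semigroup Λ) (semigroup Λ t * Λ) t :=
  hasDerivAt_exp_smul_const (𝕂 := ℝ) Λ t

lemma hasDerivAt_semigroup' (Λ : E →L[ℝ] E) (t : ℝ) :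
    HasDerivAt (semigroup Λ) (Λ * semigroup Λ t) t :=
  hasDerivAt_exp_smul_const' (𝕂 := ℝ) Λ t

lemma hasDerivAt_semigroup_apply (Λ : E →L[ℝ] E) (f : E) (t : ℝ) :
    HasDerivAt (fun t => semigroup Λ t f) (semigroup Λ t (Λ f)) t := by
  simpa using (hasDerivAt_semigroup Λ t).clm_apply (hasDerivAt_const t f)

lemma hasDerivAt_semigroup_apply' (Λ : E →L[ℝ] E) (f : E) (t : ℝ) :
    HasDerivAt (fun t => semigroup Λ t f) (Λ (semigroup Λ t f)) t := by
  simpa using (hasDerivAt_semigroup' Λ t).clm_apply (hasDerivAt_const t f)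

/-- A bounded generator yields a group, so Duhamel's formula can carry the inverse flow inside its
integral. -/
lemma semigroup_neg_apply (Λ : E →L[ℝ] E) (t : ℝ) (f : E) :
    semigroup Λ t (semigroup Λ (-t) f) = f := by
  let _ : NormedAlgebra ℚ (E →L[ℝ] E) := NormedAlgebra.restrictScalars ℚ ℝ _
  have h : semigroup Λ t * semigroup Λ (-t) = 1 := by
    rw [semigroup, semigroup, neg_smul,
      ← NormedSpace.exp_add_of_commute (Commute.refl (t • Λ)).neg_right, add_neg_cancel,
      NormedSpace.exp_zero]
  simpa using congrArg (fun A : E →L[ℝ] E => A f) h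

end Semigroup

/-! ### Symmetric flows in a weighted `ℓ²` space -/

section Symmetric

variable {ι : Type*} [Fintype ι]

/-- The bilinear form with weights `w`. -/
def wip (w f g : ι → ℝ) : ℝ := ∑ i, w i * (f i * g i)

lemma wip_comm (w f g : ι → ℝ) : wip w f g = wip w g f := by
  simp only [wip]
  exact Finset.sum_congr rfl fun i _ => by ring

lemma wip_add_left (w f g h : ι → ℝ) : wip w (f + g) h = wip w f h + wip w g h := by
  simp only [wip, ← Finset.sum_add_distrib, Pi.add_apply]
  exact Finset.sum_congr rfl fun i _ => by ring

lemma wip_smul_left (w f h : ι → ℝ) (c : ℝ) : wip w (c • f) h = c * wip w f h := by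
  simp only [wip, Finset.mul_sum, Pi.smul_apply, smul_eq_mul]
  exact Finset.sum_congr rfl fun i _ => by ring

lemma wip_self_nonneg {w : ι → ℝ} (hw : ∀ i, 0 ≤ w i) (f : ι → ℝ) : 0 ≤ wip w f f :=
  Finset.sum_nonneg fun i _ => mul_nonneg (hw i) (mul_self_nonneg _)

lemma HasDerivAt.wip (w : ι → ℝ) {f g : ℝ → ι → ℝ} {f' g' : ι → ℝ} {t : ℝ}
    (hf : HasDerivAt f f' t) (hg : HasDerivAt g g' t) :
    HasDerivAt (fun t => wip w (f t) (g t)) (wip w f' (g t) + wip w (f t) g') t := by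
  have := HasDerivAt.fun_sum (u := Finset.univ) fun i _ =>
    ((hasDerivAt_pi.mp hf i).mul (hasDerivAt_pi.mp hg i)).const_mul (w i)
  refine this.congr_deriv ?_
  simp only [NoisyVoter.wip, ← Finset.sum_add_distrib, mul_add]

/-- For a flow of a symmetric operator, the squared norm is log-convex. -/
lemma convexOn_exp_mul_wip {w : ι → ℝ} (hw : ∀ i, 0 ≤ w i) (Q : (ι → ℝ) →L[ℝ] (ι → ℝ))
    (hQ : ∀ f g, wip w (Q f) g = wip w f (Q g)) {y : ℝ → ι → ℝ}
    (hy : ∀ s, HasDerivAt y (Q (y s)) s) (β : ℝ) :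
    ConvexOn ℝ Set.univ fun s => Real.exp (β * s) * wip w (y s) (y s) := by
  have hQy : ∀ s, HasDerivAt (fun s => Q (y s)) (Q (Q (y s))) s := fun s =>
    Q.hasFDerivAt.comp_hasDerivAt s (hy s)
  have he : ∀ s : ℝ, HasDerivAt (fun s => Real.exp (β * s)) (Real.exp (β * s) * β) s := fun s => by
    simpa using ((hasDerivAt_id s).const_mul β).exp
  have h1 : ∀ s, HasDerivAt (fun s => Real.exp (β * s) * wip w (y s) (y s))
      (Real.exp (β * s) * (β * wip w (y s) (y s) + 2 * wip w (y s) (Q (y s)))) s := fun s => by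
    refine ((he s).fun_mul (HasDerivAt.wip w (hy s) (hy s))).congr_deriv ?_
    rw [wip_comm w (Q (y s))]
    ring
  -- Symmetry of `Q` completes the square in the second derivative. Convexity for every `β` is what
  -- log-convexity amounts to.
  have h2 : ∀ s, HasDerivAt (fun s => Real.exp (β * s) *
      (β * wip w (y s) (y s) + 2 * wip w (y s) (Q (y s))))
      (Real.exp (β * s) * wip w (β • y s + (2 : ℝ) • Q (y s)) (β • y s + (2 : ℝ) • Q (y s))) s := by
    intro s
    refine ((he s).fun_mul (((HasDerivAt.wip w (hy s) (hy s)).const_mul β).fun_add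
      ((HasDerivAt.wip w (hy s) (hQy s)).const_mul 2))).congr_deriv ?_
    rw [← hQ (y s) (Q (y s)), wip_comm w (y s) (Q (y s))]
    simp only [wip_add_left, wip_smul_left, wip_comm w _ (β • y s + (2 : ℝ) • Q (y s))]
    simp only [wip_comm w _ (β • y s), wip_comm w _ ((2 : ℝ) • Q (y s)), wip_smul_left,
      wip_comm w (y s) (Q (y s))]
    ring
  refine convexOn_of_hasDerivWithinAt2_nonneg convex_univ
    (fun s _ => (h1 s).continuousAt.continuousWithinAt)
    (fun s _ => (h1 s).hasDerivWithinAt) (fun s _ => (h2 s).hasDerivWithinAt) fun s _ => ?_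
  exact mul_nonneg (Real.exp_pos _).le (wip_self_nonneg hw _)

/-- Jensen's inequality for the flow of a symmetric operator. -/
lemma wip_semigroup_ge {w : ι → ℝ} (hw : ∀ i, 0 ≤ w i) (Q : (ι → ℝ) →L[ℝ] (ι → ℝ))
    (hQ : ∀ f g, wip w (Q f) g = wip w f (Q g)) (f : ι → ℝ) {L : ℝ}
    (hL : -(L * wip w f f) ≤ wip w f (Q f)) (t : ℝ) (ht : 0 ≤ t) :
    wip w f f * Real.exp (-(L * t)) ≤ wip w f (semigroup Q t f) := by
  set y : ℝ → ι → ℝ := fun s => semigroup Q s f with hydef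
  have hy : ∀ s, HasDerivAt y (Q (y s)) s := fun s => hasDerivAt_semigroup_apply' Q f s
  -- By symmetry, time can be shifted from one argument to the other: the pairing of `f` with the
  -- flow at `t` is the squared norm at `t / 2`.
  have hconst : wip w (y (t - 0)) (y 0) = wip w (y (t - t / 2)) (y (t / 2)) := by
    refine eq_of_hasDerivAt_zero (φ := fun s => wip w (y (t - s)) (y s)) (fun s => ?_) 0 (t / 2)
    have hr : HasDerivAt (fun s => y (t - s)) (-(Q (y (t - s)))) s := by
      exact ((hy (t - s)).scomp s ((hasDerivAt_id s).const_sub t)).congr_deriv (by simp)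
    refine (HasDerivAt.wip w hr (hy s)).congr_deriv ?_
    rw [← hQ, ← neg_one_smul ℝ, wip_smul_left]
    ring
  have h0 : y 0 = f := semigroup_zero Q f
  rw [sub_zero, h0, wip_comm, sub_half] at hconst
  rw [hconst]
  -- For `β = 2 * L` the hypothesis `hL` says that the convex function has nonnegative slope at `0`.
  have hconv := convexOn_exp_mul_wip hw Q hQ hy (2 * L)
  set ψ : ℝ → ℝ := fun s => Real.exp (2 * L * s) * wip w (y s) (y s) with hψ
  have hd : HasDerivAt ψ (2 * L * wip w f f + 2 * wip w f (Q f)) 0 := by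
    have he : HasDerivAt (fun s => Real.exp (2 * L * s)) (Real.exp (2 * L * 0) * (2 * L)) 0 := by
      simpa using ((hasDerivAt_id (0 : ℝ)).const_mul (2 * L)).exp
    refine (he.fun_mul (HasDerivAt.wip w (hy 0) (hy 0))).congr_deriv ?_
    rw [h0, wip_comm w (Q f) f]
    simp
    ring
  have hmain : ψ 0 ≤ ψ (t / 2) := by
    rcases ht.lt_or_eq with h | h
    · have := hconv.le_slope_of_hasDerivAt (Set.mem_univ 0) (Set.mem_univ (t / 2))
        (by positivity) hd
      rw [slope_def_field, le_div_iff₀ (by linarith)] at this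
      have h3 : 0 ≤ (2 * L * wip w f f + 2 * wip w f (Q f)) * (t / 2 - 0) :=
        mul_nonneg (by linarith) (by linarith)
      linarith
    · rw [← h]; simp
  have : ψ 0 = wip w f f := by simp [hψ, h0]
  rw [this] at hmain
  have he : Real.exp (2 * L * (t / 2)) * Real.exp (-(L * t)) = 1 := by
    rw [← Real.exp_add]
    simp
    ring
  calc wip w f f * Real.exp (-(L * t)) ≤ ψ (t / 2) * Real.exp (-(L * t)) :=
        mul_le_mul_of_nonneg_right hmain (Real.exp_pos _).le
    _ = wip w (y (t / 2)) (y (t / 2)) := by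
        simp only [hψ]
        rw [mul_right_comm, he, one_mul]

end Symmetric

/-! ### Total variation distance -/

section TotalVariation

variable {S : Type*} [Fintype S]

/-- The sign of `μ - ν` is the extremal test function. -/
lemma tvDist_le_of_forall {μ ν : S → ℝ} {η : ℝ}
    (h : ∀ f : S → ℝ, (∀ s, |f s| ≤ 1) → |∑ s, μ s * f s - ∑ s, ν s * f s| ≤ η) :
    tvDist μ ν ≤ η / 2 := by
  have := h (fun s => SignType.sign (μ s - ν s)) fun s => by
    rcases lt_trichotomy (μ s - ν s) 0 with h | h | h <;> simp [h]
  rw [← Finset.sum_sub_distrib] at this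
  have h2 := (le_abs_self _).trans this
  simp only [← sub_mul, self_mul_sign] at h2
  rw [tvDist]
  linarith

/-- Chebyshev's inequality. -/
lemma sum_ite_le_of_variance {μ : S → ℝ} (hμ : ∀ s, 0 ≤ μ s) (F : S → ℝ) {c v r : ℝ} (hr : 0 < r)
    (hv : ∑ s, μ s * (F s - c) ^ 2 ≤ v) (p : S → Prop) [DecidablePred p]
    (hp : ∀ s, p s → r ≤ |F s - c|) : ∑ s, (if p s then μ s else 0) ≤ v / r ^ 2 := by
  rw [le_div_iff₀ (by positivity), Finset.sum_mul]
  refine le_trans (Finset.sum_le_sum fun s _ => ?_) hv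
  split_ifs with h
  · refine mul_le_mul_of_nonneg_left ?_ (hμ s)
    rw [← sq_abs (F s - c)]
    exact pow_le_pow_left₀ hr.le (hp s h) 2
  · rw [zero_mul]
    exact mul_nonneg (hμ s) (sq_nonneg _)

/-- A function whose means under two measures are far apart compared to its standard deviations
separates the two measures. -/
lemma tvDist_ge_of_variance {μ ν : S → ℝ} (hμ : ∀ s, 0 ≤ μ s) (hν : ∀ s, 0 ≤ ν s)
    (hμ1 : ∑ s, μ s = 1) (F : S → ℝ) {a b v : ℝ}
    (hab : a < b) (hva : ∑ s, μ s * (F s - a) ^ 2 ≤ v) (hvb : ∑ s, ν s * (F s - b) ^ 2 ≤ v)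
    (hν1 : ∑ s, ν s = 1) : 1 - 8 * v / (b - a) ^ 2 ≤ tvDist μ ν := by
  classical
  -- Thresholding `F` half way between the two means, each measure errs with small probability by
  -- Chebyshev.
  set p : S → Prop := fun s => (a + b) / 2 ≤ F s
  have h1 : ∑ s, (if p s then μ s else 0) ≤ v / ((b - a) / 2) ^ 2 :=
    sum_ite_le_of_variance hμ F (by linarith) hva p fun s hs => by
      refine le_trans ?_ (le_abs_self _)
      simp only [p] at hs
      linarith
  have h2 : ∑ s, (if ¬ p s then ν s else 0) ≤ v / ((b - a) / 2) ^ 2 :=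
    sum_ite_le_of_variance hν F (by linarith) hvb _ fun s hs => by
      rw [abs_sub_comm]
      refine le_trans ?_ (le_abs_self _)
      simp only [p, not_le] at hs
      linarith
  have h3 : ∑ s, ((if p s then ν s - μ s else 0) + (if p s then 0 else μ s - ν s)) ≤
      ∑ s, |μ s - ν s| := by
    refine Finset.sum_le_sum fun s _ => ?_
    split_ifs
    · rw [add_zero, abs_sub_comm]; exact le_abs_self _
    · rw [zero_add]; exact le_abs_self _
  have h4 : ∑ s, ((if p s then ν s - μ s else 0) + (if p s then 0 else μ s - ν s)) =
      ∑ s, (μ s + ν s - 2 * (if p s then μ s else 0) - 2 * (if ¬ p s then ν s else 0)) := by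
    refine Finset.sum_congr rfl fun s _ => ?_
    by_cases h : p s <;> simp [h] <;> ring
  rw [h4] at h3
  simp only [Finset.sum_sub_distrib, Finset.sum_add_distrib, ← Finset.mul_sum, hμ1, hν1] at h3
  have h5 : v / ((b - a) / 2) ^ 2 = 4 * v / (b - a) ^ 2 := by
    have : (b - a) ≠ 0 := by linarith
    field_simp
    ring
  rw [h5] at h1 h2
  have h6 : 8 * v / (b - a) ^ 2 = 2 * (4 * v / (b - a) ^ 2) := by ring
  rw [tvDist, h6]
  linarith

end TotalVariation

/-! ### Lineages -/

/-- The standing assumptions on the graph and the parameters of the model. -/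
structure Admissible (G : SimpleGraph V) [DecidableRel G.Adj] (q : ℕ) (θ : ℝ) : Prop where
  two_le : 2 ≤ q
  pos : 0 < θ
  le_one : θ ≤ 1
  degree_pos : ∀ u, 0 < G.degree u

/-! ### Averages over neighbours and over one update -/

section Average

variable (G : SimpleGraph V) [DecidableRel G.Adj]

/-- The average of a function over the neighbours of a vertex. -/
def walkAvg (f : V → ℝ) (u : V) : ℝ := ∑ v ∈ G.neighborFinset u, 1 / (G.degree u : ℝ) * f v

/-- The average over the outcomes of one update at `u`. -/
def noisyAvg (q : ℕ) (θ : ℝ) (u : V) (A : V → ℝ) (B : Fin q → ℝ) : ℝ :=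
  (1 - θ) * walkAvg G A u + θ * ∑ c, 1 / (q : ℝ) * B c

variable {G}

lemma walkAvg_mono {f g : V → ℝ} {u : V} (h : ∀ v, G.Adj u v → f v ≤ g v) :
    walkAvg G f u ≤ walkAvg G g u :=
  Finset.sum_le_sum fun v hv => mul_le_mul_of_nonneg_left (h v (by simpa using hv)) (by positivity)

lemma walkAvg_const {u : V} (hu : 0 < G.degree u) (a : ℝ) : walkAvg G (fun _ => a) u = a := by
  have : (G.degree u : ℝ) ≠ 0 := by positivity
  simp only [walkAvg, Finset.sum_const, SimpleGraph.card_neighborFinset_eq_degree, nsmul_eq_mul]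
  field_simp

lemma walkAvg_add (f g : V → ℝ) (u : V) :
    walkAvg G (fun v => f v + g v) u = walkAvg G f u + walkAvg G g u := by
  simp only [walkAvg, mul_add, Finset.sum_add_distrib]

lemma walkAvg_sub (f g : V → ℝ) (u : V) :
    walkAvg G (fun v => f v - g v) u = walkAvg G f u - walkAvg G g u := by
  simp only [walkAvg, mul_sub, Finset.sum_sub_distrib]

lemma walkAvg_const_mul (a : ℝ) (f : V → ℝ) (u : V) :
    walkAvg G (fun v => a * f v) u = a * walkAvg G f u := by
  simp only [walkAvg, Finset.mul_sum]
  exact Finset.sum_congr rfl fun v _ => by ring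

lemma walkAvg_sum {ι : Type*} (s : Finset ι) (f : ι → V → ℝ) (u : V) :
    walkAvg G (fun v => ∑ i ∈ s, f i v) u = ∑ i ∈ s, walkAvg G (f i) u := by
  simp only [walkAvg, Finset.mul_sum]
  exact Finset.sum_comm

lemma degree_mul_walkAvg (hd : ∀ u, 0 < G.degree u) (f : V → ℝ) (u : V) :
    (G.degree u : ℝ) * walkAvg G f u = ∑ v, if G.Adj u v then f v else 0 := by
  have : (G.degree u : ℝ) ≠ 0 := by have := hd u; positivity
  rw [walkAvg, Finset.mul_sum, ← Finset.sum_filter]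
  refine Finset.sum_congr (by ext v; simp) fun v _ => by field_simp

/-- The walk is reversible with respect to the degree. -/
lemma sum_degree_mul_walkAvg_comm (hd : ∀ u, 0 < G.degree u) (f g : V → ℝ) :
    ∑ u, (G.degree u : ℝ) * (walkAvg G f u * g u) = ∑ u, (G.degree u : ℝ) * (f u * walkAvg G g u) := by
  have h1 : ∀ u, (G.degree u : ℝ) * (walkAvg G f u * g u) =
      ∑ v, if G.Adj u v then f v * g u else 0 := fun u => by
    rw [← mul_assoc, degree_mul_walkAvg hd, Finset.sum_mul]
    exact Finset.sum_congr rfl fun v _ => by split_ifs <;> simp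
  have h2 : ∀ u, (G.degree u : ℝ) * (f u * walkAvg G g u) =
      ∑ v, if G.Adj u v then f u * g v else 0 := fun u => by
    rw [mul_left_comm, degree_mul_walkAvg hd, Finset.mul_sum]
    exact Finset.sum_congr rfl fun v _ => by split_ifs <;> simp
  simp only [h1, h2]
  rw [Finset.sum_comm]
  simp only [G.adj_comm]

lemma sum_degree_mul_walkAvg (hd : ∀ u, 0 < G.degree u) (f : V → ℝ) :
    ∑ u, (G.degree u : ℝ) * walkAvg G f u = ∑ u, (G.degree u : ℝ) * f u := by
  have := sum_degree_mul_walkAvg_comm hd f fun _ => 1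
  simpa [walkAvg_const (hd _)] using this

/-- The variance of `f` at a uniform neighbour is nonnegative. -/
lemma walkAvg_sq_le (hd : ∀ u, 0 < G.degree u) (f : V → ℝ) (u : V) :
    walkAvg G f u ^ 2 ≤ walkAvg G (fun v => f v ^ 2) u := by
  have h : 0 ≤ walkAvg G (fun v => f v ^ 2 - 2 * walkAvg G f u * f v + walkAvg G f u ^ 2) u := by
    rw [← walkAvg_const (hd u) 0]
    refine walkAvg_mono fun v _ => ?_
    nlinarith [sq_nonneg (f v - walkAvg G f u)]
  rw [walkAvg_add, walkAvg_sub, walkAvg_const (hd u), walkAvg_const_mul] at h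
  nlinarith

lemma noisyAvg_mono {q : ℕ} {θ : ℝ} (h : Admissible G q θ) {u : V} {A A' : V → ℝ} {B B' : Fin q → ℝ}
    (hA : ∀ v, G.Adj u v → A v ≤ A' v) (hB : ∀ c, B c ≤ B' c) :
    noisyAvg G q θ u A B ≤ noisyAvg G q θ u A' B' := by
  refine add_le_add (mul_le_mul_of_nonneg_left (walkAvg_mono hA) (sub_nonneg.mpr h.le_one))
    (mul_le_mul_of_nonneg_left (Finset.sum_le_sum fun c _ => ?_) h.pos.le)
  exact mul_le_mul_of_nonneg_left (hB c) (by positivity)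

lemma noisyAvg_const {q : ℕ} {θ : ℝ} (h : Admissible G q θ) (u : V) (a : ℝ) :
    noisyAvg G q θ u (fun _ => a) (fun _ => a) = a := by
  have : (q : ℝ) ≠ 0 := by have := h.two_le; positivity
  rw [noisyAvg, walkAvg_const (h.degree_pos u)]
  simp only [Finset.sum_const, Finset.card_univ, Fintype.card_fin, nsmul_eq_mul]
  field_simp
  ring

lemma noisyAvg_add {q : ℕ} {θ : ℝ} (u : V) (A A' : V → ℝ) (B B' : Fin q → ℝ) :
    noisyAvg G q θ u (fun v => A v + A' v) (fun c => B c + B' c) =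
      noisyAvg G q θ u A B + noisyAvg G q θ u A' B' := by
  simp only [noisyAvg, walkAvg_add, mul_add, Finset.sum_add_distrib]
  ring

lemma noisyAvg_const_mul {q : ℕ} {θ : ℝ} (u : V) (a : ℝ) (A : V → ℝ) (B : Fin q → ℝ) :
    noisyAvg G q θ u (fun v => a * A v) (fun c => a * B c) = a * noisyAvg G q θ u A B := by
  simp only [noisyAvg, walkAvg_const_mul, mul_add, Finset.mul_sum]
  congr 1
  · ring
  · exact Finset.sum_congr rfl fun c _ => by ring

lemma noisyAvg_sum {q : ℕ} {θ : ℝ} {ι : Type*} (s : Finset ι) (u : V) (A : ι → V → ℝ)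
    (B : ι → Fin q → ℝ) :
    noisyAvg G q θ u (fun v => ∑ i ∈ s, A i v) (fun c => ∑ i ∈ s, B i c) =
      ∑ i ∈ s, noisyAvg G q θ u (A i) (B i) := by
  simp only [noisyAvg, walkAvg_sum, Finset.sum_add_distrib, Finset.mul_sum]
  rw [Finset.sum_comm]

end Average

/-- The value of a lineage map at `v` is the vertex, or the fresh colour, that the present colour of
`v` was copied from. -/
abbrev Lineage (V : Type*) (q : ℕ) : Type _ := V → V ⊕ Fin q

/-- The configuration produced by a lineage map from the initial configuration `x`. -/
def Lineage.eval {q : ℕ} (x : V → Fin q) (Φ : Lineage V q) : V → Fin q := fun v => Sum.elim x id (Φ v)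

/-! ### The Markov chain of lineage maps -/

section LineageChain

variable (G : SimpleGraph V) [DecidableRel G.Adj] (q : ℕ) (θ : ℝ)

/-- The generator of the chain of lineage maps. -/
def lineageGen : (Lineage V q → ℝ) →L[ℝ] (Lineage V q → ℝ) :=
  LinearMap.toContinuousLinearMap
    { toFun := fun F Φ => ∑ u, (noisyAvg G q θ u (fun v => F (Function.update Φ u (Φ v)))
        (fun c => F (Function.update Φ u (Sum.inr c))) - F Φ)
      map_add' := fun F F' => by
        ext Φ
        simp only [Pi.add_apply, noisyAvg_add, ← Finset.sum_add_distrib]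
        exact Finset.sum_congr rfl fun u _ => by ring
      map_smul' := fun a F => by
        ext Φ
        simp only [Pi.smul_apply, smul_eq_mul, noisyAvg_const_mul, RingHom.id_apply, Finset.mul_sum]
        exact Finset.sum_congr rfl fun u _ => by ring }

lemma lineageGen_apply (F : Lineage V q → ℝ) (Φ : Lineage V q) :
    lineageGen G q θ F Φ = ∑ u, (noisyAvg G q θ u (fun v => F (Function.update Φ u (Φ v)))
        (fun c => F (Function.update Φ u (Sum.inr c))) - F Φ) := rfl

/-- The expectation of a function of the lineage map after time `t`. -/
def lineageExp (t : ℝ) (F : Lineage V q → ℝ) : ℝ := semigroup (lineageGen G q θ) t F Sum.inl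

variable {G q θ}

lemma hasDerivAt_lineageExp (F : Lineage V q → ℝ) (t : ℝ) :
    HasDerivAt (fun t => lineageExp G q θ t F) (lineageExp G q θ t (lineageGen G q θ F)) t :=
  hasDerivAt_pi.mp (hasDerivAt_semigroup_apply _ F t) _

lemma lineageExp_zero (F : Lineage V q → ℝ) : lineageExp G q θ 0 F = F Sum.inl := by
  rw [lineageExp, semigroup_zero]

lemma lineageExp_sum {ι : Type*} (s : Finset ι) (t : ℝ) (F : ι → Lineage V q → ℝ) :
    lineageExp G q θ t (fun Φ => ∑ i ∈ s, F i Φ) = ∑ i ∈ s, lineageExp G q θ t (F i) := by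
  have : (fun Φ => ∑ i ∈ s, F i Φ) = ∑ i ∈ s, F i := by ext; simp
  rw [lineageExp, this, map_sum, Finset.sum_apply]
  rfl

lemma lineageExp_const_mul (t a : ℝ) (F : Lineage V q → ℝ) :
    lineageExp G q θ t (fun Φ => a * F Φ) = a * lineageExp G q θ t F := by
  have : (fun Φ => a * F Φ) = a • F := by ext; simp
  rw [lineageExp, this, map_smul]
  rfl

lemma lineageExp_add (t : ℝ) (F F' : Lineage V q → ℝ) :
    lineageExp G q θ t (fun Φ => F Φ + F' Φ) = lineageExp G q θ t F + lineageExp G q θ t F' := by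
  have : (fun Φ => F Φ + F' Φ) = F + F' := by ext; simp
  rw [lineageExp, this, map_add]
  rfl

lemma lineageExp_sub (t : ℝ) (F F' : Lineage V q → ℝ) :
    lineageExp G q θ t (fun Φ => F Φ - F' Φ) = lineageExp G q θ t F - lineageExp G q θ t F' := by
  have : (fun Φ => F Φ - F' Φ) = F - F' := by ext; simp
  rw [lineageExp, this, map_sub]
  rfl

/-- Minimum principle for the backward equation. At an entry that is at most `0`, with all entries
at least `-m`, each of the `Fintype.card V` terms of the generator is at least `-m`. -/
lemma lineage_flow_nonneg (h : Admissible G q θ) {z z' : ℝ → Lineage V q → ℝ}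
    (hz : ∀ s Φ, HasDerivAt (fun s => z s Φ) (z' s Φ) s) (h0 : ∀ Φ, 0 ≤ z 0 Φ)
    (hz' : ∀ s Φ, 0 ≤ s → lineageGen G q θ (z s) Φ ≤ z' s Φ)
    {t : ℝ} (ht : 0 ≤ t) (Φ : Lineage V q) : 0 ≤ z t Φ := by
  refine nonneg_of_deriv_ge (K := Fintype.card V) (T := t) hz h0 (fun s hs _ Φ m hm hall hneg => ?_)
    ht le_rfl Φ
  refine le_trans ?_ (hz' s Φ hs)
  rw [lineageGen_apply]
  have : ∀ u ∈ Finset.univ, -m ≤ noisyAvg G q θ u (fun v => z s (Function.update Φ u (Φ v)))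
        (fun c => z s (Function.update Φ u (Sum.inr c))) - z s Φ := fun u _ => by
    have := noisyAvg_mono h (u := u) (A := fun _ => -m) (B := fun _ => -m)
      (A' := fun v => z s (Function.update Φ u (Φ v)))
      (B' := fun c => z s (Function.update Φ u (Sum.inr c))) (fun _ _ => hall _) fun _ => hall _
    rw [noisyAvg_const h] at this
    linarith
  have := Finset.card_nsmul_le_sum _ _ _ this
  simpa using this

lemma lineageExp_nonneg (h : Admissible G q θ) {t : ℝ} (ht : 0 ≤ t) {F : Lineage V q → ℝ}
    (hF : ∀ Φ, 0 ≤ F Φ) : 0 ≤ lineageExp G q θ t F :=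
  lineage_flow_nonneg h (z := fun t => semigroup (lineageGen G q θ) t F)
    (fun s Φ => hasDerivAt_pi.mp (hasDerivAt_semigroup_apply' _ F s) Φ)
    (fun Φ => by rw [semigroup_zero]; exact hF Φ) (fun _ _ _ => le_rfl) ht _

lemma lineageExp_mono (h : Admissible G q θ) {t : ℝ} (ht : 0 ≤ t) {F F' : Lineage V q → ℝ}
    (hF : ∀ Φ, F Φ ≤ F' Φ) : lineageExp G q θ t F ≤ lineageExp G q θ t F' := by
  have := lineageExp_nonneg h ht (F := fun Φ => F' Φ - F Φ) fun Φ => sub_nonneg.mpr (hF Φ)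
  rw [lineageExp_sub] at this
  linarith

lemma abs_lineageExp_le (h : Admissible G q θ) {t : ℝ} (ht : 0 ≤ t) {F F' : Lineage V q → ℝ}
    (hF : ∀ Φ, |F Φ| ≤ F' Φ) : |lineageExp G q θ t F| ≤ lineageExp G q θ t F' := by
  rw [abs_le]
  constructor
  · have := lineageExp_mono h ht (F := fun Φ => -1 * F' Φ) (F' := F) fun Φ => by
      linarith [(abs_le.mp (hF Φ)).1]
    rw [lineageExp_const_mul] at this
    linarith
  · exact lineageExp_mono h ht fun Φ => (le_abs_self _).trans (hF Φ)

lemma lineageExp_const (h : Admissible G q θ) (t a : ℝ) :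
    lineageExp G q θ t (fun _ => a) = a := by
  have h0 : lineageGen G q θ (fun _ => a) = 0 := by
    ext Φ
    simp [lineageGen_apply, noisyAvg_const h]
  have := eq_of_hasDerivAt_zero (φ := fun t => lineageExp G q θ t (fun _ => a)) (fun s => by
    have := hasDerivAt_lineageExp (G := G) (q := q) (θ := θ) (fun _ => a) s
    rw [h0] at this
    simpa [lineageExp] using this) t 0
  simpa [lineageExp_zero] using this

/-- Lyapunov function estimate: `exp (-(a * t)) * F` is a supersolution of the backward equation
with the same initial value. -/
lemma lineageExp_le_exp_mul (h : Admissible G q θ) {t : ℝ} (ht : 0 ≤ t) {F : Lineage V q → ℝ} {a : ℝ}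
    (hF : ∀ Φ, lineageGen G q θ F Φ ≤ -(a * F Φ)) :
    lineageExp G q θ t F ≤ Real.exp (-(a * t)) * F Sum.inl := by
  have key := lineage_flow_nonneg h
    (z := fun t Φ => Real.exp (-(a * t)) * F Φ - semigroup (lineageGen G q θ) t F Φ)
    (z' := fun t Φ => Real.exp (-(a * t)) * -(a * F Φ) -
      lineageGen G q θ (semigroup (lineageGen G q θ) t F) Φ) (fun s Φ => ?_) (fun Φ => ?_)
    (fun s Φ _ => ?_) ht Sum.inl
  · exact sub_nonneg.mp key
  · have h1 : HasDerivAt (fun s => Real.exp (-(a * s))) (Real.exp (-(a * s)) * -a) s := by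
      simpa using (((hasDerivAt_id s).const_mul a).neg).exp
    refine ((h1.mul_const (F Φ)).fun_sub
      (hasDerivAt_pi.mp (hasDerivAt_semigroup_apply' _ F s) Φ)).congr_deriv ?_
    ring
  · simp [semigroup_zero]
  · have : (fun Φ => Real.exp (-(a * s)) * F Φ - semigroup (lineageGen G q θ) s F Φ) =
        Real.exp (-(a * s)) • F - semigroup (lineageGen G q θ) s F := by ext; simp
    rw [this, map_sub, map_smul]
    have := mul_le_mul_of_nonneg_left (hF Φ) (Real.exp_pos (-(a * s))).le
    simp only [Pi.sub_apply, Pi.smul_apply, smul_eq_mul]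
    linarith

end LineageChain

/-! ### The voter semigroup and its lineage representation -/

section VoterSemigroup

variable {G : SimpleGraph V} [DecidableRel G.Adj] {q : ℕ} {θ : ℝ}

/-- Kolmogorov's forward and backward equations. -/
lemma hasDerivAt_transition_mulVec (f : (V → Fin q) → ℝ) (x : V → Fin q) (t : ℝ) :
    HasDerivAt (fun t => (transition G q θ t *ᵥ f) x)
      ((transition G q θ t *ᵥ (generator G q θ *ᵥ f)) x) t ∧
    HasDerivAt (fun t => (transition G q θ t *ᵥ f) x)
      ((generator G q θ *ᵥ (transition G q θ t *ᵥ f)) x) t := by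
  let _ : NormedRing (Matrix (V → Fin q) (V → Fin q) ℝ) := Matrix.linftyOpNormedRing
  let _ : NormedAlgebra ℝ (Matrix (V → Fin q) (V → Fin q) ℝ) := Matrix.linftyOpNormedAlgebra
  let ev : Matrix (V → Fin q) (V → Fin q) ℝ →ₗ[ℝ] ℝ :=
    { toFun := fun A => (A *ᵥ f) x
      map_add' := fun A B => by simp [Matrix.add_mulVec]
      map_smul' := fun c A => by simp [Matrix.smul_mulVec] }
  have h1 := hasDerivAt_exp_smul_const (𝕂 := ℝ) (generator G q θ) t
  have h2 := hasDerivAt_exp_smul_const' (𝕂 := ℝ) (generator G q θ) t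
  constructor
  · rw [Matrix.mulVec_mulVec]
    exact (LinearMap.toContinuousLinearMap ev).hasFDerivAt.comp_hasDerivAt t h1
  · rw [Matrix.mulVec_mulVec]
    exact (LinearMap.toContinuousLinearMap ev).hasFDerivAt.comp_hasDerivAt t h2

lemma transition_zero : transition G q θ 0 = 1 := by
  rw [transition, zero_smul, NormedSpace.exp_zero]

lemma transition_add (s t : ℝ) :
    transition G q θ (s + t) = transition G q θ s * transition G q θ t := by
  rw [transition, transition, transition, add_smul]
  exact Matrix.exp_add_of_commute _ _ (((Commute.refl _).smul_left s).smul_right t)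

lemma generator_mulVec_eq_noisyAvg (f : (V → Fin q) → ℝ) (x : V → Fin q) :
    (generator G q θ *ᵥ f) x = ∑ u, (noisyAvg G q θ u (fun v => f (Function.update x u (x v)))
        (fun c => f (Function.update x u c)) - f x) := by
  rw [generator_mulVec]
  exact Finset.sum_congr rfl fun u _ => by rw [siteUpdate_mulVec]; rfl

/-- This intertwines the generator of the lineage chain with that of the voter model. -/
lemma Lineage.eval_update (x : V → Fin q) (Φ : Lineage V q) (u : V) (a : V ⊕ Fin q) :
    Lineage.eval x (Function.update Φ u a) =
      Function.update (Lineage.eval x Φ) u (Sum.elim x id a) := by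
  ext v
  by_cases h : v = u
  · subst h; simp [Lineage.eval]
  · simp [Lineage.eval, h]

/-- The voter semigroup averages over random lineage maps. -/
lemma transition_mulVec_eq_lineageExp (h : Admissible G q θ) (f : (V → Fin q) → ℝ) (x : V → Fin q)
    {t : ℝ} (ht : 0 ≤ t) :
    (transition G q θ t *ᵥ f) x = lineageExp G q θ t fun Φ => f (Φ.eval x) := by
  -- Both sides are extended to an arbitrary starting lineage map; their difference solves the
  -- homogeneous backward equation from zero, and the minimum principle applies to it and to its
  -- negative.
  set z : ℝ → Lineage V q → ℝ := fun t Φ => semigroup (lineageGen G q θ) t (fun Φ => f (Φ.eval x)) Φ -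
    (transition G q θ t *ᵥ f) (Φ.eval x) with hz
  have hd : ∀ s Φ, HasDerivAt (fun s => z s Φ) (lineageGen G q θ (z s) Φ) s := by
    intro s Φ
    refine ((hasDerivAt_pi.mp (hasDerivAt_semigroup_apply' (lineageGen G q θ) _ s) Φ).fun_sub
      (hasDerivAt_transition_mulVec (G := G) (θ := θ) f (Φ.eval x) s).2).congr_deriv ?_
    have : z s = semigroup (lineageGen G q θ) s (fun Φ => f (Φ.eval x)) -
      fun Φ => (transition G q θ s *ᵥ f) (Φ.eval x) := rfl
    rw [this, map_sub, Pi.sub_apply, generator_mulVec_eq_noisyAvg, 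
      lineageGen_apply G q θ (fun Φ => (transition G q θ s *ᵥ f) (Φ.eval x))]
    simp only [Lineage.eval_update]
    rfl
  have h0 : ∀ Φ, z 0 Φ = 0 := fun Φ => by simp [hz, semigroup_zero, transition_zero]
  have h1 := lineage_flow_nonneg h hd (fun Φ => (h0 Φ).ge) (fun _ _ _ => le_rfl) ht Sum.inl
  have h2 := lineage_flow_nonneg h (z := fun s Φ => -z s Φ) (fun s Φ => (hd s Φ).neg)
    (fun Φ => by simp [h0]) (fun s Φ _ => by
      have : (fun Φ => -z s Φ) = -z s := rfl
      rw [this, map_neg, Pi.neg_apply]) ht Sum.inl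
  have h3 : z t Sum.inl = 0 := le_antisymm (neg_nonneg.mp h2) h1
  have h4 : Lineage.eval x (Sum.inl : Lineage V q) = x := rfl
  simp only [hz, h4] at h3
  rw [lineageExp]
  linarith

lemma transition_mulVec_mono (h : Admissible G q θ) {f g : (V → Fin q) → ℝ} (hfg : ∀ x, f x ≤ g x)
    (x : V → Fin q) {t : ℝ} (ht : 0 ≤ t) : (transition G q θ t *ᵥ f) x ≤ (transition G q θ t *ᵥ g) x := by
  rw [transition_mulVec_eq_lineageExp h _ _ ht, transition_mulVec_eq_lineageExp h _ _ ht]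
  exact lineageExp_mono h ht fun _ => hfg _

lemma transition_mulVec_const (h : Admissible G q θ) (a : ℝ) (x : V → Fin q) {t : ℝ} (ht : 0 ≤ t) :
    (transition G q θ t *ᵥ fun _ => a) x = a := by
  rw [transition_mulVec_eq_lineageExp h _ _ ht, lineageExp_const h]

lemma transition_nonneg (h : Admissible G q θ) (x y : V → Fin q) {t : ℝ} (ht : 0 ≤ t) :
    0 ≤ transition G q θ t x y := by
  have := transition_mulVec_mono h (f := fun _ => 0) (g := Pi.single y 1)
    (fun z => by by_cases hz : z = y <;> simp [hz]) x ht
  rw [transition_mulVec_const h 0 x ht] at this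
  simpa using this

lemma sum_transition (h : Admissible G q θ) (x : V → Fin q) {t : ℝ} (ht : 0 ≤ t) :
    ∑ y, transition G q θ t x y = 1 := by
  simpa [Matrix.mulVec, dotProduct] using transition_mulVec_const h 1 x ht

end VoterSemigroup

/-! ### The kernel of a single lineage -/

section Kernel

variable {G : SimpleGraph V} [DecidableRel G.Adj] {q : ℕ} {θ : ℝ}

/-- Comparison principle for the killed walk. -/
lemma walk_nonneg (h : Admissible G q θ) {z z' : ℝ → V → ℝ} {c T : ℝ} (hc : 0 ≤ c)
    (hz : ∀ s v, HasDerivAt (fun s => z s v) (z' s v) s) (h0 : ∀ v, 0 ≤ z 0 v)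
    (hz' : ∀ s v, 0 ≤ s → s ≤ T → (1 - θ) * walkAvg G (z s) v - c * z s v ≤ z' s v)
    {t : ℝ} (ht : 0 ≤ t) (htT : t ≤ T) (v : V) : 0 ≤ z t v := by
  refine nonneg_of_deriv_ge (K := 1) (T := T) hz h0 (fun s hs hsT v m hm hall hneg => ?_) ht htT v
  refine le_trans ?_ (hz' s v hs hsT)
  have h1 : -m ≤ walkAvg G (z s) v := by
    rw [← walkAvg_const (h.degree_pos v) (-m)]
    exact walkAvg_mono fun _ _ => hall _
  have h2 := mul_le_mul_of_nonneg_left h1 (sub_nonneg.mpr h.le_one)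
  have h3 : 0 ≤ θ * m := mul_nonneg h.pos.le hm
  have h4 : c * z s v ≤ 0 := mul_nonpos_of_nonneg_of_nonpos hc hneg
  nlinarith

/-- The generator acts on a function of one lineage as the killed walk. -/
lemma lineageGen_single (h : Admissible G q θ) (ψ : V ⊕ Fin q → ℝ) (hψ : ∀ c, ψ (Sum.inr c) = 0)
    (a : V) (Φ : Lineage V q) :
    lineageGen G q θ (fun Φ => ψ (Φ a)) Φ = (1 - θ) * walkAvg G (fun v => ψ (Φ v)) a - ψ (Φ a) := by
  rw [lineageGen_apply, Finset.sum_eq_single a]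
  · simp [noisyAvg, hψ]
  · intro u _ hu
    simp only [Function.update_of_ne hu.symm]
    rw [noisyAvg_const h, sub_self]
  · simp

/-- The probability that the lineage of `a` after time `t` is alive at `u`. -/
def kernel (G : SimpleGraph V) [DecidableRel G.Adj] (q : ℕ) (θ t : ℝ) (a u : V) : ℝ :=
  lineageExp G q θ t fun Φ => if Φ a = Sum.inl u then 1 else 0

lemma kernel_nonneg (h : Admissible G q θ) {t : ℝ} (ht : 0 ≤ t) (a u : V) :
    0 ≤ kernel G q θ t a u :=
  lineageExp_nonneg h ht fun Φ => by split_ifs <;> simp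

lemma sum_kernel_mul (t : ℝ) (a : V) (ψ : V → ℝ) :
    ∑ u, kernel G q θ t a u * ψ u =
      lineageExp G q θ t fun Φ => Sum.elim ψ (fun _ => 0) (Φ a) := by
  simp only [kernel, mul_comm _ (ψ _), ← lineageExp_const_mul, ← lineageExp_sum]
  congr 1
  ext Φ
  rcases hΦ : Φ a with v | c <;> simp

/-- If `ψ` is a strict supersolution of the walk, its expectation along a lineage decays. -/
lemma sum_kernel_mul_le (h : Admissible G q θ) {t : ℝ} (ht : 0 ≤ t) (ψ : V → ℝ) (κ : ℝ)
    (hψ : ∀ v, (1 - θ) * walkAvg G ψ v - ψ v ≤ -(κ * ψ v)) (a : V) :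
    ∑ u, kernel G q θ t a u * ψ u ≤ Real.exp (-(κ * t)) * ψ a := by
  set F : V → Lineage V q → ℝ := fun a Φ => Sum.elim ψ (fun _ => 0) (Φ a) with hF
  have key := walk_nonneg h (c := 1) (T := t)
    (z := fun t a => Real.exp (-(κ * t)) * ψ a - lineageExp G q θ t (F a))
    (z' := fun t a => Real.exp (-(κ * t)) * -(κ * ψ a) -
      lineageExp G q θ t (lineageGen G q θ (F a))) zero_le_one (fun s v => ?_) (fun v => ?_)
      (fun s v hs _ => ?_) ht le_rfl a
  · rw [sum_kernel_mul]
    exact sub_nonneg.mp key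
  · have h1 : HasDerivAt (fun s => Real.exp (-(κ * s))) (Real.exp (-(κ * s)) * -κ) s := by
      simpa using (((hasDerivAt_id s).const_mul κ).neg).exp
    refine ((h1.mul_const (ψ v)).fun_sub (hasDerivAt_lineageExp (F v) s)).congr_deriv ?_
    ring
  · simp [lineageExp_zero, hF]
  · have h1 : lineageGen G q θ (F v) = fun Φ => (1 - θ) * walkAvg G (fun v => F v Φ) v - F v Φ := by
      ext Φ
      exact lineageGen_single h (Sum.elim ψ fun _ => 0) (fun _ => rfl) v Φ
    -- An update at `v` hands it the lineage of a neighbour, so the expectations, as functions of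
    -- the vertex, themselves satisfy the killed walk equation.
    have h2 : lineageExp G q θ s (lineageGen G q θ (F v)) =
        (1 - θ) * walkAvg G (fun v => lineageExp G q θ s (F v)) v - lineageExp G q θ s (F v) := by
      rw [h1, lineageExp_sub, lineageExp_const_mul]
      simp only [walkAvg]
      rw [lineageExp_sum]
      simp only [lineageExp_const_mul]
    rw [h2, walkAvg_sub, walkAvg_const_mul]
    have := mul_le_mul_of_nonneg_left (hψ v) (Real.exp_pos (-(κ * s))).le
    linarith

lemma sum_kernel_le (h : Admissible G q θ) {t : ℝ} (ht : 0 ≤ t) (a : V) :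
    ∑ u, kernel G q θ t a u ≤ Real.exp (-(θ * t)) := by
  simpa using sum_kernel_mul_le h ht (fun _ => 1) θ (fun v => by
    rw [walkAvg_const (h.degree_pos v)]; linarith) a

/-! ### The set of ancestors -/

/-- The total degree of the vertices whose lineage ends at `w`. -/
def mass (G : SimpleGraph V) [DecidableRel G.Adj] {q : ℕ} (w : V) (Φ : Lineage V q) : ℝ :=
  ∑ v, (G.degree v : ℝ) * if Φ v = Sum.inl w then 1 else 0

lemma mass_nonneg (w : V) (Φ : Lineage V q) : 0 ≤ mass G w Φ :=
  Finset.sum_nonneg fun v _ => by split_ifs <;> simp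

lemma mass_update (w u : V) (Φ : Lineage V q) (a : V ⊕ Fin q) :
    mass G w (Function.update Φ u a) = mass G w Φ + (G.degree u : ℝ) *
      ((if a = Sum.inl w then 1 else 0) - (if Φ u = Sum.inl w then 1 else 0)) := by
  rw [mass, mass, ← Finset.add_sum_erase _ _ (Finset.mem_univ u),
    ← Finset.add_sum_erase _ _ (Finset.mem_univ u)]
  rw [Finset.sum_congr (g := fun v => (G.degree v : ℝ) * if Φ v = Sum.inl w then 1 else 0) rfl
    fun v hv => by rw [Function.update_of_ne (Finset.ne_of_mem_erase hv)]]
  rw [Function.update_self]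
  ring

/-- The expansion of the product may be stopped at first order, because the sign condition makes the
cross terms created at each induction step nonpositive. It expresses negative dependence of the
increments. -/
lemma prod_add_le {ι : Type*} [DecidableEq ι] (S : Finset ι) (D δ : ι → ℝ) (hD : ∀ i, 0 ≤ D i)
    (hDδ : ∀ i, 0 ≤ D i + δ i) (hδ : ∀ i j, i ≠ j → δ i * δ j ≤ 0) :
    ∏ i ∈ S, (D i + δ i) ≤ ∏ i ∈ S, D i + ∑ i ∈ S, δ i * ∏ j ∈ S.erase i, D j := by
  induction S using Finset.induction_on with
  | empty => simp
  | insert a S ha ih =>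
    rw [Finset.prod_insert ha, Finset.prod_insert ha, Finset.sum_insert ha, Finset.erase_insert ha]
    have h1 := mul_le_mul_of_nonneg_left ih (hDδ a)
    have h2 : ∑ i ∈ S, δ i * ∏ j ∈ (insert a S).erase i, D j =
        D a * ∑ i ∈ S, δ i * ∏ j ∈ S.erase i, D j := by
      rw [Finset.mul_sum]
      refine Finset.sum_congr rfl fun i hi => ?_
      have hia : a ≠ i := by rintro rfl; exact ha hi
      rw [Finset.erase_insert_of_ne hia, Finset.prod_insert (by simp [ha])]
      ring
    have h3 : δ a * ∑ i ∈ S, δ i * ∏ j ∈ S.erase i, D j ≤ 0 := by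
      rw [Finset.mul_sum]
      refine Finset.sum_nonpos fun i hi => ?_
      rw [← mul_assoc]
      refine mul_nonpos_of_nonpos_of_nonneg (hδ a i ?_) (Finset.prod_nonneg fun j _ => hD j)
      rintro rfl; exact ha hi
    rw [h2]
    nlinarith

/-- An update at `u` takes weight `G.degree u` from at most one mass and gives it to at most one
other, so increments at distinct vertices never have the same strict sign and `prod_add_le` leaves
only first-order terms. Reversibility with respect to the degree conserves each mass under copying,
so each factor decays at rate `θ`, as for independent lineages. -/
lemma lineageGen_prod_mass_le (h : Admissible G q θ) (S : Finset V) (Φ : Lineage V q) :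
    lineageGen G q θ (fun Φ => ∏ w ∈ S, mass G w Φ) Φ ≤ -(θ * S.card * ∏ w ∈ S, mass G w Φ) := by
  have hup : ∀ u a, ∏ w ∈ S, mass G w (Function.update Φ u a) ≤ ∏ w ∈ S, mass G w Φ +
      ∑ w ∈ S, ((G.degree u : ℝ) *
      ((if a = Sum.inl w then 1 else 0) - (if Φ u = Sum.inl w then 1 else 0))) *
        ∏ j ∈ S.erase w, mass G j Φ := by
    intro u a
    simp only [mass_update]
    refine prod_add_le S _ _ (fun w => mass_nonneg w Φ) (fun w => ?_) fun w w' hw => ?_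
    · rw [← mass_update]
      exact mass_nonneg _ _
    · have : ∀ b : V ⊕ Fin q, b = Sum.inl w → b ≠ Sum.inl w' := by
        rintro b rfl h'
        exact hw (Sum.inl_injective h')
      have h3 : 0 ≤ (G.degree u : ℝ) ^ 2 := by positivity
      split_ifs with h1 h2 h3 h4 <;>
      first
      | exact absurd ‹a = Sum.inl w'› (this _ ‹a = Sum.inl w›)
      | exact absurd ‹Φ u = Sum.inl w'› (this _ ‹Φ u = Sum.inl w›)
      | nlinarith
  set I : V → V → ℝ := fun w v => if Φ v = Sum.inl w then 1 else 0 with hI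
  have hu : ∀ u, noisyAvg G q θ u (fun v => ∏ w ∈ S, mass G w (Function.update Φ u (Φ v)))
      (fun c => ∏ w ∈ S, mass G w (Function.update Φ u (Sum.inr c))) - ∏ w ∈ S, mass G w Φ ≤
      ∑ w ∈ S, (G.degree u : ℝ) * ((1 - θ) * walkAvg G (I w) u - I w u) *
        ∏ j ∈ S.erase w, mass G j Φ := by
    intro u
    have := noisyAvg_mono h (u := u) (fun v _ => hup u (Φ v)) (fun c => hup u (Sum.inr c))
    rw [noisyAvg_add, noisyAvg_const h, noisyAvg_sum] at this
    refine (sub_le_iff_le_add'.mpr this).trans (Finset.sum_le_sum fun w _ => le_of_eq ?_)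
    have e : ∀ A B, noisyAvg G q θ u (fun v => (G.degree u : ℝ) * (A v - I w u) *
        ∏ j ∈ S.erase w, mass G j Φ) (fun c => (G.degree u : ℝ) * (B c - I w u) *
        ∏ j ∈ S.erase w, mass G j Φ) = (G.degree u : ℝ) * (noisyAvg G q θ u A B - I w u) *
        ∏ j ∈ S.erase w, mass G j Φ := by
      intro A B
      have e1 : ∀ y : ℝ, (G.degree u : ℝ) * (y - I w u) * ∏ j ∈ S.erase w, mass G j Φ =
        ((G.degree u : ℝ) * ∏ j ∈ S.erase w, mass G j Φ) * (y + -I w u) := fun y => by ring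
      simp only [e1]
      rw [noisyAvg_const_mul, noisyAvg_add, noisyAvg_const h]
    refine (e (I w) (fun c => if (Sum.inr c : V ⊕ Fin q) = Sum.inl w then 1 else 0)).trans ?_
    simp [noisyAvg]
  rw [lineageGen_apply]
  refine (Finset.sum_le_sum fun u _ => hu u).trans (le_of_eq ?_)
  rw [Finset.sum_comm]
  have hw : ∀ w ∈ S, ∑ u, (G.degree u : ℝ) * ((1 - θ) * walkAvg G (I w) u - I w u) *
        ∏ j ∈ S.erase w, mass G j Φ = -(θ * ∏ w ∈ S, mass G w Φ) := by
    intro w hw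
    rw [← Finset.sum_mul]
    have : ∑ u, (G.degree u : ℝ) * ((1 - θ) * walkAvg G (I w) u - I w u) = -θ * mass G w Φ := by
      simp only [mul_sub, Finset.sum_sub_distrib, mul_left_comm _ (1 - θ)]
      rw [← Finset.mul_sum, sum_degree_mul_walkAvg h.degree_pos]
      simp only [mass, hI]
      ring
    rw [this, ← Finset.mul_prod_erase S _ hw]
    ring
  rw [Finset.sum_congr rfl hw, Finset.sum_const, nsmul_eq_mul]
  ring

/-- The set of vertices at which some lineage is alive. -/
def ancestors (Φ : Lineage V q) : Finset V := Finset.univ.filter fun w => ∃ v, Φ v = Sum.inl w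

/-- The ancestors are at most as dense as those of independent walks. -/
lemma lineageExp_subset_ancestors_le (h : Admissible G q θ) {Δ : ℝ} (hΔ0 : 0 ≤ Δ)
    (hΔ : ∀ v, (G.degree v : ℝ) ≤ Δ) {t : ℝ} (ht : 0 ≤ t) (S : Finset V) :
    lineageExp G q θ t (fun Φ => if S ⊆ ancestors Φ then 1 else 0) ≤
      (Δ * Real.exp (-(θ * t))) ^ S.card := by
  -- Every ancestor has a descendant, of degree at least one, hence mass at least one.
  have h1 : lineageExp G q θ t (fun Φ => if S ⊆ ancestors Φ then 1 else 0) ≤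
      lineageExp G q θ t (fun Φ => ∏ w ∈ S, mass G w Φ) := by
    refine lineageExp_mono h ht fun Φ => ?_
    split_ifs with hS
    · rw [← Finset.prod_const_one (s := S)]
      refine Finset.prod_le_prod (fun _ _ => zero_le_one) fun w hw => ?_
      obtain ⟨v, hv⟩ := (Finset.mem_filter.mp (hS hw)).2
      rw [mass]
      refine le_trans ?_ (Finset.single_le_sum (f := fun v => (G.degree v : ℝ) *
        if Φ v = Sum.inl w then 1 else 0) (fun v _ => by split_ifs <;> simp) (Finset.mem_univ v))
      simp only [hv, if_true, mul_one]
      exact_mod_cast h.degree_pos v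
    · exact Finset.prod_nonneg fun w _ => mass_nonneg w Φ
  have h2 := lineageExp_le_exp_mul h ht (lineageGen_prod_mass_le h S)
  refine h1.trans (h2.trans ?_)
  have h3 : ∀ w, mass G w (Sum.inl : Lineage V q) ≤ Δ := fun w => by simpa [mass] using hΔ w
  rw [mul_pow, ← Real.exp_nat_mul, mul_comm]
  refine mul_le_mul ?_ (le_of_eq (by ring_nf)) (Real.exp_pos _).le ?_
  · rw [← Finset.prod_const]
    exact Finset.prod_le_prod (fun w _ => mass_nonneg w _) (fun w _ => h3 w)
  · exact pow_nonneg hΔ0 _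

lemma sum_degree_mul_kernel_le (h : Admissible G q θ) {t : ℝ} (ht : 0 ≤ t) (u : V) :
    ∑ a, (G.degree a : ℝ) * kernel G q θ t a u ≤ Real.exp (-(θ * t)) * G.degree u := by
  have h2 := lineageExp_le_exp_mul h ht (lineageGen_prod_mass_le h {u})
  simp only [Finset.prod_singleton, Finset.card_singleton, Nat.cast_one, mul_one] at h2
  have e : mass G u (Sum.inl : Lineage V q) = G.degree u := by simp [mass]
  rw [e] at h2
  refine le_trans (le_of_eq ?_) h2
  simp only [kernel, ← lineageExp_const_mul, ← lineageExp_sum]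
  rfl

lemma sum_kernel_left_le (h : Admissible G q θ) {Δ : ℝ} (hΔ : ∀ v, (G.degree v : ℝ) ≤ Δ)
    {t : ℝ} (ht : 0 ≤ t) (u : V) : ∑ a, kernel G q θ t a u ≤ Δ * Real.exp (-(θ * t)) := by
  refine le_trans (Finset.sum_le_sum fun a _ => ?_) ((sum_degree_mul_kernel_le h ht u).trans ?_)
  · have h1 : (1 : ℝ) ≤ G.degree a := by exact_mod_cast h.degree_pos a
    nlinarith [kernel_nonneg h ht a u]
  · rw [mul_comm]
    exact mul_le_mul_of_nonneg_right (hΔ u) (Real.exp_pos _).le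

end Kernel

/-! ### Influences -/

/-- Changing the colour at `a` changes `f` by at most `o a`. -/
def HasInfluence {q : ℕ} (f : (V → Fin q) → ℝ) (o : V → ℝ) : Prop :=
  ∀ x a c, |f (Function.update x a c) - f x| ≤ o a

/-- The mean of `f` under the weights `μ`. -/
def expect {S : Type*} [Fintype S] (μ f : S → ℝ) : ℝ := ∑ x, μ x * f x

/-! ### Means with respect to weights -/

section Expect

variable {S : Type*} [Fintype S]

lemma expect_mono {μ f g : S → ℝ} (hμ : ∀ x, 0 ≤ μ x) (h : ∀ x, f x ≤ g x) :
    expect μ f ≤ expect μ g :=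
  Finset.sum_le_sum fun x _ => mul_le_mul_of_nonneg_left (h x) (hμ x)

lemma expect_const {μ : S → ℝ} (hμ : ∑ x, μ x = 1) (a : ℝ) : expect μ (fun _ => a) = a := by
  rw [expect, ← Finset.sum_mul, hμ, one_mul]

lemma expect_add (μ f g : S → ℝ) : expect μ (fun x => f x + g x) = expect μ f + expect μ g := by
  simp only [expect, mul_add, Finset.sum_add_distrib]

lemma expect_sub (μ f g : S → ℝ) : expect μ (fun x => f x - g x) = expect μ f - expect μ g := by
  simp only [expect, mul_sub, Finset.sum_sub_distrib]

lemma expect_const_mul (μ f : S → ℝ) (a : ℝ) : expect μ (fun x => a * f x) = a * expect μ f := by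
  simp only [expect, Finset.mul_sum]
  exact Finset.sum_congr rfl fun x _ => by ring

lemma expect_sum {ι : Type*} (s : Finset ι) (μ : S → ℝ) (f : ι → S → ℝ) :
    expect μ (fun x => ∑ i ∈ s, f i x) = ∑ i ∈ s, expect μ (f i) := by
  simp only [expect, Finset.mul_sum]
  exact Finset.sum_comm

lemma abs_expect_le {μ f : S → ℝ} (hμ : ∀ x, 0 ≤ μ x) (hμ1 : ∑ x, μ x = 1) {M : ℝ}
    (h : ∀ x, |f x| ≤ M) : |expect μ f| ≤ M := by
  rw [abs_le]
  constructor
  · rw [← expect_const hμ1 (-M)]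
    exact expect_mono hμ fun x => (abs_le.mp (h x)).1
  · rw [← expect_const hμ1 M]
    exact expect_mono hμ fun x => (abs_le.mp (h x)).2

lemma expect_variance {μ : S → ℝ} (hμ1 : ∑ x, μ x = 1) (f : S → ℝ) :
    ∑ x, μ x * (f x - expect μ f) ^ 2 = expect μ (fun x => f x * f x) - expect μ f * expect μ f := by
  have : ∀ m : ℝ, ∑ x, μ x * (f x - m) ^ 2 = expect μ (fun x => f x * f x) -
      2 * m * expect μ f + m ^ 2 * ∑ x, μ x := fun m => by
    simp only [expect, Finset.mul_sum, ← Finset.sum_add_distrib, ← Finset.sum_sub_distrib]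
    exact Finset.sum_congr rfl fun x _ => by ring
  rw [this, hμ1]
  ring

end Expect

section Influence

variable {G : SimpleGraph V} [DecidableRel G.Adj] {q : ℕ} {θ : ℝ}

/-- Turn `y` into `x` one vertex at a time; vertices with equal colours cost nothing. -/
lemma HasInfluence.abs_sub_le {f : (V → Fin q) → ℝ} {o : V → ℝ} (hf : HasInfluence f o)
    (x y : V → Fin q) : |f x - f y| ≤ ∑ a, if x a ≠ y a then o a else 0 := by
  have key : ∀ s : Finset V, |f (fun v => if v ∈ s then x v else y v) - f y| ≤
      ∑ a ∈ s, if x a ≠ y a then o a else 0 := by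
    intro s
    induction s using Finset.induction_on with
    | empty => simp
    | insert a s ha ih =>
      rw [Finset.sum_insert ha]
      have e : (fun v => if v ∈ insert a s then x v else y v) =
          Function.update (fun v => if v ∈ s then x v else y v) a (x a) := by
        ext v
        by_cases hv : v = a
        · subst hv; simp
        · simp [hv]
      rw [e]
      have h1 := hf (fun v => if v ∈ s then x v else y v) a (x a)
      have h2 : |f (Function.update (fun v => if v ∈ s then x v else y v) a (x a)) -
          f (fun v => if v ∈ s then x v else y v)| ≤ if x a ≠ y a then o a else 0 := by
        split_ifs with hxy
        · exact h1
        · have : Function.update (fun v => if v ∈ s then x v else y v) a (x a) =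
              fun v => if v ∈ s then x v else y v := by
            rw [Function.update_eq_self_iff]
            simp only [ne_eq, not_not] at hxy
            simp [ha, hxy]
          simp [this]
      exact (_root_.abs_sub_le _ (f fun v => if v ∈ s then x v else y v) _).trans (add_le_add h2 ih)
  simpa using key Finset.univ

lemma HasInfluence.nonneg {f : (V → Fin q) → ℝ} {o : V → ℝ} (hf : HasInfluence f o)
    (x : V → Fin q) (a : V) : 0 ≤ o a :=
  (abs_nonneg _).trans (hf x a (x a))

/-- A bounded function that depends only on the colours in `R` has no influences outside `R`. -/
lemma hasInfluence_of_dependsOn {f : (V → Fin q) → ℝ} {R : Finset V} {M : ℝ}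
    (hf : ∀ x y, |f x - f y| ≤ M)
    (hR : ∀ x y, (∀ v ∈ R, x v = y v) → f x = f y) :
    HasInfluence f fun a => if a ∈ R then M else 0 := by
  intro x a c
  dsimp only
  split_ifs with ha
  · exact hf _ _
  · rw [hR _ x fun v hv => Function.update_of_ne (by rintro rfl; exact ha hv) _ _]
    simp

/-- The initial colour at `u` is felt at `a` only if the lineage of `a` is alive at `u`, so
influences are transported by the kernel. -/
lemma HasInfluence.transition (h : Admissible G q θ) {f : (V → Fin q) → ℝ} {o : V → ℝ}
    (hf : HasInfluence f o) {t : ℝ} (ht : 0 ≤ t) :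
    HasInfluence (transition G q θ t *ᵥ f) fun u => ∑ a, o a * kernel G q θ t a u := by
  intro x u c
  rw [transition_mulVec_eq_lineageExp h _ _ ht, transition_mulVec_eq_lineageExp h _ _ ht,
    ← lineageExp_sub]
  simp only [kernel, ← lineageExp_const_mul, ← lineageExp_sum]
  refine abs_lineageExp_le h ht fun Φ => (hf.abs_sub_le _ _).trans
    (Finset.sum_le_sum fun a _ => ?_)
  have ho := hf.nonneg x a
  split_ifs with h1 h2 h2
  · rw [mul_one]
  · exfalso
    apply h1
    rcases hΦ : Φ a with v | c'
    · have : v ≠ u := by rintro rfl; exact h2 hΦ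
      simp [Lineage.eval, hΦ, this]
    · simp [Lineage.eval, hΦ]
  · simpa using ho
  · simp

lemma abs_transition_mulVec_sub_le (h : Admissible G q θ) {f : (V → Fin q) → ℝ} {o : V → ℝ}
    (hf : HasInfluence f o) {t : ℝ} (ht : 0 ≤ t) (x y : V → Fin q) :
    |(transition G q θ t *ᵥ f) x - (transition G q θ t *ᵥ f) y| ≤ Real.exp (-(θ * t)) * ∑ a, o a := by
  refine ((hf.transition h ht).abs_sub_le x y).trans ?_
  have ho := hf.nonneg x
  refine (Finset.sum_le_sum (g := fun u => ∑ a, o a * kernel G q θ t a u) fun u _ => ?_).trans ?_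
  · split_ifs
    · exact le_rfl
    · exact Finset.sum_nonneg fun a _ => mul_nonneg (ho a) (kernel_nonneg h ht a u)
  · rw [Finset.sum_comm, Finset.mul_sum]
    refine Finset.sum_le_sum fun a _ => ?_
    rw [← Finset.mul_sum, mul_comm]
    exact mul_le_mul_of_nonneg_right (sum_kernel_le h ht a) (ho a)

end Influence

/-! ### Covariances -/

section Covariance

variable {G : SimpleGraph V} [DecidableRel G.Adj] {q : ℕ} {θ : ℝ}

lemma abs_noisyAvg_le (h : Admissible G q θ) {u : V} {A : V → ℝ} {B : Fin q → ℝ} {M : ℝ}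
    (hA : ∀ v, |A v| ≤ M) (hB : ∀ c, |B c| ≤ M) : |noisyAvg G q θ u A B| ≤ M := by
  rw [abs_le]
  constructor
  · rw [← noisyAvg_const h u (-M)]
    exact noisyAvg_mono h (fun v _ => (abs_le.mp (hA v)).1) fun c => (abs_le.mp (hB c)).1
  · rw [← noisyAvg_const h u M]
    exact noisyAvg_mono h (fun v _ => (abs_le.mp (hA v)).2) fun c => (abs_le.mp (hB c)).2

/-- The carré du champ is controlled by the influences. -/
lemma abs_generator_mul_sub_le (h : Admissible G q θ) {f g : (V → Fin q) → ℝ} {o o' : V → ℝ}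
    (hf : HasInfluence f o) (hg : HasInfluence g o') (x : V → Fin q) :
    |(generator G q θ *ᵥ f) x * g x + f x * (generator G q θ *ᵥ g) x -
      (generator G q θ *ᵥ fun y => f y * g y) x| ≤ ∑ u, o u * o' u := by
  have e : (generator G q θ *ᵥ f) x * g x + f x * (generator G q θ *ᵥ g) x -
      (generator G q θ *ᵥ fun y => f y * g y) x = ∑ u, -noisyAvg G q θ u
        (fun v => (f (Function.update x u (x v)) - f x) * (g (Function.update x u (x v)) - g x))
        (fun c => (f (Function.update x u c) - f x) * (g (Function.update x u c) - g x)) := by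
    simp only [generator_mulVec_eq_noisyAvg]
    rw [Finset.sum_mul, Finset.mul_sum, ← Finset.sum_add_distrib, ← Finset.sum_sub_distrib]
    refine Finset.sum_congr rfl fun u _ => ?_
    have e1 : ∀ y, (f y - f x) * (g y - g x) = (f y * g y + -f x * g y) + (-g x * f y + f x * g x) :=
      fun y => by ring
    simp only [e1]
    rw [noisyAvg_add, noisyAvg_add, noisyAvg_add, noisyAvg_const h, noisyAvg_const_mul,
      noisyAvg_const_mul]
    ring
  rw [e]
  refine (Finset.abs_sum_le_sum_abs _ _).trans (Finset.sum_le_sum fun u _ => ?_)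
  rw [abs_neg]
  refine abs_noisyAvg_le h (fun v => ?_) fun c => ?_ <;>
  · rw [abs_mul]
    exact mul_le_mul (hf _ _ _) (hg _ _ _) (abs_nonneg _) (hf.nonneg x u)

/-- Interpolate by applying the semigroup for time `t - s` to the product of `f` and `g` evolved for
time `s`. The derivative in `s` is an average of the carré du champ of the evolved functions, whose
influences spread by the kernel; the bound `B * exp (-(κ * s))` is then integrated over all `s`. -/
lemma abs_covariance_le (h : Admissible G q θ) {f g : (V → Fin q) → ℝ} {o o' : V → ℝ}
    (hf : HasInfluence f o) (hg : HasInfluence g o') {B κ : ℝ} (hκ : 0 < κ)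
    (hB : ∀ s, 0 ≤ s → ∑ u, (∑ a, o a * kernel G q θ s a u) * (∑ b, o' b * kernel G q θ s b u) ≤
      B * Real.exp (-(κ * s))) {t : ℝ} (ht : 0 ≤ t) (x : V → Fin q) :
    |(transition G q θ t *ᵥ fun y => f y * g y) x -
      (transition G q θ t *ᵥ f) x * (transition G q θ t *ᵥ g) x| ≤ B / κ := by
  have hB0 : 0 ≤ B := by
    have h1 := hB 0 le_rfl
    simp only [mul_zero, neg_zero, Real.exp_zero, mul_one] at h1
    refine le_trans (Finset.sum_nonneg fun u _ => mul_nonneg ?_ ?_) h1 <;>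
    refine Finset.sum_nonneg fun a _ => mul_nonneg ?_ (kernel_nonneg h le_rfl _ _)
    · exact hf.nonneg x a
    · exact hg.nonneg x a
  set F : ℝ → (V → Fin q) → ℝ := fun s => transition G q θ s *ᵥ f with hF
  set H : ℝ → (V → Fin q) → ℝ := fun s => transition G q θ s *ᵥ g with hH
  set Γ : ℝ → (V → Fin q) → ℝ := fun s y => (generator G q θ *ᵥ F s) y * H s y +
    F s y * (generator G q θ *ᵥ H s) y - (generator G q θ *ᵥ fun y => F s y * H s y) y with hΓ
  set ψ : ℝ → ℝ := fun s => (transition G q θ (t - s) *ᵥ fun y => F s y * H s y) x with hψ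
  have hd : ∀ s, HasDerivAt ψ ((transition G q θ (t - s) *ᵥ Γ s) x) s := by
    intro s
    have hentry : ∀ r y, HasDerivAt (fun r => transition G q θ r x y)
        ((transition G q θ r * generator G q θ) x y) r := fun r y => by
      have := (hasDerivAt_transition_mulVec (G := G) (θ := θ) (Pi.single y 1) x r).1
      rw [Matrix.mulVec_mulVec] at this
      simpa using this
    have hy : ∀ y, HasDerivAt (fun s => transition G q θ (t - s) x y * (F s y * H s y))
        (-(transition G q θ (t - s) * generator G q θ) x y * (F s y * H s y) +
          transition G q θ (t - s) x y * ((generator G q θ *ᵥ F s) y * H s y +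
          F s y * (generator G q θ *ᵥ H s) y)) s := fun y => by
      have h1 : HasDerivAt (fun s => transition G q θ (t - s) x y)
          (-(transition G q θ (t - s) * generator G q θ) x y) s :=
        ((hentry (t - s) y).scomp s ((hasDerivAt_id s).const_sub t)).congr_deriv (by simp)
      exact h1.fun_mul ((hasDerivAt_transition_mulVec f y s).2.fun_mul
        (hasDerivAt_transition_mulVec g y s).2)
    refine (HasDerivAt.fun_sum fun y (_ : y ∈ Finset.univ) => hy y).congr_deriv ?_
    have e : Γ s = (fun y => (generator G q θ *ᵥ F s) y * H s y +
          F s y * (generator G q θ *ᵥ H s) y) - (generator G q θ *ᵥ fun y => F s y * H s y) := rfl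
    rw [e, Matrix.mulVec_sub, Matrix.mulVec_mulVec (fun y => F s y * H s y), Pi.sub_apply]
    change _ = ∑ y, transition G q θ (t - s) x y * _ -
      ∑ y, (transition G q θ (t - s) * generator G q θ) x y * _
    rw [← Finset.sum_sub_distrib]
    exact Finset.sum_congr rfl fun y _ => by ring
  have hbound : ∀ s, 0 ≤ s → s ≤ t →
      |(transition G q θ (t - s) *ᵥ Γ s) x| ≤ B * Real.exp (-(κ * s)) := by
    intro s hs hst
    refine abs_expect_le (μ := fun y => transition G q θ (t - s) x y)
      (fun y => transition_nonneg h x y (sub_nonneg.mpr hst))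
      (sum_transition h x (sub_nonneg.mpr hst)) fun y => ?_
    exact (abs_generator_mul_sub_le h (hf.transition h hs) (hg.transition h hs) y).trans (hB s hs)
  have he : ∀ s : ℝ, HasDerivAt (fun s => B / κ * Real.exp (-(κ * s)))
      (-(B * Real.exp (-(κ * s)))) s := fun s => by
    have h1 : HasDerivAt (fun s => Real.exp (-(κ * s))) (Real.exp (-(κ * s)) * -κ) s := by
      simpa using (((hasDerivAt_id s).const_mul κ).neg).exp
    refine (h1.const_mul (B / κ)).congr_deriv ?_
    field_simp
  -- Adding or subtracting a primitive of the bound makes the interpolation monotone, which replaces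
  -- the integration.
  have up := le_of_hasDerivAt_nonpos ht (fun s => (hd s).fun_add (he s)) fun s hs hst => by
    linarith [(abs_le.mp (hbound s hs hst)).2]
  have dn := le_of_hasDerivAt_nonpos ht (fun s => (he s).fun_sub (hd s)) fun s hs hst => by
    linarith [(abs_le.mp (hbound s hs hst)).1]
  have hψ0 : ψ 0 = (transition G q θ t *ᵥ fun y => f y * g y) x := by
    simp [hψ, hF, hH, transition_zero]
  have hψt : ψ t = (transition G q θ t *ᵥ f) x * (transition G q θ t *ᵥ g) x := by
    simp [hψ, hF, hH, transition_zero]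
  have hpos : 0 ≤ B / κ * Real.exp (-(κ * t)) := by positivity
  simp only [hψ0, hψt, mul_zero, neg_zero, Real.exp_zero, mul_one] at up dn
  rw [abs_le]
  constructor <;> linarith

/-- Poincaré inequality, uniformly in time. -/
lemma variance_transition_le (h : Admissible G q θ) {Δ : ℝ} (hΔ : ∀ v, (G.degree v : ℝ) ≤ Δ)
    {f : (V → Fin q) → ℝ} {o : V → ℝ} (hf : HasInfluence f o) {t : ℝ} (ht : 0 ≤ t)
    (x : V → Fin q) :
    (transition G q θ t *ᵥ fun y => f y * f y) x -
      (transition G q θ t *ᵥ f) x * (transition G q θ t *ᵥ f) x ≤ Δ / (2 * θ) * ∑ a, o a ^ 2 := by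
  have ho := hf.nonneg x
  have key := abs_covariance_le h hf hf (B := Δ * ∑ a, o a ^ 2) (κ := 2 * θ)
    (by have := h.pos; positivity) (fun s hs => ?_) ht x
  · refine (le_abs_self _).trans (key.trans (le_of_eq (by ring)))
  · have h1 : ∀ u, (∑ a, o a * kernel G q θ s a u) * (∑ b, o b * kernel G q θ s b u) ≤
        Δ * Real.exp (-(θ * s)) * ∑ a, o a ^ 2 * kernel G q θ s a u := by
      intro u
      have hk := fun a => kernel_nonneg h hs a u
      have := Finset.sum_sq_le_sum_mul_sum_of_sq_le_mul Finset.univ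
        (r := fun a => o a * kernel G q θ s a u) (f := fun a => kernel G q θ s a u)
        (g := fun a => o a ^ 2 * kernel G q θ s a u) (fun a _ => hk a)
        (fun a _ => mul_nonneg (sq_nonneg _) (hk a)) (fun a _ => le_of_eq (by ring))
      rw [← sq]
      exact this.trans (mul_le_mul_of_nonneg_right (sum_kernel_left_le h hΔ hs u)
        (Finset.sum_nonneg fun a _ => mul_nonneg (sq_nonneg _) (hk a)))
    refine (Finset.sum_le_sum fun u _ => h1 u).trans ?_
    rw [← Finset.mul_sum, Finset.sum_comm]
    have h2 : ∑ a, ∑ u, o a ^ 2 * kernel G q θ s a u ≤ (∑ a, o a ^ 2) * Real.exp (-(θ * s)) := by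
      rw [Finset.sum_mul]
      refine Finset.sum_le_sum fun a _ => ?_
      rw [← Finset.mul_sum]
      exact mul_le_mul_of_nonneg_left (sum_kernel_le h hs a) (sq_nonneg _)
    by_cases hV : Nonempty V
    · have hΔ0 : 0 ≤ Δ := le_trans (by positivity) (hΔ hV.some)
      refine (mul_le_mul_of_nonneg_left h2 (by positivity)).trans (le_of_eq ?_)
      have : Real.exp (-(2 * θ * s)) = Real.exp (-(θ * s)) * Real.exp (-(θ * s)) := by
        rw [← Real.exp_add]; ring_nf
      rw [this]
      ring
    · have : IsEmpty V := not_nonempty_iff.mp hV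
      simp

lemma sum_mul_le_sum_mul_sum {ι : Type*} (s : Finset ι) {f g : ι → ℝ} (hf : ∀ i, 0 ≤ f i)
    (hg : ∀ i, 0 ≤ g i) : ∑ i ∈ s, f i * g i ≤ (∑ i ∈ s, f i) * ∑ i ∈ s, g i := by
  rw [Finset.sum_mul]
  exact Finset.sum_le_sum fun i hi => mul_le_mul_of_nonneg_left
    (Finset.single_le_sum (fun i _ => hg i) hi) (hf i)

/-- The rate of exponential decay of correlations in space. -/
def decayBase (θ : ℝ) : ℝ := 1 + θ / 2

/-- A step of the walk multiplies the weight by at most `decayBase θ`, and `(1 - θ) * (1 + θ / 2) -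
1 ≤ -(θ / 2)`: killing outweighs the growth, leaving decay at rate `θ / 2`. -/
lemma sum_kernel_mul_decay_le (h : Admissible G q θ) (hG : G.Connected) {t : ℝ} (ht : 0 ≤ t) (a : V) :
    ∑ u, kernel G q θ t a u * decayBase θ ^ G.dist a u ≤ Real.exp (-(θ / 2 * t)) := by
  have hθ := h.pos
  have hb : 1 ≤ decayBase θ := by rw [decayBase]; linarith
  have := sum_kernel_mul_le h ht (fun u => decayBase θ ^ G.dist a u) (θ / 2) (fun v => ?_) a
  · simpa using this
  · have h1 : walkAvg G (fun u => decayBase θ ^ G.dist a u) v ≤ decayBase θ * decayBase θ ^ G.dist a v := by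
      rw [← walkAvg_const (h.degree_pos v) (decayBase θ * decayBase θ ^ G.dist a v)]
      refine walkAvg_mono fun w hw => ?_
      rw [← pow_succ']
      refine pow_le_pow_right₀ hb ?_
      have := hG.dist_triangle (u := a) (v := v) (w := w)
      rw [SimpleGraph.dist_eq_one_iff_adj.mpr hw] at this
      exact this
    have h2 := mul_le_mul_of_nonneg_left h1 (sub_nonneg.mpr h.le_one)
    have h3 : 0 < decayBase θ ^ G.dist a v := by positivity
    have h4 : (1 - θ) * decayBase θ - 1 ≤ -(θ / 2) := by rw [decayBase]; nlinarith [sq_nonneg θ]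
    nlinarith

/-- Two walks from `a` and `b` that end at the same `u` have together covered the distance of `a`
and `b`. The two exponential moments pay for it and each leaves `exp (-(θ / 2 * t))`. -/
lemma sum_kernel_mul_kernel_le (h : Admissible G q θ) (hG : G.Connected) {t : ℝ} (ht : 0 ≤ t)
    (a b : V) : ∑ u, kernel G q θ t a u * kernel G q θ t b u ≤
      (decayBase θ ^ G.dist a b)⁻¹ * Real.exp (-(θ * t)) := by
  have hθ := h.pos
  have hb : 1 ≤ decayBase θ := by rw [decayBase]; linarith
  have hb0 : 0 < decayBase θ := by linarith
  rw [inv_mul_eq_div, le_div_iff₀ (by positivity), Finset.sum_mul]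
  have h1 := sum_mul_le_sum_mul_sum Finset.univ
    (f := fun u => kernel G q θ t a u * decayBase θ ^ G.dist a u)
    (g := fun u => kernel G q θ t b u * decayBase θ ^ G.dist b u)
    (fun u => mul_nonneg (kernel_nonneg h ht _ _) (by positivity))
    (fun u => mul_nonneg (kernel_nonneg h ht _ _) (by positivity))
  have h2 : Real.exp (-(θ * t)) = Real.exp (-(θ / 2 * t)) * Real.exp (-(θ / 2 * t)) := by
    rw [← Real.exp_add]; ring_nf
  rw [h2]
  refine le_trans (Finset.sum_le_sum fun u _ => ?_) (h1.trans (mul_le_mul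
    (sum_kernel_mul_decay_le h hG ht a) (sum_kernel_mul_decay_le h hG ht b)
    (Finset.sum_nonneg fun u _ => mul_nonneg (kernel_nonneg h ht _ _) (by positivity))
    (Real.exp_pos _).le))
  have h3 : decayBase θ ^ G.dist a b ≤ decayBase θ ^ G.dist a u * decayBase θ ^ G.dist b u := by
    rw [← pow_add]
    refine pow_le_pow_right₀ hb ?_
    rw [G.dist_comm (u := b)]
    exact hG.dist_triangle
  calc _ ≤ kernel G q θ t a u * kernel G q θ t b u *
        (decayBase θ ^ G.dist a u * decayBase θ ^ G.dist b u) :=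
        mul_le_mul_of_nonneg_left h3 (mul_nonneg (kernel_nonneg h ht _ _) (kernel_nonneg h ht _ _))
    _ = _ := by ring

/-- Covariances under `ν` decay exponentially in the distance. -/
def CovarianceDecay (G : SimpleGraph V) {q : ℕ} (θ : ℝ) (ν : (V → Fin q) → ℝ) : Prop :=
  ∀ f g o o', HasInfluence f o → HasInfluence g o' →
    |expect ν (fun y => f y * g y) - expect ν f * expect ν g| ≤
      (∑ a, ∑ b, o a * o' b * (decayBase θ ^ G.dist a b)⁻¹) / θ

lemma covarianceDecay_transition (h : Admissible G q θ) (hG : G.Connected) {t : ℝ} (ht : 0 ≤ t)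
    (x : V → Fin q) : CovarianceDecay G θ (transition G q θ t x) := by
  intro f g o o' hf hg
  refine abs_covariance_le h hf hg h.pos (fun s hs => ?_) ht x
  have e : ∑ u, (∑ a, o a * kernel G q θ s a u) * (∑ b, o' b * kernel G q θ s b u) =
      ∑ a, ∑ b, o a * o' b * ∑ u, kernel G q θ s a u * kernel G q θ s b u := by
    simp only [Finset.sum_mul_sum]
    simp only [Finset.mul_sum]
    rw [Finset.sum_comm]
    refine Finset.sum_congr rfl fun a _ => ?_
    rw [Finset.sum_comm]
    exact Finset.sum_congr rfl fun b _ => Finset.sum_congr rfl fun u _ => by ring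
  rw [e, Finset.sum_mul]
  refine Finset.sum_le_sum fun a _ => ?_
  rw [Finset.sum_mul]
  refine Finset.sum_le_sum fun b _ => ?_
  rw [mul_assoc (o a * o' b)]
  exact mul_le_mul_of_nonneg_left (sum_kernel_mul_kernel_le h hG hs a b)
    (mul_nonneg (hf.nonneg x a) (hg.nonneg x b))

end Covariance

/-! ### The stationary distribution -/

section Stationary

variable {G : SimpleGraph V} [DecidableRel G.Adj] {q : ℕ} {θ : ℝ} {μ : (V → Fin q) → ℝ}

lemma IsStationary.expect_transition (hμ : IsStationary G q θ μ) {t : ℝ} (ht : 0 ≤ t)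
    (f : (V → Fin q) → ℝ) : expect μ (transition G q θ t *ᵥ f) = expect μ f := by
  have : expect μ (transition G q θ t *ᵥ f) = (μ ᵥ* transition G q θ t) ⬝ᵥ f :=
    Matrix.dotProduct_mulVec _ _ _
  rw [this, hμ.invariant t ht]
  rfl

lemma IsStationary.expect_generator (hμ : IsStationary G q θ μ) (f : (V → Fin q) → ℝ) :
    expect μ (generator G q θ *ᵥ f) = 0 := by
  have : expect μ (generator G q θ *ᵥ f) = (μ ᵥ* generator G q θ) ⬝ᵥ f :=
    Matrix.dotProduct_mulVec _ _ _
  rw [this, ((isStationary_iff G q θ μ).mp hμ).2.2, zero_dotProduct]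

lemma IsStationary.abs_sub_expect_le (hμ : IsStationary G q θ μ) (h : Admissible G q θ)
    {f : (V → Fin q) → ℝ} {o : V → ℝ} (hf : HasInfluence f o) {t : ℝ} (ht : 0 ≤ t) (x : V → Fin q) :
    |(transition G q θ t *ᵥ f) x - expect μ f| ≤ Real.exp (-(θ * t)) * ∑ a, o a := by
  rw [← hμ.expect_transition ht f, ← expect_const hμ.sum_eq_one ((transition G q θ t *ᵥ f) x),
    ← expect_sub]
  exact abs_expect_le hμ.nonneg hμ.sum_eq_one fun y => abs_transition_mulVec_sub_le h hf ht x y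

lemma exists_hasInfluence (f : (V → Fin q) → ℝ) : ∃ o, HasInfluence f o := by
  refine ⟨fun _ => 2 * ∑ x, |f x|, fun x a c => ?_⟩
  have h1 : ∀ x, |f x| ≤ ∑ x, |f x| := fun x =>
    Finset.single_le_sum (f := fun x => |f x|) (fun _ _ => abs_nonneg _) (Finset.mem_univ x)
  have := abs_sub (f (Function.update x a c)) (f x)
  linarith [h1 x, h1 (Function.update x a c)]

/-- Through this limit, estimates uniform in time are inherited by the stationary law. -/
lemma IsStationary.tendsto_transition (hμ : IsStationary G q θ μ) (h : Admissible G q θ)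
    (f : (V → Fin q) → ℝ) (x : V → Fin q) :
    Tendsto (fun t => (transition G q θ t *ᵥ f) x) atTop (𝓝 (expect μ f)) := by
  obtain ⟨o, ho⟩ := exists_hasInfluence f
  rw [tendsto_iff_norm_sub_tendsto_zero]
  have h1 : Tendsto (fun t : ℝ => Real.exp (-(θ * t)) * ∑ a, o a) atTop (𝓝 (0 * ∑ a, o a)) :=
    (Real.tendsto_exp_neg_atTop_nhds_zero.comp (tendsto_id.const_mul_atTop h.pos)).mul_const _
  rw [zero_mul] at h1
  refine squeeze_zero' (Eventually.of_forall fun t => norm_nonneg _) ?_ h1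
  filter_upwards [eventually_ge_atTop 0] with t ht
  exact hμ.abs_sub_expect_le h ho ht x

lemma IsStationary.covarianceDecay (hμ : IsStationary G q θ μ) (h : Admissible G q θ)
    (hG : G.Connected) : CovarianceDecay G θ μ := by
  intro f g o o' hf hg
  have x : V → Fin q := fun _ => ⟨0, by have := h.two_le; omega⟩
  have h1 := ((hμ.tendsto_transition h (fun y => f y * g y) x).sub
    ((hμ.tendsto_transition h f x).mul (hμ.tendsto_transition h g x))).abs
  refine le_of_tendsto h1 ?_
  filter_upwards [eventually_ge_atTop 0] with t ht
  exact covarianceDecay_transition h hG ht x f g o o' hf hg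

lemma IsStationary.variance_le (hμ : IsStationary G q θ μ) (h : Admissible G q θ)
    {Δ : ℝ} (hΔ : ∀ v, (G.degree v : ℝ) ≤ Δ) {f : (V → Fin q) → ℝ} {o : V → ℝ}
    (hf : HasInfluence f o) :
    expect μ (fun y => f y * f y) - expect μ f * expect μ f ≤ Δ / (2 * θ) * ∑ a, o a ^ 2 := by
  have x : V → Fin q := fun _ => ⟨0, by have := h.two_le; omega⟩
  refine le_of_tendsto ((hμ.tendsto_transition h (fun y => f y * f y) x).sub
    ((hμ.tendsto_transition h f x).mul (hμ.tendsto_transition h f x))) ?_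
  filter_upwards [eventually_ge_atTop 0] with t ht
  exact variance_transition_le h hΔ hf ht x

end Stationary

/-! ### Marginals and the autocorrelation function -/

section Marginal

variable {G : SimpleGraph V} [DecidableRel G.Adj] {q : ℕ} {θ : ℝ}

/-- The indicator that the vertex `v` has colour `j`. -/
def hasColour {q : ℕ} (v : V) (j : Fin q) (y : V → Fin q) : ℝ := if y v = j then 1 else 0

lemma marginal_eq_mulVec (x₀ : V → Fin q) (t : ℝ) (v : V) (j : Fin q) :
    marginal G q θ x₀ t v j = (transition G q θ t *ᵥ hasColour v j) x₀ := by
  simp only [marginal, Matrix.mulVec, dotProduct, hasColour, mul_ite, mul_one, mul_zero]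

/-- The marginal minus its stationary value. -/
def bias (G : SimpleGraph V) [DecidableRel G.Adj] (q : ℕ) (θ : ℝ) (x₀ : V → Fin q) (t : ℝ)
    (p : V × Fin q) : ℝ := marginal G q θ x₀ t p.1 p.2 - 1 / q

/-- The generator of the killed walk, acting on functions of a vertex and a colour. -/
def biasGen (G : SimpleGraph V) [DecidableRel G.Adj] (q : ℕ) (θ : ℝ) :
    (V × Fin q → ℝ) →L[ℝ] (V × Fin q → ℝ) :=
  LinearMap.toContinuousLinearMap
    { toFun := fun f p => (1 - θ) * walkAvg G (fun w => f (w, p.2)) p.1 - f p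
      map_add' := fun f g => by
        ext p
        simp only [Pi.add_apply, walkAvg_add]
        ring
      map_smul' := fun a f => by
        ext p
        simp only [Pi.smul_apply, smul_eq_mul, walkAvg_const_mul, RingHom.id_apply]
        ring }

lemma biasGen_apply (f : V × Fin q → ℝ) (p : V × Fin q) :
    biasGen G q θ f p = (1 - θ) * walkAvg G (fun w => f (w, p.2)) p.1 - f p := rfl

lemma generator_mulVec_hasColour (h : Admissible G q θ) (v : V) (j : Fin q) (x : V → Fin q) :
    (generator G q θ *ᵥ hasColour v j) x =
      (1 - θ) * walkAvg G (fun w => hasColour w j x) v + θ * (1 / q) - hasColour v j x := by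
  rw [generator_mulVec_eq_noisyAvg, Finset.sum_eq_single v]
  · simp [noisyAvg, hasColour]
  · intro u _ hu
    have : ∀ c, hasColour v j (Function.update x u c) = hasColour v j x := fun c => by
      simp [hasColour, Function.update_of_ne hu.symm]
    simp only [this]
    rw [noisyAvg_const h, sub_self]
  · simp

lemma mulVec_walkAvg {S : Type*} [Fintype S] (A : Matrix S S ℝ) (f : V → S → ℝ) (v : V) (x : S) :
    (A *ᵥ fun y => walkAvg G (fun w => f w y) v) x = walkAvg G (fun w => (A *ᵥ f w) x) v := by
  simp only [walkAvg]
  change expect (A x) (fun y => ∑ w ∈ G.neighborFinset v, 1 / (G.degree v : ℝ) * f w y) = _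
  rw [expect_sum]
  simp only [expect_const_mul]
  rfl

/-- The marginals obey a closed linear equation because each update copies a single vertex.
Subtracting the fixed point `1 / q` removes the inhomogeneous noise term. -/
lemma hasDerivAt_bias (h : Admissible G q θ) (x₀ : V → Fin q) (t : ℝ) :
    HasDerivAt (bias G q θ x₀) (biasGen G q θ (bias G q θ x₀ t)) t := by
  rw [hasDerivAt_pi]
  rintro ⟨v, j⟩
  simp only [bias, marginal_eq_mulVec]
  refine ((hasDerivAt_transition_mulVec (hasColour v j) x₀ t).1.sub_const _).congr_deriv ?_
  have e : generator G q θ *ᵥ hasColour v j = fun x =>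
      (1 - θ) * walkAvg G (fun w => hasColour w j x) v + (θ * (1 / q) - hasColour v j x) := by
    ext x
    rw [generator_mulVec_hasColour h]
    ring
  have hsum : ∑ y, transition G q θ t x₀ y = 1 := by
    rcases le_total 0 t with ht | ht
    · exact sum_transition h x₀ ht
    -- Negative times are allowed, so that the derivative is two-sided also at `0`; there the row
    -- sums follow by inverting the semigroup.
    · have hs : (transition G q θ (-t) *ᵥ fun _ => 1) = fun _ => (1 : ℝ) :=
        funext fun x => transition_mulVec_const h 1 x (by linarith)
      have := congrFun (congrArg (fun f => transition G q θ t *ᵥ f) hs) x₀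
      simp only [Matrix.mulVec_mulVec, ← transition_add, add_neg_cancel, transition_zero,
        Matrix.one_mulVec] at this
      simpa [Matrix.mulVec, dotProduct] using this.symm
  have e2 : (transition G q θ t *ᵥ (generator G q θ *ᵥ hasColour v j)) x₀ =
      (1 - θ) * walkAvg G (fun w => (transition G q θ t *ᵥ hasColour w j) x₀) v +
        (θ * (1 / q) - (transition G q θ t *ᵥ hasColour v j) x₀) := by
    rw [e, ← mulVec_walkAvg]
    change expect (transition G q θ t x₀) _ = _ * expect (transition G q θ t x₀) _ +
      (_ - expect (transition G q θ t x₀) _)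
    rw [expect_add, expect_const_mul, expect_sub, expect_const hsum]
  rw [e2, biasGen_apply]
  simp only [bias, marginal_eq_mulVec, walkAvg_sub, walkAvg_const (h.degree_pos v)]
  ring

/-- The degree, as a weight on vertices and colours. -/
def degreeWeight (G : SimpleGraph V) [DecidableRel G.Adj] (q : ℕ) (p : V × Fin q) : ℝ := G.degree p.1

lemma wip_degreeWeight (f g : V × Fin q → ℝ) : wip (degreeWeight G q) f g =
    ∑ j, ∑ v, (G.degree v : ℝ) * (f (v, j) * g (v, j)) := by
  rw [wip, Fintype.sum_prod_type_right]
  rfl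

lemma biasGen_symm (h : Admissible G q θ) (f g : V × Fin q → ℝ) :
    wip (degreeWeight G q) (biasGen G q θ f) g = wip (degreeWeight G q) f (biasGen G q θ g) := by
  simp only [wip_degreeWeight, biasGen_apply]
  refine Finset.sum_congr rfl fun j _ => ?_
  have := sum_degree_mul_walkAvg_comm h.degree_pos (fun v => f (v, j)) (fun v => g (v, j))
  have e1 : ∀ v, (G.degree v : ℝ) * (((1 - θ) * walkAvg G (fun w => f (w, j)) v - f (v, j)) * g (v, j)) =
      (1 - θ) * ((G.degree v : ℝ) * (walkAvg G (fun w => f (w, j)) v * g (v, j))) -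
        (G.degree v : ℝ) * (f (v, j) * g (v, j)) := fun v => by ring
  have e2 : ∀ v, (G.degree v : ℝ) * (f (v, j) * ((1 - θ) * walkAvg G (fun w => g (w, j)) v - g (v, j))) =
      (1 - θ) * ((G.degree v : ℝ) * (f (v, j) * walkAvg G (fun w => g (w, j)) v)) -
        (G.degree v : ℝ) * (f (v, j) * g (v, j)) := fun v => by ring
  simp only [e1, e2, Finset.sum_sub_distrib, ← Finset.mul_sum, this]

lemma sum_degree_mul_walkAvg_sq_le (hd : ∀ u, 0 < G.degree u) (f : V → ℝ) :
    ∑ u, (G.degree u : ℝ) * walkAvg G f u ^ 2 ≤ ∑ u, (G.degree u : ℝ) * f u ^ 2 := by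
  rw [← sum_degree_mul_walkAvg hd fun u => f u ^ 2]
  exact Finset.sum_le_sum fun u _ => mul_le_mul_of_nonneg_left (walkAvg_sq_le hd f u) (by positivity)

lemma abs_sum_degree_mul_self_walkAvg_le (hd : ∀ u, 0 < G.degree u) (f : V → ℝ) :
    |∑ u, (G.degree u : ℝ) * (f u * walkAvg G f u)| ≤ ∑ u, (G.degree u : ℝ) * f u ^ 2 := by
  have h1 := sum_degree_mul_walkAvg_sq_le hd f
  have h2 : ∀ a b : ℝ, |a * b| ≤ (a ^ 2 + b ^ 2) / 2 := fun a b => by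
    rw [abs_le]; constructor <;> nlinarith [sq_nonneg (a + b), sq_nonneg (a - b)]
  calc |∑ u, (G.degree u : ℝ) * (f u * walkAvg G f u)|
      ≤ ∑ u, (G.degree u : ℝ) * ((f u ^ 2 + walkAvg G f u ^ 2) / 2) := by
        refine (Finset.abs_sum_le_sum_abs _ _).trans (Finset.sum_le_sum fun u _ => ?_)
        rw [abs_mul, Nat.abs_cast]
        exact mul_le_mul_of_nonneg_left (h2 _ _) (by positivity)
    _ = (∑ u, (G.degree u : ℝ) * f u ^ 2 + ∑ u, (G.degree u : ℝ) * walkAvg G f u ^ 2) / 2 := by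
        rw [← Finset.sum_add_distrib, Finset.sum_div]
        exact Finset.sum_congr rfl fun u _ => by ring
    _ ≤ _ := by linarith

/-- In the degree-weighted space averaging over neighbours has quadratic form between `-1` and `1`,
which confines that of `biasGen` to the range from `-(2 - θ)` to `-θ`. -/
lemma wip_biasGen_bounds (h : Admissible G q θ) (f : V × Fin q → ℝ) :
    wip (degreeWeight G q) f (biasGen G q θ f) ≤ -(θ * wip (degreeWeight G q) f f) ∧
    -((2 - θ) * wip (degreeWeight G q) f f) ≤ wip (degreeWeight G q) f (biasGen G q θ f) := by
  have e : wip (degreeWeight G q) f (biasGen G q θ f) =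
      (1 - θ) * ∑ j, ∑ v, (G.degree v : ℝ) * (f (v, j) * walkAvg G (fun w => f (w, j)) v) -
        wip (degreeWeight G q) f f := by
    simp only [wip_degreeWeight, biasGen_apply, Finset.mul_sum, ← Finset.sum_sub_distrib]
    exact Finset.sum_congr rfl fun j _ => Finset.sum_congr rfl fun v _ => by ring
  have h1 : |∑ j, ∑ v, (G.degree v : ℝ) * (f (v, j) * walkAvg G (fun w => f (w, j)) v)| ≤
      wip (degreeWeight G q) f f := by
    rw [wip_degreeWeight]
    refine (Finset.abs_sum_le_sum_abs _ _).trans (Finset.sum_le_sum fun j _ => ?_)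
    refine (abs_sum_degree_mul_self_walkAvg_le h.degree_pos _).trans (le_of_eq ?_)
    exact Finset.sum_congr rfl fun v _ => by ring
  have h2 := mul_le_mul_of_nonneg_left (abs_le.mp h1).1 (sub_nonneg.mpr h.le_one)
  have h3 := mul_le_mul_of_nonneg_left (abs_le.mp h1).2 (sub_nonneg.mpr h.le_one)
  rw [e]
  constructor <;> nlinarith

lemma sum_degree_eq : ∑ v, (G.degree v : ℝ) = 2 * (G.edgeFinset.card : ℝ) := by
  exact_mod_cast G.sum_degrees_eq_twice_card_edges

lemma autocorrelation_eq (x₀ : V → Fin q) (t : ℝ) : autocorrelation G q θ x₀ t =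
    wip (degreeWeight G q) (bias G q θ x₀ t) (bias G q θ x₀ t) / ∑ v, (G.degree v : ℝ) := by
  rw [wip_degreeWeight, Finset.sum_comm, autocorrelation, sum_degree_eq, Finset.sum_div]
  refine Finset.sum_congr rfl fun v _ => ?_
  rw [walkStationary, ← Finset.mul_sum, div_mul_eq_mul_div]
  simp only [bias, sq]

lemma card_le_sum_degree (h : Admissible G q θ) : (Fintype.card V : ℝ) ≤ ∑ v, (G.degree v : ℝ) := by
  have : ∑ _v : V, (1 : ℝ) ≤ ∑ v, (G.degree v : ℝ) :=
    Finset.sum_le_sum fun v _ => by exact_mod_cast h.degree_pos v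
  simpa using this

lemma sum_degree_le {Δ : ℝ} (hΔ : ∀ v, (G.degree v : ℝ) ≤ Δ) :
    ∑ v, (G.degree v : ℝ) ≤ Fintype.card V * Δ := by
  have := Finset.sum_le_sum fun v (_ : v ∈ Finset.univ) => hΔ v
  simpa using this

variable [Nonempty V]

lemma sum_degree_pos (h : Admissible G q θ) : 0 < ∑ v, (G.degree v : ℝ) :=
  lt_of_lt_of_le (by exact_mod_cast Fintype.card_pos) (card_le_sum_degree h)

lemma sum_degree_mul_autocorrelation (h : Admissible G q θ) (x₀ : V → Fin q) (t : ℝ) :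
    wip (degreeWeight G q) (bias G q θ x₀ t) (bias G q θ x₀ t) =
      (∑ v, (G.degree v : ℝ)) * autocorrelation G q θ x₀ t := by
  rw [autocorrelation_eq, mul_div_cancel₀ _ (sum_degree_pos h).ne']

lemma autocorrelation_nonneg (h : Admissible G q θ) (x₀ : V → Fin q) (t : ℝ) :
    0 ≤ autocorrelation G q θ x₀ t := by
  rw [autocorrelation_eq]
  exact div_nonneg (wip_self_nonneg (fun p => Nat.cast_nonneg _) _) (sum_degree_pos h).le

lemma hasDerivAt_autocorrelation (h : Admissible G q θ) (x₀ : V → Fin q) (t : ℝ) :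
    HasDerivAt (autocorrelation G q θ x₀)
      (2 * wip (degreeWeight G q) (bias G q θ x₀ t) (biasGen G q θ (bias G q θ x₀ t)) /
        ∑ v, (G.degree v : ℝ)) t := by
  have e : autocorrelation G q θ x₀ = fun t => wip (degreeWeight G q) (bias G q θ x₀ t)
      (bias G q θ x₀ t) / ∑ v, (G.degree v : ℝ) := funext fun t => autocorrelation_eq x₀ t
  rw [e]
  refine ((HasDerivAt.wip _ (hasDerivAt_bias h x₀ t) (hasDerivAt_bias h x₀ t)).div_const _).congr_deriv ?_
  rw [wip_comm _ (biasGen G q θ _)]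
  ring

lemma autocorrelation_le_exp_mul (h : Admissible G q θ) (x₀ : V → Fin q) {s t : ℝ} (hst : s ≤ t) :
    autocorrelation G q θ x₀ t ≤ Real.exp (-(2 * θ * (t - s))) * autocorrelation G q θ x₀ s := by
  have he : ∀ r : ℝ, HasDerivAt (fun r => Real.exp (2 * θ * r)) (Real.exp (2 * θ * r) * (2 * θ)) r :=
    fun r => by simpa using ((hasDerivAt_id r).const_mul (2 * θ)).exp
  have := le_of_hasDerivAt_nonpos hst
    (fun r => (he r).fun_mul (hasDerivAt_autocorrelation h x₀ r)) fun r _ _ => by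
      have h1 := (wip_biasGen_bounds h (bias G q θ x₀ r)).1
      rw [autocorrelation_eq]
      have h2 : (2 * θ * wip (degreeWeight G q) (bias G q θ x₀ r) (bias G q θ x₀ r) +
        2 * wip (degreeWeight G q) (bias G q θ x₀ r) (biasGen G q θ (bias G q θ x₀ r))) /
        ∑ v, (G.degree v : ℝ) ≤ 0 := div_nonpos_of_nonpos_of_nonneg (by linarith) (sum_degree_pos h).le
      have := mul_nonpos_of_nonneg_of_nonpos (Real.exp_pos (2 * θ * r)).le h2
      refine le_trans (le_of_eq ?_) this
      ring
  have e : Real.exp (-(2 * θ * (t - s))) = Real.exp (2 * θ * s) / Real.exp (2 * θ * t) := by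
    rw [← Real.exp_sub]; ring_nf
  rw [e, div_mul_eq_mul_div, le_div_iff₀ (Real.exp_pos _)]
  linarith

/-- The rate is twice the lower spectral bound. It is needed for `θ = 1`, where it equals `2`. -/
lemma exp_mul_le_autocorrelation (h : Admissible G q θ) (x₀ : V → Fin q) {t : ℝ} (ht : 0 ≤ t) :
    Real.exp (-((4 - 2 * θ) * t)) * autocorrelation G q θ x₀ 0 ≤ autocorrelation G q θ x₀ t := by
  have he : ∀ r : ℝ, HasDerivAt (fun r => -Real.exp ((4 - 2 * θ) * r))
      (-(Real.exp ((4 - 2 * θ) * r) * (4 - 2 * θ))) r :=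
    fun r => by simpa using (((hasDerivAt_id r).const_mul (4 - 2 * θ)).exp).fun_neg
  have := le_of_hasDerivAt_nonpos ht
    (fun r => (he r).fun_mul (hasDerivAt_autocorrelation h x₀ r)) fun r _ _ => by
      have h1 := (wip_biasGen_bounds h (bias G q θ x₀ r)).2
      rw [autocorrelation_eq]
      have h2 : 0 ≤ ((4 - 2 * θ) * wip (degreeWeight G q) (bias G q θ x₀ r) (bias G q θ x₀ r) +
        2 * wip (degreeWeight G q) (bias G q θ x₀ r) (biasGen G q θ (bias G q θ x₀ r))) /
        ∑ v, (G.degree v : ℝ) := div_nonneg (by linarith) (sum_degree_pos h).le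
      have := mul_nonneg (Real.exp_pos ((4 - 2 * θ) * r)).le h2
      refine le_trans (le_of_eq ?_) (neg_nonpos.mpr this)
      ring
  rw [Real.exp_neg, inv_mul_eq_div, div_le_iff₀ (Real.exp_pos _)]
  simp only [mul_zero, Real.exp_zero] at this
  linarith

lemma convexOn_exp_mul_autocorrelation (h : Admissible G q θ) (x₀ : V → Fin q) (β : ℝ) :
    ConvexOn ℝ Set.univ fun s => Real.exp (β * s) * autocorrelation G q θ x₀ s := by
  have := (convexOn_exp_mul_wip (w := degreeWeight G q) (fun p => Nat.cast_nonneg _) (biasGen G q θ)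
    (biasGen_symm h) (hasDerivAt_bias h x₀) β).smul (inv_nonneg.mpr (sum_degree_pos h).le)
  refine this.congr fun s _ => ?_
  simp only [smul_eq_mul, autocorrelation_eq]
  ring

lemma autocorrelation_zero (h : Admissible G q θ) (x₀ : V → Fin q) :
    autocorrelation G q θ x₀ 0 = 1 - 1 / q := by
  have hq : (q : ℝ) ≠ 0 := by have := h.two_le; positivity
  have e : ∀ v, ∑ j, (marginal G q θ x₀ 0 v j - 1 / (q : ℝ)) ^ 2 = (1 : ℝ) - 1 / (q : ℝ) := by
    intro v
    have : ∀ j, (marginal G q θ x₀ 0 v j - 1 / (q : ℝ)) ^ 2 =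
        (if x₀ v = j then 1 - 2 / (q : ℝ) else 0) + (1 / (q : ℝ)) ^ 2 := by
      intro j
      rw [marginal_eq_mulVec, transition_zero, Matrix.one_mulVec, hasColour]
      split_ifs <;> ring
    simp only [this, Finset.sum_add_distrib]
    simp
    field_simp
    ring
  simp only [autocorrelation, e]
  rw [← Finset.sum_mul]
  have : ∑ v, walkStationary G v = 1 := by
    simp only [walkStationary, ← Finset.sum_div, ← sum_degree_eq]
    exact div_self (sum_degree_pos h).ne'
  rw [this, one_mul]

lemma autocorrelation_zero_le_one (h : Admissible G q θ) (x₀ : V → Fin q) :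
    autocorrelation G q θ x₀ 0 ≤ 1 := by
  rw [autocorrelation_zero h]
  have : (0 : ℝ) ≤ 1 / q := by positivity
  linarith

lemma half_le_autocorrelation_zero (h : Admissible G q θ) (x₀ : V → Fin q) :
    1 / 2 ≤ autocorrelation G q θ x₀ 0 := by
  rw [autocorrelation_zero h]
  have h2 : (2 : ℝ) ≤ q := by exact_mod_cast h.two_le
  have : 1 / (q : ℝ) ≤ 1 / 2 := one_div_le_one_div_of_le (by norm_num) h2
  linarith

lemma continuous_autocorrelation (h : Admissible G q θ) (x₀ : V → Fin q) :
    Continuous (autocorrelation G q θ x₀) :=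
  continuous_iff_continuousAt.mpr fun t => (hasDerivAt_autocorrelation h x₀ t).continuousAt

lemma card_pos_real : (0 : ℝ) < Fintype.card V := by exact_mod_cast Fintype.card_pos

lemma log_card_nonneg : 0 ≤ Real.log (Fintype.card V) :=
  Real.log_nonneg (by exact_mod_cast Fintype.card_pos)

lemma autocorrelation_log_le (h : Admissible G q θ) (x₀ : V → Fin q) :
    autocorrelation G q θ x₀ (Real.log (Fintype.card V) / (2 * θ)) ≤ 1 / (Fintype.card V : ℝ) := by
  have hθ := h.pos
  have hl := log_card_nonneg (V := V)
  refine (autocorrelation_le_exp_mul h x₀ (s := 0) (by positivity)).trans ?_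
  have e : -(2 * θ * (Real.log (Fintype.card V) / (2 * θ) - 0)) = -Real.log (Fintype.card V) := by
    field_simp
    ring
  rw [e, Real.exp_neg, Real.exp_log card_pos_real, one_div]
  exact mul_le_of_le_one_right (inv_nonneg.mpr card_pos_real.le) (autocorrelation_zero_le_one h x₀)

lemma autocorrelationTime_nonneg (x₀ : V → Fin q) : 0 ≤ autocorrelationTime G q θ x₀ :=
  Real.sInf_nonneg fun _ ht => ht.1

lemma autocorrelationTime_le (h : Admissible G q θ) (x₀ : V → Fin q) :
    autocorrelationTime G q θ x₀ ≤ Real.log (Fintype.card V) / (2 * θ) := by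
  have hθ := h.pos
  have hl := log_card_nonneg (V := V)
  exact csInf_le ⟨0, fun t ht => ht.1⟩ ⟨by positivity, autocorrelation_log_le h x₀⟩

lemma autocorrelation_autocorrelationTime_le (h : Admissible G q θ) (x₀ : V → Fin q) :
    autocorrelation G q θ x₀ (autocorrelationTime G q θ x₀) ≤ 1 / (Fintype.card V : ℝ) := by
  have hθ := h.pos
  have hl := log_card_nonneg (V := V)
  have hc : IsClosed {t : ℝ | 0 ≤ t ∧ autocorrelation G q θ x₀ t ≤ 1 / (Fintype.card V : ℝ)} :=
    (isClosed_le continuous_const continuous_id).inter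
      (isClosed_le (continuous_autocorrelation h x₀) continuous_const)
  exact (hc.csInf_mem ⟨_, by positivity, autocorrelation_log_le h x₀⟩ ⟨0, fun t ht => ht.1⟩).2

lemma lt_autocorrelation_of_lt (x₀ : V → Fin q) {t : ℝ} (ht : 0 ≤ t)
    (htT : t < autocorrelationTime G q θ x₀) :
    1 / (Fintype.card V : ℝ) < autocorrelation G q θ x₀ t := by
  by_contra hc
  push Not at hc
  have : autocorrelationTime G q θ x₀ ≤ t := csInf_le ⟨0, fun t ht => ht.1⟩ ⟨ht, hc⟩
  linarith

lemma cutoffTime_nonneg (x₀ : V → Fin q) : 0 ≤ cutoffTime G q θ x₀ :=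
  (autocorrelationTime_nonneg x₀).trans (le_max_left _ _)

lemma cutoffTime_le (h : Admissible G q θ) (x₀ : V → Fin q) :
    cutoffTime G q θ x₀ ≤ Real.log (Fintype.card V) / (2 * θ) := by
  have hθ := h.pos
  have hl := log_card_nonneg (V := V)
  refine max_le (autocorrelationTime_le h x₀) ?_
  rw [div_mul_eq_mul_div, one_mul]
  gcongr
  norm_num

lemma log_card_le_cutoffTime (h : Admissible G q θ) (x₀ : V → Fin q) :
    Real.log (Fintype.card V) ≤ 4 * θ * cutoffTime G q θ x₀ := by
  have hθ := h.pos
  have := le_max_right (autocorrelationTime G q θ x₀) (1 / (4 * θ) * Real.log (Fintype.card V))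
  rw [cutoffTime]
  have h2 := mul_le_mul_of_nonneg_left this (show (0 : ℝ) ≤ 4 * θ by positivity)
  have : 4 * θ * (1 / (4 * θ) * Real.log (Fintype.card V)) = Real.log (Fintype.card V) := by
    field_simp
  linarith

/-- By log-convexity, the autocorrelation before the cutoff time cannot be much larger than at the
cutoff time. -/
lemma autocorrelation_le_before (h : Admissible G q θ) (x₀ : V → Fin q) {r : ℝ} (hr : 0 ≤ r)
    (hr' : r ≤ cutoffTime G q θ x₀) : autocorrelation G q θ x₀ r ≤
      1 / (Fintype.card V : ℝ) * Real.exp (4 * θ * (cutoffTime G q θ x₀ - r)) := by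
  set T := cutoffTime G q θ x₀ with hT
  set n : ℝ := (Fintype.card V : ℝ) with hn
  have hn0 : 0 < n := card_pos_real
  have hA : autocorrelation G q θ x₀ T ≤ 1 / n := by
    refine (autocorrelation_le_exp_mul h x₀ (le_max_left _ _)).trans ?_
    refine (mul_le_of_le_one_left (autocorrelation_nonneg h x₀ _) ?_).trans
      (autocorrelation_autocorrelationTime_le h x₀)
    rw [Real.exp_le_one_iff, neg_nonpos]
    exact mul_nonneg (by have := h.pos; positivity) (sub_nonneg.mpr (le_max_left _ _))
  have hlog := log_card_le_cutoffTime h x₀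
  rw [← hT, ← hn] at hlog
  rcases (cutoffTime_nonneg (G := G) (θ := θ) x₀).lt_or_eq with hT0 | hT0
  · rw [← hT] at hT0
    -- This rate makes `exp (β * s)` times the autocorrelation at most one at both ends `0` and `T`,
    -- hence by convexity in between; and `β ≤ 4 * θ` because `T` is at least `log n / (4 * θ)`.
    set β := Real.log n / T with hβ
    have hβT : β * T = Real.log n := by rw [hβ]; field_simp
    have hβ4 : β ≤ 4 * θ := by rw [hβ, div_le_iff₀ hT0]; exact hlog
    have hconv := convexOn_exp_mul_autocorrelation h x₀ β
    have hle := hconv.le_max_of_mem_Icc (Set.mem_univ 0) (Set.mem_univ T) (z := r) ⟨hr, hr'⟩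
    have h1 : Real.exp (β * r) * autocorrelation G q θ x₀ r ≤ 1 := by
      refine hle.trans (max_le ?_ ?_)
      · simpa using autocorrelation_zero_le_one h x₀
      · rw [hβT, Real.exp_log hn0]
        calc n * autocorrelation G q θ x₀ T ≤ n * (1 / n) := mul_le_mul_of_nonneg_left hA hn0.le
          _ = 1 := by field_simp
    have h2 : autocorrelation G q θ x₀ r ≤ Real.exp (-(β * r)) := by
      rw [Real.exp_neg, ← one_div, le_div_iff₀ (Real.exp_pos _)]
      linarith
    refine h2.trans ?_
    have h3 : 1 / n = Real.exp (-(β * T)) := by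
      rw [hβT, Real.exp_neg, Real.exp_log hn0, one_div]
    rw [h3, ← Real.exp_add]
    refine Real.exp_le_exp.mpr ?_
    nlinarith [mul_le_mul_of_nonneg_right hβ4 (sub_nonneg.mpr hr')]
  · rw [← hT] at hT0
    have : r = T := le_antisymm hr' (by rw [← hT0]; exact hr)
    rw [this]
    simpa using hA

/-! ### The first lower bound -/

lemma sum_bias (h : Admissible G q θ) (x₀ : V → Fin q) {t : ℝ} (ht : 0 ≤ t) (v : V) :
    ∑ j, bias G q θ x₀ t (v, j) = 0 := by
  have hq : (q : ℝ) ≠ 0 := by have := h.two_le; positivity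
  simp only [bias, Finset.sum_sub_distrib, marginal_eq_mulVec]
  change ∑ j, expect (transition G q θ t x₀) (hasColour v j) - _ = 0
  rw [← expect_sum]
  have : (fun x : V → Fin q => ∑ j, hasColour v j x) = fun _ => 1 := by
    ext x
    simp [hasColour]
  rw [this, expect_const (sum_transition h x₀ ht)]
  simp
  field_simp
  simp

lemma bias_sq_le (h : Admissible G q θ) (x₀ : V → Fin q) (t : ℝ) (p : V × Fin q) :
    bias G q θ x₀ t p ^ 2 ≤ wip (degreeWeight G q) (bias G q θ x₀ t) (bias G q θ x₀ t) := by
  refine le_trans ?_ (Finset.single_le_sum (f := fun p => degreeWeight G q p *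
    (bias G q θ x₀ t p * bias G q θ x₀ t p)) (fun p _ => mul_nonneg (Nat.cast_nonneg _)
    (mul_self_nonneg _)) (Finset.mem_univ p))
  have : (1 : ℝ) ≤ degreeWeight G q p := by
    rw [degreeWeight]; exact_mod_cast h.degree_pos p.1
  nlinarith [sq_nonneg (bias G q θ x₀ t p)]

/-- From any initial state the marginals converge both to the stationary ones and, as the
autocorrelation decays, to `1 / q`. -/
lemma IsStationary.expect_hasColour {μ : (V → Fin q) → ℝ} (hμ : IsStationary G q θ μ)
    (h : Admissible G q θ) (v : V) (j : Fin q) : expect μ (hasColour v j) = 1 / q := by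
  have x : V → Fin q := fun _ => j
  have h1 := (hμ.tendsto_transition h (hasColour v j) x).sub_const (1 / (q : ℝ))
  have h2 : Tendsto (fun t => bias G q θ x t (v, j)) atTop (𝓝 0) := by
    have h4 : Tendsto (fun t : ℝ => Real.sqrt ((∑ v, (G.degree v : ℝ)) * Real.exp (-(2 * θ * t))))
        atTop (𝓝 0) := by
      have h5 := ((Real.tendsto_exp_neg_atTop_nhds_zero.comp (tendsto_id.const_mul_atTop
        (show (0 : ℝ) < 2 * θ by have := h.pos; positivity))).const_mul (∑ v, (G.degree v : ℝ))).sqrt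
      simpa using h5
    refine squeeze_zero_norm' ?_ h4
    filter_upwards [eventually_ge_atTop 0] with t ht
    refine Real.abs_le_sqrt ((bias_sq_le h x t (v, j)).trans ?_)
    rw [sum_degree_mul_autocorrelation h]
    refine mul_le_mul_of_nonneg_left ?_ (sum_degree_pos h).le
    have h6 := autocorrelation_le_exp_mul h x ht
    rw [sub_zero] at h6
    exact h6.trans (mul_le_of_le_one_right (Real.exp_pos _).le (autocorrelation_zero_le_one h x))
  have h3 : expect μ (hasColour v j) - 1 / q = 0 := by
    refine tendsto_nhds_unique h1 ?_
    simpa only [bias, marginal_eq_mulVec] using h2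
  linarith

lemma tvDist_comm {S : Type*} [Fintype S] (μ ν : S → ℝ) : tvDist μ ν = tvDist ν μ := by
  simp only [tvDist, abs_sub_comm]

/-- While the autocorrelation is large compared to `1 / n`, the chain is not mixed. -/
lemma tvDist_ge_of_autocorrelation (h : Admissible G q θ) {μ : (V → Fin q) → ℝ}
    (hμ : IsStationary G q θ μ) {Δ : ℝ} (hΔ : ∀ v, (G.degree v : ℝ) ≤ Δ) (x₀ : V → Fin q)
    {t : ℝ} (ht : 0 ≤ t) (hpos : 0 < autocorrelation G q θ x₀ t) :
    1 - 4 * Δ ^ 2 * q / (θ * (Fintype.card V * autocorrelation G q θ x₀ t)) ≤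
      tvDist (transition G q θ t x₀) μ := by
  have hθ := h.pos
  have hn := card_pos_real (V := V)
  have hΔ0 : 0 ≤ Δ := le_trans (by positivity) (hΔ (Classical.arbitrary V))
  set m := bias G q θ x₀ t with hm
  set N := wip (degreeWeight G q) m m with hN
  -- The weights of this linear statistic are the biases themselves: its mean is `0` in equilibrium
  -- and the squared norm `N` at time `t`.
  set F : (V → Fin q) → ℝ := fun y => ∑ v, ∑ j, (G.degree v : ℝ) * m (v, j) * hasColour v j y with hF
  have hNA : N = (∑ v, (G.degree v : ℝ)) * autocorrelation G q θ x₀ t :=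
    sum_degree_mul_autocorrelation h x₀ t
  have hNn : Fintype.card V * autocorrelation G q θ x₀ t ≤ N := by
    rw [hNA]
    exact mul_le_mul_of_nonneg_right (card_le_sum_degree h) hpos.le
  have hnA : 0 < Fintype.card V * autocorrelation G q θ x₀ t := mul_pos hn hpos
  have hN0 : 0 < N := lt_of_lt_of_le hnA hNn
  have hE : ∀ ν : (V → Fin q) → ℝ, expect ν F =
      ∑ v, ∑ j, (G.degree v : ℝ) * m (v, j) * expect ν (hasColour v j) := by
    intro ν
    simp only [hF, expect_sum, expect_const_mul]
  have hEμ : expect μ F = 0 := by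
    rw [hE]
    refine Finset.sum_eq_zero fun v _ => ?_
    simp only [hμ.expect_hasColour h]
    rw [← Finset.sum_mul, ← Finset.mul_sum, sum_bias h x₀ ht]
    simp
  have hEt : expect (transition G q θ t x₀) F = N := by
    rw [hE, hN, wip_degreeWeight, Finset.sum_comm (s := (Finset.univ : Finset (Fin q)))]
    refine Finset.sum_congr rfl fun v _ => ?_
    have e : ∀ j, (G.degree v : ℝ) * m (v, j) * expect (transition G q θ t x₀) (hasColour v j) =
        (G.degree v : ℝ) * (m (v, j) * m (v, j)) + (G.degree v : ℝ) * (1 / q) * m (v, j) := by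
      intro j
      have : expect (transition G q θ t x₀) (hasColour v j) = m (v, j) + 1 / q := by
        simp only [hm, bias, marginal_eq_mulVec]
        rw [sub_add_cancel]
        rfl
      rw [this]
      ring
    simp only [e, Finset.sum_add_distrib, ← Finset.mul_sum]
    rw [sum_bias h x₀ ht, mul_zero, add_zero]
  set o : V → ℝ := fun v => (G.degree v : ℝ) * ∑ j, |m (v, j)| with ho
  have hinf : HasInfluence F o := by
    intro x a c
    have hFv : ∀ y, F y = ∑ v, (G.degree v : ℝ) * m (v, y v) := by
      intro y
      simp only [hF, hasColour]
      refine Finset.sum_congr rfl fun v _ => ?_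
      simp
    rw [hFv, hFv, ← Finset.sum_sub_distrib, Finset.sum_eq_single a]
    · rw [Function.update_self, ← mul_sub, abs_mul, Nat.abs_cast]
      refine mul_le_mul_of_nonneg_left ?_ (by positivity)
      by_cases hc : c = x a
      · simp only [hc, sub_self, abs_zero]
        exact Finset.sum_nonneg fun _ _ => abs_nonneg _
      · refine (abs_sub _ _).trans ?_
        rw [← Finset.sum_pair (f := fun j => |m (a, j)|) hc]
        exact Finset.sum_le_sum_of_subset_of_nonneg (Finset.subset_univ _) fun _ _ _ => abs_nonneg _
    · intro v _ hv
      rw [Function.update_of_ne hv, sub_self]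
    · simp
  -- By Cauchy-Schwarz over the colours the variance is linear in `N`, whereas the squared gap of
  -- the means is `N ^ 2`. So a large `N` separates the laws.
  have hosum : ∑ v, o v ^ 2 ≤ Δ * q * N := by
    rw [hN, wip_degreeWeight, Finset.sum_comm (s := (Finset.univ : Finset (Fin q))), Finset.mul_sum]
    refine Finset.sum_le_sum fun v _ => ?_
    have h1 : (∑ j, |m (v, j)|) ^ 2 ≤ q * ∑ j, m (v, j) * m (v, j) := by
      have := sq_sum_le_card_mul_sum_sq (s := (Finset.univ : Finset (Fin q))) (f := fun j => |m (v, j)|)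
      simpa [sq_abs, sq] using this
    have h2 := hΔ v
    have h3 : (0 : ℝ) ≤ G.degree v := by positivity
    simp only [ho, mul_pow, ← Finset.mul_sum]
    calc (G.degree v : ℝ) ^ 2 * (∑ j, |m (v, j)|) ^ 2
        ≤ (Δ * G.degree v) * (q * ∑ j, m (v, j) * m (v, j)) := by
          refine mul_le_mul ?_ h1 (sq_nonneg _) (by positivity)
          nlinarith
      _ = _ := by ring
  have hv : Δ / (2 * θ) * ∑ a, o a ^ 2 ≤ Δ ^ 2 * q / (2 * θ) * N := by
    refine (mul_le_mul_of_nonneg_left hosum (by positivity)).trans (le_of_eq ?_)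
    ring
  have h1 : ∑ y, μ y * (F y - 0) ^ 2 ≤ Δ ^ 2 * q / (2 * θ) * N := by
    rw [← hEμ, expect_variance hμ.sum_eq_one]
    exact (hμ.variance_le h hΔ hinf).trans hv
  have h2 : ∑ y, transition G q θ t x₀ y * (F y - N) ^ 2 ≤ Δ ^ 2 * q / (2 * θ) * N := by
    rw [← hEt, expect_variance (sum_transition h x₀ ht), hEt] 
    have := variance_transition_le h hΔ hinf ht x₀
    exact (le_of_eq (by rw [← hEt]; rfl)).trans (this.trans hv)
  have key := tvDist_ge_of_variance hμ.nonneg (fun y => transition_nonneg h x₀ y ht) hμ.sum_eq_one F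
    hN0 h1 h2 (sum_transition h x₀ ht)
  rw [tvDist_comm]
  refine le_trans ?_ key
  have e : 8 * (Δ ^ 2 * q / (2 * θ) * N) / (N - 0) ^ 2 = 4 * Δ ^ 2 * q / (θ * N) := by
    rw [sub_zero]
    field_simp
    ring
  rw [e]
  gcongr

end Marginal

/-! ### Two-point functions -/

section Pair

variable {G : SimpleGraph V} [DecidableRel G.Adj] {q : ℕ} {θ : ℝ}

/-- The function `f` with its values on the diagonal replaced by `0`. -/
def offDiag (f : V × V → ℝ) (p : V × V) : ℝ := if p.1 = p.2 then 0 else f p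

/-- The sum of the averages over the neighbours of the two coordinates. -/
def pairAvg (G : SimpleGraph V) [DecidableRel G.Adj] (f : V × V → ℝ) (p : V × V) : ℝ :=
  walkAvg G (fun u => f (u, p.2)) p.1 + walkAvg G (fun v => f (p.1, v)) p.2

lemma pairAvg_mono {f g : V × V → ℝ} (h : ∀ p, f p ≤ g p) (p : V × V) :
    pairAvg G f p ≤ pairAvg G g p :=
  add_le_add (walkAvg_mono fun _ _ => h _) (walkAvg_mono fun _ _ => h _)

lemma pairAvg_const (h : Admissible G q θ) (a : ℝ) (p : V × V) : pairAvg G (fun _ => a) p = 2 * a := by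
  rw [pairAvg, walkAvg_const (h.degree_pos _), walkAvg_const (h.degree_pos _)]
  ring

lemma pairAvg_add (f g : V × V → ℝ) (p : V × V) :
    pairAvg G (fun p => f p + g p) p = pairAvg G f p + pairAvg G g p := by
  simp only [pairAvg, walkAvg_add]
  ring

lemma pairAvg_sub (f g : V × V → ℝ) (p : V × V) :
    pairAvg G (fun p => f p - g p) p = pairAvg G f p - pairAvg G g p := by
  simp only [pairAvg, walkAvg_sub]
  ring

lemma pairAvg_const_mul (a : ℝ) (f : V × V → ℝ) (p : V × V) :
    pairAvg G (fun p => a * f p) p = a * pairAvg G f p := by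
  simp only [pairAvg, walkAvg_const_mul]
  ring

/-- The generator of two independent killed walks, killed when they meet. -/
def pairGen (G : SimpleGraph V) [DecidableRel G.Adj] (θ : ℝ) : (V × V → ℝ) →L[ℝ] (V × V → ℝ) :=
  LinearMap.toContinuousLinearMap
    { toFun := fun f => offDiag fun p => (1 - θ) * pairAvg G (offDiag f) p - 2 * f p
      map_add' := fun f g => by
        have e : offDiag (f + g) = fun p => offDiag f p + offDiag g p := by
          ext p; simp only [offDiag, Pi.add_apply]; split_ifs <;> simp
        ext p
        simp only [e, pairAvg_add, Pi.add_apply]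
        simp only [offDiag]
        split_ifs
        · simp
        · ring
      map_smul' := fun a f => by
        have e : offDiag (a • f) = fun p => a * offDiag f p := by
          ext p; simp only [offDiag, Pi.smul_apply, smul_eq_mul]; split_ifs <;> simp
        ext p
        simp only [e, pairAvg_const_mul, Pi.smul_apply, smul_eq_mul, RingHom.id_apply]
        simp only [offDiag]
        split_ifs
        · simp
        · ring }

lemma pairGen_apply (f : V × V → ℝ) :
    pairGen G θ f = offDiag fun p => (1 - θ) * pairAvg G (offDiag f) p - 2 * f p := rfl

/-- The product of the degrees. -/
def pairWeight (G : SimpleGraph V) [DecidableRel G.Adj] (p : V × V) : ℝ :=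
  (G.degree p.1 : ℝ) * G.degree p.2

lemma pairWeight_nonneg (p : V × V) : 0 ≤ pairWeight G p := by
  rw [pairWeight]; positivity

lemma wip_pairAvg_comm (h : Admissible G q θ) (f g : V × V → ℝ) :
    wip (pairWeight G) (pairAvg G f) g = wip (pairWeight G) f (pairAvg G g) := by
  have h1 : ∀ f g : V × V → ℝ, wip (pairWeight G) (fun p => walkAvg G (fun u => f (u, p.2)) p.1) g =
      wip (pairWeight G) f (fun p => walkAvg G (fun u => g (u, p.2)) p.1) := by
    intro f g
    rw [wip, wip, Fintype.sum_prod_type_right, Fintype.sum_prod_type_right]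
    refine Finset.sum_congr rfl fun v _ => ?_
    have := sum_degree_mul_walkAvg_comm h.degree_pos (fun u => f (u, v)) fun u => g (u, v)
    have := congrArg (fun a => (G.degree v : ℝ) * a) this
    simp only [Finset.mul_sum] at this
    simp only [pairWeight]
    convert this using 2 <;> ring
  have h2 : ∀ f g : V × V → ℝ, wip (pairWeight G) (fun p => walkAvg G (fun u => f (p.1, u)) p.2) g =
      wip (pairWeight G) f (fun p => walkAvg G (fun u => g (p.1, u)) p.2) := by
    intro f g
    rw [wip, wip, Fintype.sum_prod_type, Fintype.sum_prod_type]
    refine Finset.sum_congr rfl fun v _ => ?_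
    have := sum_degree_mul_walkAvg_comm h.degree_pos (fun u => f (v, u)) fun u => g (v, u)
    have := congrArg (fun a => (G.degree v : ℝ) * a) this
    simp only [Finset.mul_sum] at this
    simp only [pairWeight]
    convert this using 2 <;> ring
  have e : ∀ f : V × V → ℝ, pairAvg G f = (fun p => walkAvg G (fun u => f (u, p.2)) p.1) +
      fun p => walkAvg G (fun v => f (p.1, v)) p.2 := fun f => rfl
  rw [e, e, wip_add_left, h1, h2, wip_comm _ f (_ + _), wip_add_left, wip_comm _ _ f, wip_comm _ _ f]

lemma wip_offDiag_comm (w f g : V × V → ℝ) : wip w (offDiag f) g = wip w f (offDiag g) := by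
  simp only [wip, offDiag]
  exact Finset.sum_congr rfl fun p _ => by split_ifs <;> simp

lemma wip_pairGen (f g : V × V → ℝ) : wip (pairWeight G) (pairGen G θ f) g =
    (1 - θ) * wip (pairWeight G) (pairAvg G (offDiag f)) (offDiag g) -
      2 * wip (pairWeight G) (offDiag f) g := by
  rw [pairGen_apply, wip_offDiag_comm, wip_offDiag_comm]
  simp only [wip, Finset.mul_sum, ← Finset.sum_sub_distrib]
  exact Finset.sum_congr rfl fun p _ => by ring

lemma pairGen_symm (h : Admissible G q θ) (f g : V × V → ℝ) :
    wip (pairWeight G) (pairGen G θ f) g = wip (pairWeight G) f (pairGen G θ g) := by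
  rw [wip_comm _ f, wip_pairGen, wip_pairGen, wip_pairAvg_comm h, wip_comm _ (offDiag f),
    wip_comm _ (offDiag f) g, wip_offDiag_comm _ g f |>.symm]

/-- The centred indicator that two vertices have the same colour. -/
def agree {q : ℕ} (p : V × V) (y : V → Fin q) : ℝ := (if y p.1 = y p.2 then 1 else 0) - 1 / q

lemma agree_diag (u : V) (y : V → Fin q) : agree (u, u) y = 1 - 1 / q := by simp [agree]

/-- A fresh colour at one of two distinct vertices agrees with the other with probability exactly `1
/ q`. Centring therefore removes the noise term and the two-point functions satisfy a closed
equation off the diagonal. -/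
lemma generator_mulVec_agree (h : Admissible G q θ) {u v : V} (huv : u ≠ v) (x : V → Fin q) :
    (generator G q θ *ᵥ agree (u, v)) x =
      (1 - θ) * pairAvg G (fun p => agree p x) (u, v) - 2 * agree (u, v) x := by
  have hq : (q : ℝ) ≠ 0 := by have := h.two_le; positivity
  rw [generator_mulVec_eq_noisyAvg, Finset.sum_eq_add_of_mem u v (Finset.mem_univ _)
    (Finset.mem_univ _) huv]
  · have h1 : noisyAvg G q θ u (fun w => agree (u, v) (Function.update x u (x w)))
        (fun c => agree (u, v) (Function.update x u c)) =
        (1 - θ) * walkAvg G (fun w => agree (w, v) x) u := by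
      simp only [noisyAvg, agree, Function.update_self, Function.update_of_ne huv.symm]
      simp only [mul_sub, Finset.sum_sub_distrib]
      simp [hq]
    have h2 : noisyAvg G q θ v (fun w => agree (u, v) (Function.update x v (x w)))
        (fun c => agree (u, v) (Function.update x v c)) =
        (1 - θ) * walkAvg G (fun w => agree (u, w) x) v := by
      simp only [noisyAvg, agree, Function.update_self, Function.update_of_ne huv]
      simp only [mul_sub, Finset.sum_sub_distrib]
      simp [hq]
    rw [h1, h2, pairAvg]
    ring
  · intro w _ hw
    have : ∀ c, agree (u, v) (Function.update x w c) = agree (u, v) x := fun c => by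
      simp [agree, Function.update_of_ne hw.1.symm, Function.update_of_ne hw.2.symm]
    simp only [this]
    rw [noisyAvg_const h, sub_self]

lemma expect_walkAvg {S : Type*} [Fintype S] (μ : S → ℝ) (f : V → S → ℝ) (v : V) :
    expect μ (fun y => walkAvg G (fun w => f w y) v) = walkAvg G (fun w => expect μ (f w)) v := by
  simp only [walkAvg]
  rw [expect_sum]
  simp only [expect_const_mul]

lemma expect_generator_agree (h : Admissible G q θ) (ν : (V → Fin q) → ℝ) {u v : V} (huv : u ≠ v) :
    expect ν (generator G q θ *ᵥ agree (u, v)) =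
      (1 - θ) * pairAvg G (fun p => expect ν (agree p)) (u, v) - 2 * expect ν (agree (u, v)) := by
  have e : generator G q θ *ᵥ agree (u, v) = fun x =>
      (1 - θ) * pairAvg G (fun p => agree p x) (u, v) - 2 * agree (u, v) x :=
    funext fun x => generator_mulVec_agree h huv x
  rw [e, expect_sub, expect_const_mul, expect_const_mul]
  simp only [pairAvg]
  rw [expect_add, expect_walkAvg, expect_walkAvg]

lemma IsStationary.expect_agree_eq {μ : (V → Fin q) → ℝ} (hμ : IsStationary G q θ μ)
    (h : Admissible G q θ) {u v : V} (huv : u ≠ v) :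
    2 * expect μ (agree (u, v)) = (1 - θ) * pairAvg G (fun p => expect μ (agree p)) (u, v) := by
  have := hμ.expect_generator (agree (u, v))
  rw [expect_generator_agree h μ huv] at this
  linarith

lemma IsStationary.expect_agree_diag {μ : (V → Fin q) → ℝ} (hμ : IsStationary G q θ μ) (u : V) :
    expect μ (agree (u, u)) = 1 - 1 / q := by
  have : agree (q := q) (u, u) = fun _ => 1 - 1 / (q : ℝ) := funext fun y => agree_diag u y
  rw [this, expect_const hμ.sum_eq_one]

lemma half_le_one_sub (h : Admissible G q θ) : (1 / 2 : ℝ) ≤ 1 - 1 / q := by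
  have h2 : (2 : ℝ) ≤ q := by exact_mod_cast h.two_le
  have : 1 / (q : ℝ) ≤ 1 / 2 := one_div_le_one_div_of_le (by norm_num) h2
  linarith

/-- At an off-diagonal minimum `m`, the stationary equation gives `2 * m ≥ (1 - θ) * (2 * m)`, so `m
≥ 0`; the diagonal values are positive. -/
lemma IsStationary.expect_agree_nonneg {μ : (V → Fin q) → ℝ} (hμ : IsStationary G q θ μ)
    (h : Admissible G q θ) (p : V × V) : 0 ≤ expect μ (agree p) := by
  have : Nonempty (V × V) := ⟨p⟩
  obtain ⟨⟨u, v⟩, hm⟩ := Finite.exists_min fun p => expect μ (agree p)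
  refine le_trans ?_ (hm p)
  by_cases huv : u = v
  · rw [huv, hμ.expect_agree_diag]
    linarith [half_le_one_sub h]
  · have h1 := hμ.expect_agree_eq h huv
    have h2 := pairAvg_mono (G := G) hm (u, v)
    rw [pairAvg_const h] at h2
    have h3 := mul_le_mul_of_nonneg_left h2 (sub_nonneg.mpr h.le_one)
    have h4 := h.pos
    by_contra hc
    push Not at hc
    nlinarith [mul_neg_of_pos_of_neg h4 hc]

/-- Stationary correlations decay at most exponentially in the distance. -/
lemma IsStationary.le_expect_agree {μ : (V → Fin q) → ℝ} (hμ : IsStationary G q θ μ)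
    (h : Admissible G q θ) (hG : G.Connected) {Δ : ℝ} (hΔ : ∀ v, (G.degree v : ℝ) ≤ Δ) (u v : V) :
    1 / 2 * ((1 - θ) / (2 * Δ)) ^ G.dist u v ≤ expect μ (agree (u, v)) := by
  have hΔ0 : 0 < Δ := lt_of_lt_of_le (by exact_mod_cast h.degree_pos u) (hΔ u)
  have hκ : 0 ≤ (1 - θ) / (2 * Δ) := div_nonneg (sub_nonneg.mpr h.le_one) (by positivity)
  induction hd : G.dist u v generalizing u with
  | zero =>
    have : u = v := hG.dist_eq_zero_iff.mp hd
    rw [this, hμ.expect_agree_diag, pow_zero, mul_one]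
    exact half_le_one_sub h
  | succ k ih =>
    have huv : u ≠ v := by
      rintro rfl
      simp at hd
    obtain ⟨p, hp⟩ := hG.exists_walk_length_eq_dist u v
    cases p with
    | nil => exact absurd rfl huv
    | @cons _ w _ hadj p' =>
      have hw : G.dist w v = k := by
        rw [SimpleGraph.Walk.length_cons, hd] at hp
        have h1 : G.dist w v ≤ k := by
          have := SimpleGraph.dist_le p'
          omega
        have h2 := hG.dist_triangle (u := u) (v := w) (w := v)
        rw [SimpleGraph.dist_eq_one_iff_adj.mpr hadj, hd] at h2
        omega
      have h1 := ih w hw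
      have h2 := hμ.expect_agree_eq h huv
      have hnn := fun p => hμ.expect_agree_nonneg h p
      -- Only the neighbour `w` of `u` on a geodesic to `v` is kept; all other terms are
      -- nonnegative.
      have h3 : 1 / Δ * expect μ (agree (w, v)) ≤ pairAvg G (fun p => expect μ (agree p)) (u, v) := by
        have h4 : 0 ≤ walkAvg G (fun x => expect μ (agree (u, x))) v := by
          rw [← walkAvg_const (h.degree_pos v) 0]
          exact walkAvg_mono fun _ _ => hnn _
        have h5 : 1 / (G.degree u : ℝ) * expect μ (agree (w, v)) ≤
            walkAvg G (fun x => expect μ (agree (x, v))) u :=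
          Finset.single_le_sum (f := fun x => 1 / (G.degree u : ℝ) * expect μ (agree (x, v)))
            (fun x _ => mul_nonneg (by positivity) (hnn _)) (by simpa using hadj)
        have h6 : 1 / Δ ≤ 1 / (G.degree u : ℝ) :=
          one_div_le_one_div_of_le (by exact_mod_cast h.degree_pos u) (hΔ u)
        have h7 := mul_le_mul_of_nonneg_right h6 (hnn (w, v))
        simp only [pairAvg]
        linarith
      have h8 := mul_le_mul_of_nonneg_left h3 (sub_nonneg.mpr h.le_one)
      have h9 := mul_le_mul_of_nonneg_left h1 hκ
      rw [pow_succ]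
      have e : (1 - θ) / (2 * Δ) * expect μ (agree (w, v)) =
          (1 - θ) * (1 / Δ * expect μ (agree (w, v))) / 2 := by
        field_simp
      rw [e] at h9
      linarith

/-- The product of the biases at two vertices. -/
def biasProd (G : SimpleGraph V) [DecidableRel G.Adj] (q : ℕ) (θ : ℝ) (x₀ : V → Fin q) (t : ℝ)
    (p : V × V) : ℝ := ∑ j, bias G q θ x₀ t (p.1, j) * bias G q θ x₀ t (p.2, j)

lemma hasDerivAt_biasProd (h : Admissible G q θ) (x₀ : V → Fin q) (t : ℝ) (p : V × V) :
    HasDerivAt (fun t => biasProd G q θ x₀ t p)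
      ((1 - θ) * pairAvg G (biasProd G q θ x₀ t) p - 2 * biasProd G q θ x₀ t p) t := by
  have hb := fun r => hasDerivAt_pi.mp (hasDerivAt_bias h x₀ t) r
  refine (HasDerivAt.fun_sum fun j (_ : j ∈ Finset.univ) =>
    (hb (p.1, j)).fun_mul (hb (p.2, j))).congr_deriv ?_
  simp only [biasGen_apply, pairAvg, biasProd, walkAvg_sum, walkAvg_const_mul]
  have e : ∀ j, walkAvg G (fun v => bias G q θ x₀ t (v, j) * bias G q θ x₀ t (p.2, j)) p.1 =
      bias G q θ x₀ t (p.2, j) * walkAvg G (fun v => bias G q θ x₀ t (v, j)) p.1 := fun j => by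
    rw [← walkAvg_const_mul]
    simp only [mul_comm]
  simp only [e, ← Finset.sum_add_distrib, Finset.mul_sum, ← Finset.sum_sub_distrib]
  exact Finset.sum_congr rfl fun j _ => by ring

lemma biasProd_zero (h : Admissible G q θ) (x₀ : V → Fin q) (p : V × V) :
    biasProd G q θ x₀ 0 p = agree p x₀ := by
  have hq : (q : ℝ) ≠ 0 := by have := h.two_le; positivity
  have e : ∀ j, bias G q θ x₀ 0 (p.1, j) * bias G q θ x₀ 0 (p.2, j) =
      (if x₀ p.1 = j then (if x₀ p.2 = j then 1 else 0) - 1 / (q : ℝ) else 0) -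
        (if x₀ p.2 = j then 1 / (q : ℝ) else 0) + 1 / (q : ℝ) * (1 / q) := by
    intro j
    simp only [bias, marginal_eq_mulVec, transition_zero, Matrix.one_mulVec, hasColour]
    split_ifs <;> ring
  simp only [biasProd, e, agree, Finset.sum_add_distrib, Finset.sum_sub_distrib]
  simp [eq_comm]
  field_simp
  ring

/-- The deviation of the two-point function from its stationary value dominates the flow of two
walks that are killed when they meet. -/
lemma semigroup_pairGen_le (h : Admissible G q θ) {μ : (V → Fin q) → ℝ} (hμ : IsStationary G q θ μ)
    (x₀ : V → Fin q) {f : V × V → ℝ} {c : ℝ}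
    (hf : ∀ p : V × V, p.1 ≠ p.2 → c * f p ≤ expect μ (agree p)) {t : ℝ} (ht : 0 ≤ t)
    {p : V × V} (hp : p.1 ≠ p.2) : c * semigroup (pairGen G θ) t f p ≤
      expect μ (agree p) - (transition G q θ t *ᵥ agree p) x₀ + biasProd G q θ x₀ t p := by
  -- Off the diagonal `H` solves the equation of two killed walks. It starts from the stationary
  -- correlations, since the bias product at time `0` is `agree p x₀`, and on the diagonal it is a
  -- sum of squares. The flow of `pairGen` has zero diagonal values instead, so comparison applies;
  -- setting `z` to `0` on the diagonal encodes the boundary.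
  set H : ℝ → V × V → ℝ := fun t p => expect μ (agree p) - (transition G q θ t *ᵥ agree p) x₀ +
    biasProd G q θ x₀ t p with hH
  set y : ℝ → V × V → ℝ := fun t => semigroup (pairGen G θ) t f with hy
  have key := nonneg_of_deriv_ge (K := 2) (T := t)
    (z := fun t p => if p.1 = p.2 then 0 else H t p - c * y t p)
    (z' := fun t p => if p.1 = p.2 then 0 else ((1 - θ) * pairAvg G (H t) p - 2 * H t p) -
      c * ((1 - θ) * pairAvg G (offDiag (y t)) p - 2 * y t p)) (fun s p => ?_) (fun p => ?_)
      (fun s hs hst p m hm hall hneg => ?_) ht le_rfl p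
  · simp only [hp, if_false] at key
    linarith
  · by_cases hp : p.1 = p.2
    · simp only [hp, if_true]
      exact hasDerivAt_const _ _
    · simp only [hp, if_false]
      have hyd : HasDerivAt (fun s => y s p)
          ((1 - θ) * pairAvg G (offDiag (y s)) p - 2 * y s p) s := by
        have := hasDerivAt_pi.mp (hasDerivAt_semigroup_apply' (pairGen G θ) f s) p
        rw [pairGen_apply] at this
        simpa only [offDiag, hp, if_false] using this
      have hCd := (hasDerivAt_transition_mulVec (G := G) (θ := θ) (agree p) x₀ s).1
      refine ((((hCd.const_sub (expect μ (agree p))).fun_add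
        (hasDerivAt_biasProd h x₀ s p)).fun_sub (hyd.const_mul c))).congr_deriv ?_
      obtain ⟨u, v⟩ := p
      have e1 : (transition G q θ s *ᵥ (generator G q θ *ᵥ agree (u, v))) x₀ = _ :=
        expect_generator_agree h (transition G q θ s x₀) hp
      have e2 := hμ.expect_agree_eq h hp
      rw [e1]
      have e3 : pairAvg G (H s) (u, v) = pairAvg G (fun p => expect μ (agree p)) (u, v) -
          pairAvg G (fun p => expect (transition G q θ s x₀) (agree p)) (u, v) +
          pairAvg G (biasProd G q θ x₀ s) (u, v) := by
        rw [← pairAvg_sub, ← pairAvg_add]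
        rfl
      have e4 : H s (u, v) = expect μ (agree (u, v)) - expect (transition G q θ s x₀) (agree (u, v)) +
          biasProd G q θ x₀ s (u, v) := rfl
      rw [e3, e4]
      linarith
  · by_cases hp : p.1 = p.2
    · simp [hp]
    · simp only [hp, if_false, hH, hy, semigroup_zero, transition_zero, Matrix.one_mulVec,
        biasProd_zero h]
      linarith [hf p hp]
  · by_cases hp : p.1 = p.2
    · simp only [hp, if_true]
      linarith
    · simp only [hp, if_false] at hneg ⊢
      have hdiag : ∀ u, 0 ≤ H s (u, u) := by
        intro u
        have e : (transition G q θ s *ᵥ agree (u, u)) x₀ = 1 - 1 / q := by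
          have : agree (q := q) (u, u) = fun _ => 1 - 1 / (q : ℝ) := funext fun y => agree_diag u y
          rw [this, transition_mulVec_const h _ _ hs]
        simp only [hH, e, hμ.expect_agree_diag, sub_self, zero_add, biasProd]
        exact Finset.sum_nonneg fun j _ => mul_self_nonneg _
      have h1 : -(2 * m) ≤ pairAvg G (H s) p - c * pairAvg G (offDiag (y s)) p := by
        rw [← pairAvg_const_mul, ← pairAvg_sub]
        have := pairAvg_mono (G := G) (f := fun _ => -m)
          (g := fun p => H s p - c * offDiag (y s) p) (fun p => ?_) p
        · rw [pairAvg_const h] at this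
          linarith
        · have := hall p
          by_cases hp' : p.1 = p.2
          · obtain ⟨u, v⟩ := p
            dsimp only at hp'
            subst hp'
            have := hdiag u
            simp only [offDiag, if_true, mul_zero, sub_zero]
            linarith
          · simpa only [hp', if_false, offDiag] using this
      have h2 := mul_le_mul_of_nonneg_left h1 (sub_nonneg.mpr h.le_one)
      have h3 : 0 ≤ θ * m := mul_nonneg h.pos.le hm
      nlinarith

/-- The second lower bound: a local statistic of pairs separates the law from the stationary law. -/
lemma tvDist_ge_of_pair [Nonempty V] (h : Admissible G q θ) {μ : (V → Fin q) → ℝ}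
    (hμ : IsStationary G q θ μ) {Δ : ℝ} (hΔ : ∀ v, (G.degree v : ℝ) ≤ Δ) (x₀ : V → Fin q)
    {f : V × V → ℝ} {c β L : ℝ} (hc : 0 ≤ c) (hf0 : ∀ p, 0 ≤ f p) (hfd : ∀ u, f (u, u) = 0)
    (hf : ∀ p : V × V, p.1 ≠ p.2 → c * f p ≤ expect μ (agree p))
    (hrow : ∀ u, ∑ v, (G.degree v : ℝ) * f (u, v) ≤ β)
    (hcol : ∀ v, ∑ u, (G.degree u : ℝ) * f (u, v) ≤ β)
    (hL : -(L * wip (pairWeight G) f f) ≤ wip (pairWeight G) f (pairGen G θ f))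
    {t S : ℝ} (ht : 0 ≤ t) (hS : 0 < S)
    (hS' : S ≤ c * (wip (pairWeight G) f f * Real.exp (-(L * t))) -
      β * ((∑ v, (G.degree v : ℝ)) * autocorrelation G q θ x₀ t)) :
    1 - 16 * Δ ^ 3 * β ^ 2 * Fintype.card V / (θ * S ^ 2) ≤ tvDist (transition G q θ t x₀) μ := by
  have hθ := h.pos
  have hβ : 0 ≤ β := le_trans (Finset.sum_nonneg fun v _ => mul_nonneg (by positivity) (hf0 _))
    (hrow (Classical.arbitrary V))
  have hΔ0 : 0 ≤ Δ := le_trans (by positivity) (hΔ (Classical.arbitrary V))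
  set F : (V → Fin q) → ℝ := fun y => ∑ p, pairWeight G p * f p * agree p y with hF
  have hE : ∀ ν : (V → Fin q) → ℝ, expect ν F = ∑ p, pairWeight G p * f p * expect ν (agree p) := by
    intro ν
    simp only [hF, expect_sum, expect_const_mul]
  have hdiff : S ≤ expect μ F - expect (transition G q θ t x₀) F := by
    have h1 : wip (pairWeight G) f (fun p => c * semigroup (pairGen G θ) t f p) -
        wip (pairWeight G) f (biasProd G q θ x₀ t) ≤ expect μ F - expect (transition G q θ t x₀) F := by
      rw [hE, hE, wip, wip, ← Finset.sum_sub_distrib, ← Finset.sum_sub_distrib]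
      refine Finset.sum_le_sum fun p _ => ?_
      have e : ∀ a b : ℝ, pairWeight G p * (f p * a) - pairWeight G p * (f p * b) =
          pairWeight G p * f p * (a - b) := fun a b => by ring
      rw [e, ← mul_sub]
      by_cases hp : p.1 = p.2
      · have : f p = 0 := by
          obtain ⟨u, v⟩ := p
          dsimp only at hp
          rw [hp]
          exact hfd v
        simp [this]
      · refine mul_le_mul_of_nonneg_left ?_ (mul_nonneg (pairWeight_nonneg p) (hf0 p))
        have := semigroup_pairGen_le h hμ x₀ hf ht hp
        have e : (transition G q θ t *ᵥ agree p) x₀ = expect (transition G q θ t x₀) (agree p) := rfl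
        rw [e] at this
        linarith
    have h2 : wip (pairWeight G) f (fun p => c * semigroup (pairGen G θ) t f p) =
        c * wip (pairWeight G) f (semigroup (pairGen G θ) t f) := by
      simp only [wip, Finset.mul_sum]
      exact Finset.sum_congr rfl fun p _ => by ring
    have h3 := mul_le_mul_of_nonneg_left
      (wip_semigroup_ge pairWeight_nonneg (pairGen G θ) (pairGen_symm h) f hL t ht) hc
    -- Bounding a product of biases by half the sum of their squares, the row and column sums of `f`
    -- leave a multiple of the autocorrelation.
    have h4 : wip (pairWeight G) f (biasProd G q θ x₀ t) ≤
        β * ((∑ v, (G.degree v : ℝ)) * autocorrelation G q θ x₀ t) := by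
      rw [← sum_degree_mul_autocorrelation h]
      set M : V → ℝ := fun v => ∑ j, bias G q θ x₀ t (v, j) * bias G q θ x₀ t (v, j) with hM
      have hM0 : ∀ v, 0 ≤ M v := fun v => Finset.sum_nonneg fun j _ => mul_self_nonneg _
      have h5 : ∀ p, biasProd G q θ x₀ t p ≤ (M p.1 + M p.2) / 2 := by
        intro p
        simp only [biasProd, hM]
        rw [← Finset.sum_add_distrib, Finset.sum_div]
        refine Finset.sum_le_sum fun j _ => ?_
        nlinarith [sq_nonneg (bias G q θ x₀ t (p.1, j) - bias G q θ x₀ t (p.2, j))]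
      have h6 : wip (degreeWeight G q) (bias G q θ x₀ t) (bias G q θ x₀ t) =
          ∑ v, (G.degree v : ℝ) * M v := by
        rw [wip_degreeWeight, Finset.sum_comm]
        simp only [hM, Finset.mul_sum]
      have h7 : ∑ p : V × V, pairWeight G p * (f p * M p.1) ≤ β * ∑ v, (G.degree v : ℝ) * M v := by
        rw [Fintype.sum_prod_type, Finset.mul_sum]
        refine Finset.sum_le_sum fun u _ => ?_
        have : ∑ v, pairWeight G (u, v) * (f (u, v) * M u) =
            (∑ v, (G.degree v : ℝ) * f (u, v)) * ((G.degree u : ℝ) * M u) := by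
          rw [Finset.sum_mul]
          exact Finset.sum_congr rfl fun v _ => by simp only [pairWeight]; ring
        rw [this]
        exact mul_le_mul_of_nonneg_right (hrow u) (mul_nonneg (by positivity) (hM0 u))
      have h8 : ∑ p : V × V, pairWeight G p * (f p * M p.2) ≤ β * ∑ v, (G.degree v : ℝ) * M v := by
        rw [Fintype.sum_prod_type_right, Finset.mul_sum]
        refine Finset.sum_le_sum fun v _ => ?_
        have : ∑ u, pairWeight G (u, v) * (f (u, v) * M v) =
            (∑ u, (G.degree u : ℝ) * f (u, v)) * ((G.degree v : ℝ) * M v) := by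
          rw [Finset.sum_mul]
          exact Finset.sum_congr rfl fun u _ => by simp only [pairWeight]; ring
        rw [this]
        exact mul_le_mul_of_nonneg_right (hcol v) (mul_nonneg (by positivity) (hM0 v))
      have h9 : wip (pairWeight G) f (biasProd G q θ x₀ t) ≤
          (∑ p : V × V, pairWeight G p * (f p * M p.1) +
            ∑ p : V × V, pairWeight G p * (f p * M p.2)) / 2 := by
        rw [← Finset.sum_add_distrib, Finset.sum_div, wip]
        refine Finset.sum_le_sum fun p _ => ?_
        have := mul_le_mul_of_nonneg_left (h5 p) (mul_nonneg (pairWeight_nonneg (G := G) p) (hf0 p))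
        linarith
      rw [h6]
      linarith
    rw [h2] at h1
    linarith
  have hinf : HasInfluence F fun _ => 2 * Δ * β := by
    intro x a c'
    have hag : ∀ p : V × V, |agree p (Function.update x a c') - agree p x| ≤
        (if p.1 = a then 1 else 0) + (if p.2 = a then 1 else 0) := by
      intro p
      by_cases h1 : p.1 = a
      · have h2 : |agree p (Function.update x a c') - agree p x| ≤ 1 := by
          simp only [agree, sub_sub_sub_cancel_right]
          split_ifs <;> norm_num
        simp only [h1, if_true]
        split_ifs <;> linarith
      · by_cases h2 : p.2 = a
        · have h2' : |agree p (Function.update x a c') - agree p x| ≤ 1 := by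
            simp only [agree, sub_sub_sub_cancel_right]
            split_ifs <;> norm_num
          simp only [h1, h2, if_true, if_false]
          linarith
        · simp [agree, h1, h2]
    simp only [hF]
    rw [← Finset.sum_sub_distrib]
    refine (Finset.abs_sum_le_sum_abs _ _).trans ?_
    have hterm : ∀ p ∈ (Finset.univ : Finset (V × V)), |pairWeight G p * f p * agree p (Function.update x a c') -
        pairWeight G p * f p * agree p x| ≤ pairWeight G p * f p * (if p.1 = a then 1 else 0) +
          pairWeight G p * f p * (if p.2 = a then 1 else 0) := by
      intro p _
      have hw := mul_nonneg (pairWeight_nonneg (G := G) p) (hf0 p)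
      rw [← mul_sub, abs_mul, abs_of_nonneg hw, ← mul_add]
      exact mul_le_mul_of_nonneg_left (hag p) hw
    refine (Finset.sum_le_sum hterm).trans ?_
    rw [Finset.sum_add_distrib, Fintype.sum_prod_type, Fintype.sum_prod_type_right]
    simp only [mul_ite, mul_one, mul_zero, Finset.sum_ite_irrel, Finset.sum_const_zero,
      Finset.sum_ite_eq', Finset.mem_univ, if_true]
    have e1 : ∑ v, pairWeight G (a, v) * f (a, v) = (G.degree a : ℝ) * ∑ v, (G.degree v : ℝ) * f (a, v) := by
      rw [Finset.mul_sum]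
      exact Finset.sum_congr rfl fun v _ => by simp only [pairWeight]; ring
    have e2 : ∑ u, pairWeight G (u, a) * f (u, a) = (G.degree a : ℝ) * ∑ u, (G.degree u : ℝ) * f (u, a) := by
      rw [Finset.mul_sum]
      exact Finset.sum_congr rfl fun v _ => by simp only [pairWeight]; ring
    rw [e1, e2]
    have h1 : (G.degree a : ℝ) * ∑ v, (G.degree v : ℝ) * f (a, v) ≤ Δ * β :=
      mul_le_mul (hΔ a) (hrow a) (Finset.sum_nonneg fun v _ => mul_nonneg (by positivity) (hf0 _)) hΔ0
    have h2 : (G.degree a : ℝ) * ∑ u, (G.degree u : ℝ) * f (u, a) ≤ Δ * β :=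
      mul_le_mul (hΔ a) (hcol a) (Finset.sum_nonneg fun v _ => mul_nonneg (by positivity) (hf0 _)) hΔ0
    linarith
  set v : ℝ := Δ / (2 * θ) * ∑ _a : V, (2 * Δ * β) ^ 2 with hv
  have h1 : ∑ y, μ y * (F y - expect μ F) ^ 2 ≤ v := by
    rw [expect_variance hμ.sum_eq_one]
    exact hμ.variance_le h hΔ hinf
  have h2 : ∑ y, transition G q θ t x₀ y * (F y - expect (transition G q θ t x₀) F) ^ 2 ≤ v := by
    rw [expect_variance (sum_transition h x₀ ht)]
    exact variance_transition_le h hΔ hinf ht x₀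
  have hlt : expect (transition G q θ t x₀) F < expect μ F := by linarith
  have key := tvDist_ge_of_variance (fun y => transition_nonneg h x₀ y ht) hμ.nonneg
    (sum_transition h x₀ ht) F hlt h2 h1 hμ.sum_eq_one
  refine le_trans ?_ key
  have hv' : v = 2 * Δ ^ 3 * β ^ 2 * Fintype.card V / θ := by
    rw [hv, Finset.sum_const, nsmul_eq_mul, Finset.card_univ]
    field_simp
  have h3 : 8 * v / (expect μ F - expect (transition G q θ t x₀) F) ^ 2 ≤ 8 * v / S ^ 2 := by
    have : 0 ≤ v := by rw [hv']; positivity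
    gcongr
  have h4 : 8 * v / S ^ 2 = 16 * Δ ^ 3 * β ^ 2 * Fintype.card V / (θ * S ^ 2) := by
    rw [hv']
    field_simp
    ring
  linarith

end Pair

/-! ### Growth of balls -/

section Growth

variable {G : SimpleGraph V} [DecidableRel G.Adj] {q : ℕ} {θ c₀ α : ℝ}

/-- The ball of radius `r` around `v`. -/
def ball (G : SimpleGraph V) (v : V) (r : ℕ) : Finset V := Finset.univ.filter fun u => G.dist v u ≤ r

lemma mem_ball {v u : V} {r : ℕ} : u ∈ ball G v r ↔ G.dist v u ≤ r := by simp [ball]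

lemma SubexpGrowth.card_ball_le (hgr : SubexpGrowth G c₀ α) (hG : G.Connected) (v : V) {r : ℕ}
    (hr : 1 ≤ r) : ((ball G v r).card : ℝ) ≤ c₀ * Real.exp ((r : ℝ) ^ (1 - α)) := by
  refine le_trans (le_of_eq ?_) (hgr v r hr)
  congr 1
  rw [← Set.ncard_coe_finset]
  congr 1
  ext u
  simp only [ball, Finset.coe_filter, Finset.mem_univ, true_and, Set.mem_ofPred_eq]
  rw [← (hG.preconnected v u).coe_dist_eq_edist]
  exact_mod_cast Iff.rfl

/-- At radius one the growth condition bounds the degrees, uniformly over all graphs considered. -/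
lemma SubexpGrowth.degree_le (hgr : SubexpGrowth G c₀ α) (hG : G.Connected) (v : V) :
    (G.degree v : ℝ) ≤ c₀ * Real.exp 1 := by
  have h1 := hgr.card_ball_le hG v le_rfl
  rw [Nat.cast_one, Real.one_rpow] at h1
  refine le_trans ?_ h1
  rw [← SimpleGraph.card_neighborFinset_eq_degree]
  exact_mod_cast Finset.card_le_card fun u hu => by
    rw [mem_ball, SimpleGraph.dist_eq_one_iff_adj.mpr (by simpa using hu)]

/-- Walking along a geodesic, the distance from `u` takes every intermediate value. -/
lemma exists_dist_eq_of_le (hG : G.Connected) {u v : V} {r : ℕ} (hr : r ≤ G.dist u v) :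
    ∃ w, G.dist u w = r := by
  induction hd : G.dist u v generalizing v with
  | zero => exact ⟨v, by omega⟩
  | succ k ih =>
    by_cases hrk : r = k + 1
    · exact ⟨v, by omega⟩
    · obtain ⟨p, hp⟩ := hG.exists_walk_length_eq_dist v u
      rw [G.dist_comm, hd] at hp
      cases p with
      | nil => simp at hp
      | @cons _ w _ hadj p' =>
        rw [SimpleGraph.Walk.length_cons] at hp
        have h1 : G.dist u w ≤ k := by
          have := SimpleGraph.dist_le p'
          rw [G.dist_comm]
          omega
        have h2 := hG.dist_triangle (u := u) (v := w) (w := v)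
        rw [SimpleGraph.dist_eq_one_iff_adj.mpr hadj.symm, hd] at h2
        exact ih (v := w) (by omega) (by omega)

/-! ### The test function of the second lower bound -/

/-- The profile `exp (-a r)`, cut off outside of `1 ≤ r ≤ R`. -/
def profile (a : ℝ) (R r : ℕ) : ℝ := if 1 ≤ r ∧ r ≤ R then Real.exp (-(a * r)) else 0

lemma profile_nonneg (a : ℝ) (R r : ℕ) : 0 ≤ profile a R r := by
  rw [profile]; split_ifs <;> positivity

lemma profile_le_one {a : ℝ} (ha : 0 ≤ a) (R r : ℕ) : profile a R r ≤ 1 := by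
  rw [profile]
  split_ifs
  · rw [Real.exp_le_one_iff, neg_nonpos]; positivity
  · exact zero_le_one

/-- Inside its range the profile changes by at most a fraction `a` of its value. The two error terms
pay for the jump up from the diagonal and for the cut at `R`. -/
lemma profile_succ_sub_sq_le {a : ℝ} (ha : 0 ≤ a) (R r : ℕ) :
    (profile a R r - profile a R (r + 1)) ^ 2 ≤ a ^ 2 * profile a R r ^ 2 + (if r = 0 then 1 else 0) +
      (if r = R then Real.exp (-(2 * a * R)) else 0) := by
  have hnn : ∀ s : Prop, ∀ [Decidable s], (0 : ℝ) ≤ if s then Real.exp (-(2 * a * R)) else 0 :=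
    fun s _ => by split_ifs <;> positivity
  have hmain : 0 ≤ a ^ 2 * profile a R r ^ 2 := by positivity
  by_cases h0 : r = 0
  · have h1 := profile_le_one ha R 1
    have h2 := profile_nonneg a R 1
    have h3 : profile a R 0 = 0 := by simp [profile]
    have h4 := hnn (0 = R)
    subst h0
    rw [h3] at hmain ⊢
    simp only [if_true, zero_add]
    nlinarith
  · by_cases hR : r = R
    · subst hR
      have h3 : profile a r (r + 1) = 0 := by simp [profile]
      have h4 : profile a r r ^ 2 = Real.exp (-(2 * a * r)) := by
        rw [profile, if_pos ⟨by omega, le_rfl⟩, ← Real.exp_nat_mul]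
        push_cast
        ring_nf
      rw [h3, sub_zero, if_neg h0, if_pos rfl]
      linarith
    · rw [if_neg h0, if_neg hR, add_zero, add_zero]
      by_cases hlt : r < R
      · have h1 : profile a R (r + 1) = Real.exp (-a) * profile a R r := by
          rw [profile, profile, if_pos ⟨by omega, by omega⟩, if_pos ⟨by omega, by omega⟩,
            ← Real.exp_add]
          push_cast
          ring_nf
        have h2 : 1 - Real.exp (-a) ≤ a := by linarith [Real.add_one_le_exp (-a)]
        have h3 : 0 ≤ 1 - Real.exp (-a) := by
          rw [sub_nonneg, Real.exp_le_one_iff]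
          linarith
        rw [h1]
        have : (profile a R r - Real.exp (-a) * profile a R r) ^ 2 =
            (1 - Real.exp (-a)) ^ 2 * profile a R r ^ 2 := by ring
        rw [this]
        exact mul_le_mul_of_nonneg_right (pow_le_pow_left₀ h3 h2 2) (sq_nonneg _)
      · have h1 : profile a R r = 0 := by rw [profile, if_neg (by omega)]
        have h2 : profile a R (r + 1) = 0 := by rw [profile, if_neg (by omega)]
        rw [h1, h2]
        simp

/-- A Dirichlet form bound for the walk. -/
lemma sum_degree_mul_self_walkAvg_ge (h : Admissible G q θ) (φ e : V → ℝ)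
    (he : ∀ u w, G.Adj u w → (φ u - φ w) ^ 2 ≤ e u + e w) :
    ∑ u, (G.degree u : ℝ) * (φ u * φ u) - ∑ u, (G.degree u : ℝ) * e u ≤
      ∑ u, (G.degree u : ℝ) * (φ u * walkAvg G φ u) := by
  -- Polarisation: `φ u * φ w` is half the sum of the squares minus half the squared difference,
  -- which `e` controls along edges.
  have h1 : ∀ u, 1 / 2 * ((φ u ^ 2 - e u) + walkAvg G (fun w => φ w ^ 2 - e w) u) ≤
      φ u * walkAvg G φ u := by
    intro u
    rw [← walkAvg_const_mul, ← walkAvg_const (h.degree_pos u) (φ u ^ 2 - e u), ← walkAvg_add,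
      ← walkAvg_const_mul]
    refine walkAvg_mono fun w hw => ?_
    have := he u w hw
    nlinarith
  have h2 : ∑ u, (G.degree u : ℝ) * (1 / 2 * ((φ u ^ 2 - e u) +
      walkAvg G (fun w => φ w ^ 2 - e w) u)) ≤ ∑ u, (G.degree u : ℝ) * (φ u * walkAvg G φ u) :=
    Finset.sum_le_sum fun u _ => mul_le_mul_of_nonneg_left (h1 u) (by positivity)
  refine le_trans (le_of_eq ?_) h2
  have h3 := sum_degree_mul_walkAvg h.degree_pos fun w => φ w ^ 2 - e w
  have e1 : ∀ u, (G.degree u : ℝ) * (1 / 2 * ((φ u ^ 2 - e u) +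
      walkAvg G (fun w => φ w ^ 2 - e w) u)) = 1 / 2 * ((G.degree u : ℝ) * (φ u ^ 2 - e u)) +
      1 / 2 * ((G.degree u : ℝ) * walkAvg G (fun w => φ w ^ 2 - e w) u) := fun u => by ring
  simp only [e1]
  rw [Finset.sum_add_distrib, ← Finset.mul_sum, ← Finset.mul_sum, h3, ← Finset.sum_sub_distrib,
    ← add_mul, add_halves, one_mul]
  exact Finset.sum_congr rfl fun u _ => by ring

/-- The test function. -/
def testFun (G : SimpleGraph V) (a : ℝ) (R : ℕ) (p : V × V) : ℝ := profile a R (G.dist p.1 p.2)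

/-- Along an edge the distance to `v` changes by at most one; the change is charged to the endpoint
nearer to `v`. -/
lemma testFun_sub_sq_le (hG : G.Connected) {a : ℝ} (ha : 0 ≤ a) (R : ℕ) {u w : V} (huw : G.Adj u w)
    (v : V) : (testFun G a R (u, v) - testFun G a R (w, v)) ^ 2 ≤
      (a ^ 2 * testFun G a R (u, v) ^ 2 + (if u = v then 1 else 0) +
        (if G.dist u v = R then Real.exp (-(2 * a * R)) else 0)) +
      (a ^ 2 * testFun G a R (w, v) ^ 2 + (if w = v then 1 else 0) +
        (if G.dist w v = R then Real.exp (-(2 * a * R)) else 0)) := by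
  have hnn : ∀ u, 0 ≤ a ^ 2 * testFun G a R (u, v) ^ 2 + (if u = v then 1 else 0) +
        (if G.dist u v = R then Real.exp (-(2 * a * R)) else 0) := fun u => by
    refine add_nonneg (add_nonneg (by positivity) ?_) ?_ <;> split_ifs <;> positivity
  have key : ∀ u w, G.dist w v = G.dist u v + 1 → (testFun G a R (u, v) - testFun G a R (w, v)) ^ 2 ≤
      a ^ 2 * testFun G a R (u, v) ^ 2 + (if u = v then 1 else 0) +
        (if G.dist u v = R then Real.exp (-(2 * a * R)) else 0) := by
    intro u w hd
    have := profile_succ_sub_sq_le ha R (G.dist u v)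
    simp only [hG.dist_eq_zero_iff] at this
    simpa only [testFun, hd] using this
  have h1 := hG.dist_triangle (u := u) (v := w) (w := v)
  have h2 := hG.dist_triangle (u := w) (v := u) (w := v)
  rw [SimpleGraph.dist_eq_one_iff_adj.mpr huw] at h1
  rw [SimpleGraph.dist_eq_one_iff_adj.mpr huw.symm] at h2
  have hcases : G.dist w v = G.dist u v + 1 ∨ G.dist u v = G.dist w v + 1 ∨
    G.dist u v = G.dist w v := by omega
  rcases hcases with hd | hd | hd
  · linarith [key u w hd, hnn w]
  · have := key w u hd
    rw [← neg_sub, neg_sq] at this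
    linarith [hnn u]
  · have : testFun G a R (u, v) - testFun G a R (w, v) = 0 := by simp [testFun, hd]
    rw [this]
    have := add_nonneg (hnn u) (hnn w)
    simpa using this

variable [Nonempty V]

/-- For each fixed second point this is a Dirichlet form bound for one walk, and symmetry of the
test function doubles it. The errors come from the slope `a`, from the diagonal, and from the sphere
of radius `R`, on which the squared function is at most `exp (-(2 * a * R))`. -/
lemma wip_pairGen_testFun_ge (h : Admissible G q θ) (hG : G.Connected) {Δ b : ℝ} (hb : 0 ≤ b)
    (hΔ : ∀ v, (G.degree v : ℝ) ≤ Δ) {a : ℝ} (ha : 0 ≤ a) {R : ℕ}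
    (hball : ∀ v, ((ball G v R).card : ℝ) ≤ b) :
    -(2 * θ * wip (pairWeight G) (testFun G a R) (testFun G a R)) -
      2 * (a ^ 2 * wip (pairWeight G) (testFun G a R) (testFun G a R) +
        Fintype.card V * Δ ^ 2 * (1 + b * Real.exp (-(2 * a * R)))) ≤
      wip (pairWeight G) (testFun G a R) (pairGen G θ (testFun G a R)) := by
  set f := testFun G a R with hf
  have hΔ0 : 0 ≤ Δ := le_trans (by positivity) (hΔ (Classical.arbitrary V))
  set ε := Real.exp (-(2 * a * R)) with hε
  have hε0 : 0 < ε := Real.exp_pos _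
  have hoff : offDiag f = f := by
    ext p
    rw [offDiag]
    split_ifs with hp
    · simp [hf, testFun, hp, profile]
    · rfl
  have hsymm : ∀ u v, f (u, v) = f (v, u) := fun u v => by simp [hf, testFun, G.dist_comm]
  set e : V → V → ℝ := fun v u => a ^ 2 * f (u, v) ^ 2 + (if u = v then 1 else 0) +
        (if G.dist u v = R then ε else 0) with he
  have hone : ∑ v, (G.degree v : ℝ) * ∑ u, (G.degree u : ℝ) * (f (u, v) * f (u, v)) -
      ∑ v, (G.degree v : ℝ) * ∑ u, (G.degree u : ℝ) * e v u ≤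
      ∑ v, (G.degree v : ℝ) * ∑ u, (G.degree u : ℝ) * (f (u, v) * walkAvg G (fun u => f (u, v)) u) := by
    rw [← Finset.sum_sub_distrib]
    refine Finset.sum_le_sum fun v _ => ?_
    rw [← mul_sub]
    refine mul_le_mul_of_nonneg_left ?_ (by positivity)
    exact sum_degree_mul_self_walkAvg_ge h _ _ fun u w huw => testFun_sub_sq_le hG ha R huw v
  have hN : wip (pairWeight G) f f =
      ∑ v, (G.degree v : ℝ) * ∑ u, (G.degree u : ℝ) * (f (u, v) * f (u, v)) := by
    rw [wip, Fintype.sum_prod_type_right]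
    simp only [Finset.mul_sum, pairWeight]
    exact Finset.sum_congr rfl fun v _ => Finset.sum_congr rfl fun u _ => by ring
  have hP : wip (pairWeight G) (pairAvg G f) f = 2 * ∑ v, (G.degree v : ℝ) *
      ∑ u, (G.degree u : ℝ) * (f (u, v) * walkAvg G (fun u => f (u, v)) u) := by
    rw [wip]
    have e1 : ∀ p : V × V, pairWeight G p * (pairAvg G f p * f p) =
        (G.degree p.2 : ℝ) * ((G.degree p.1 : ℝ) * (f p * walkAvg G (fun u => f (u, p.2)) p.1)) +
        (G.degree p.1 : ℝ) * ((G.degree p.2 : ℝ) * (f p * walkAvg G (fun v => f (p.1, v)) p.2)) :=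
      fun p => by simp only [pairWeight, pairAvg]; ring
    simp only [e1]
    rw [Finset.sum_add_distrib, Fintype.sum_prod_type_right, Fintype.sum_prod_type, two_mul]
    simp only [Finset.mul_sum]
    congr 1
    refine Finset.sum_congr rfl fun u _ => Finset.sum_congr rfl fun v _ => ?_
    rw [hsymm u v]
    simp only [hsymm u]
  have hE : ∑ v, (G.degree v : ℝ) * ∑ u, (G.degree u : ℝ) * e v u ≤
      a ^ 2 * wip (pairWeight G) f f + Fintype.card V * Δ ^ 2 * (1 + b * ε) := by
    have h1 : ∀ v, (G.degree v : ℝ) * ∑ u, (G.degree u : ℝ) * e v u ≤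
        a ^ 2 * ((G.degree v : ℝ) * ∑ u, (G.degree u : ℝ) * (f (u, v) * f (u, v))) +
          Δ ^ 2 * (1 + b * ε) := by
      intro v
      have h2 : ∑ u, (G.degree u : ℝ) * e v u = a ^ 2 * ∑ u, (G.degree u : ℝ) * (f (u, v) * f (u, v)) +
          G.degree v + ε * ∑ u, (if G.dist u v = R then (G.degree u : ℝ) else 0) := by
        have : (G.degree v : ℝ) = ∑ u, (G.degree u : ℝ) * (if u = v then 1 else 0) := by simp
        rw [this, Finset.mul_sum, Finset.mul_sum, ← Finset.sum_add_distrib, ← Finset.sum_add_distrib]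
        refine Finset.sum_congr rfl fun u _ => ?_
        simp only [he]
        split_ifs <;> ring
      have h3 : ∑ u, (if G.dist u v = R then (G.degree u : ℝ) else 0) ≤ b * Δ := by
        calc ∑ u, (if G.dist u v = R then (G.degree u : ℝ) else 0)
            ≤ ∑ u ∈ ball G v R, Δ := by
              rw [← Finset.sum_filter]
              refine (Finset.sum_le_sum fun u _ => hΔ u).trans ?_
              refine Finset.sum_le_sum_of_subset_of_nonneg (fun u hu => ?_) fun _ _ _ => hΔ0
              rw [mem_ball, G.dist_comm]
              exact (Finset.mem_filter.mp hu).2.le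
          _ ≤ b * Δ := by
              rw [Finset.sum_const, nsmul_eq_mul]
              exact mul_le_mul_of_nonneg_right (hball v) hΔ0
      have h4 := hΔ v
      have h5 : (0 : ℝ) ≤ G.degree v := by positivity
      have h6 : (G.degree v : ℝ) + ε * ∑ u, (if G.dist u v = R then (G.degree u : ℝ) else 0) ≤
          Δ * (1 + b * ε) := by
        have := mul_le_mul_of_nonneg_left h3 hε0.le
        nlinarith
      have h7 : (G.degree v : ℝ) * ((G.degree v : ℝ) + ε * ∑ u,
          (if G.dist u v = R then (G.degree u : ℝ) else 0)) ≤ Δ * (Δ * (1 + b * ε)) := by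
        refine mul_le_mul h4 h6 ?_ hΔ0
        refine add_nonneg h5 (mul_nonneg hε0.le (Finset.sum_nonneg fun u _ => ?_))
        split_ifs <;> positivity
      rw [h2]
      nlinarith
    refine (Finset.sum_le_sum fun v _ => h1 v).trans (le_of_eq ?_)
    rw [Finset.sum_add_distrib, ← Finset.mul_sum, hN]
    simp
    ring
  have hθ1 : 0 ≤ 1 - θ := sub_nonneg.mpr h.le_one
  rw [wip_comm _ f (pairGen G θ f), wip_pairGen, hoff, hP]
  rw [← hN] at hone
  have h8 := mul_le_mul_of_nonneg_left hone hθ1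
  have hE0 : 0 ≤ ∑ v, (G.degree v : ℝ) * ∑ u, (G.degree u : ℝ) * e v u := by
    refine Finset.sum_nonneg fun v _ => mul_nonneg (by positivity) (Finset.sum_nonneg fun u _ =>
      mul_nonneg (by positivity) ?_)
    refine add_nonneg (add_nonneg (by positivity) ?_) ?_ <;> split_ifs <;> positivity
  have h9 := mul_nonneg h.pos.le hE0
  linarith

/-- Up to distance `K ≤ 1 / a` the test function is at least `exp (-1)`, and around every vertex
each distance from `1` to `K` is attained because some vertex lies at distance at least `R`. -/
lemma le_wip_testFun (h : Admissible G q θ) (hG : G.Connected) {a : ℝ} (ha : 0 ≤ a) {R K : ℕ}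
    (hK : K ≤ R) (haK : a * K ≤ 1) (hfar : ∀ u, ∃ v, R ≤ G.dist u v) :
    Fintype.card V * (K * Real.exp (-2)) ≤
      wip (pairWeight G) (testFun G a R) (testFun G a R) := by
  rw [wip, Fintype.sum_prod_type]
  have : ∀ u ∈ (Finset.univ : Finset V), K * Real.exp (-2) ≤
      ∑ v, pairWeight G (u, v) * (testFun G a R (u, v) * testFun G a R (u, v)) := by
    intro u _
    set S := Finset.univ.filter fun v => 1 ≤ G.dist u v ∧ G.dist u v ≤ K with hS
    have hcard : K ≤ S.card := by
      have h1 : Finset.Icc 1 K ⊆ S.image (G.dist u) := by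
        intro r hr
        rw [Finset.mem_Icc] at hr
        obtain ⟨v, hv⟩ := hfar u
        obtain ⟨w, hw⟩ := exists_dist_eq_of_le hG (show r ≤ G.dist u v by omega)
        refine Finset.mem_image.mpr ⟨w, ?_, hw⟩
        simp only [hS, Finset.mem_filter, Finset.mem_univ, true_and]
        omega
      have h2 := (Finset.card_le_card h1).trans Finset.card_image_le
      simpa using h2
    calc K * Real.exp (-2) ≤ ∑ v ∈ S, Real.exp (-2) := by
          rw [Finset.sum_const, nsmul_eq_mul]
          exact mul_le_mul_of_nonneg_right (by exact_mod_cast hcard) (Real.exp_pos _).le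
      _ ≤ ∑ v ∈ S, pairWeight G (u, v) * (testFun G a R (u, v) * testFun G a R (u, v)) := by
          refine Finset.sum_le_sum fun v hv => ?_
          simp only [hS, Finset.mem_filter, Finset.mem_univ, true_and] at hv
          have h1 : (1 : ℝ) ≤ pairWeight G (u, v) := by
            rw [pairWeight]
            have h2 : (1 : ℝ) ≤ G.degree u := by exact_mod_cast h.degree_pos u
            have h3 : (1 : ℝ) ≤ G.degree v := by exact_mod_cast h.degree_pos v
            dsimp only
            nlinarith
          have h4 : Real.exp (-1) ≤ testFun G a R (u, v) := by
            rw [testFun, profile, if_pos ⟨hv.1, hv.2.trans hK⟩]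
            refine Real.exp_le_exp.mpr (neg_le_neg ?_)
            refine le_trans (mul_le_mul_of_nonneg_left ?_ ha) haK
            exact_mod_cast hv.2
          have h5 : Real.exp (-2) = Real.exp (-1) * Real.exp (-1) := by
            rw [← Real.exp_add]; norm_num
          have h6 : Real.exp (-2) ≤ testFun G a R (u, v) * testFun G a R (u, v) := by
            rw [h5]
            exact mul_le_mul h4 h4 (Real.exp_pos _).le ((Real.exp_pos _).le.trans h4)
          have h7 : 0 < Real.exp (-2) := Real.exp_pos _
          nlinarith
      _ ≤ _ := Finset.sum_le_sum_of_subset_of_nonneg (Finset.subset_univ _) fun v _ _ =>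
          mul_nonneg (pairWeight_nonneg _) (mul_self_nonneg _)
  have h2 := Finset.card_nsmul_le_sum _ _ _ this
  simpa using h2

/-- The constant in the Rayleigh quotient of the test function. -/
def rayleighConst (c₀ : ℝ) : ℝ := 1 + 2 * (c₀ * Real.exp 1) ^ 2 * (1 + c₀) * Real.exp 2

/-- The second lower bound, for a graph of subexponential growth. -/
lemma tvDist_ge_of_radius (h : Admissible G q θ) (hG : G.Connected) {μ : (V → Fin q) → ℝ}
    (hμ : IsStationary G q θ μ) (hc₀ : 0 < c₀) (hα : 0 < α) (hα' : α < 1)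
    (hgr : SubexpGrowth G c₀ α) (x₀ : V → Fin q) {R : ℕ} (hR : 1 ≤ R)
    (hfar : ∀ u, ∃ v, R ≤ G.dist u v) {t S Δ b : ℝ} (ht : 0 ≤ t) (hS : 0 < S)
    (hΔ : Δ = c₀ * Real.exp 1) (hb : b = c₀ * Real.exp ((R : ℝ) ^ (1 - α)))
    (hS' : S ≤ 1 / 2 * ((1 - θ) / (2 * Δ)) ^ R * (Fintype.card V * Real.exp (-2) *
        Real.exp (-((2 * θ + 2 * (rayleighConst c₀ * (R : ℝ) ^ (-α))) * t))) -
      Δ * b * (Fintype.card V * Δ * autocorrelation G q θ x₀ t)) :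
    1 - 16 * Δ ^ 3 * (Δ * b) ^ 2 * Fintype.card V / (θ * S ^ 2) ≤ tvDist (transition G q θ t x₀) μ := by
  have hθ := h.pos
  have hdeg : ∀ v, (G.degree v : ℝ) ≤ Δ := fun v => hΔ ▸ hgr.degree_le hG v
  have hΔ0 : 0 < Δ := by rw [hΔ]; positivity
  have hΔ1 : 1 ≤ Δ := le_trans (by exact_mod_cast h.degree_pos (Classical.arbitrary V))
    (hdeg (Classical.arbitrary V))
  have hb0 : 0 < b := by rw [hb]; positivity
  have hball : ∀ v, ((ball G v R).card : ℝ) ≤ b := fun v => hb ▸ hgr.card_ball_le hG v hR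
  have hRr : (1 : ℝ) ≤ R := by exact_mod_cast hR
  have hR0 : (0 : ℝ) < R := by linarith
  -- With this slope `a * R = R ^ (1 - α)` is the growth exponent, so that the cut at `R` costs no
  -- more than `c₀` per vertex, while the plateau length `K` is of order `1 / a`.
  set a : ℝ := (R : ℝ) ^ (-α) with ha
  have ha0 : 0 < a := by positivity
  have ha1 : a ≤ 1 := Real.rpow_le_one_of_one_le_of_nonpos hRr (by linarith)
  set K : ℕ := ⌊(R : ℝ) ^ α⌋₊ with hK
  have hRα1 : (1 : ℝ) ≤ (R : ℝ) ^ α := Real.one_le_rpow hRr hα.le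
  have hKle : (K : ℝ) ≤ (R : ℝ) ^ α := Nat.floor_le (by positivity)
  have hK1 : 1 ≤ K := Nat.le_floor (by simpa using hRα1)
  have hK2 : (R : ℝ) ^ α ≤ 2 * K := by
    have := Nat.lt_floor_add_one ((R : ℝ) ^ α)
    have h1 : (1 : ℝ) ≤ K := by exact_mod_cast hK1
    rw [← hK] at this
    linarith
  have hKR : K ≤ R := by
    have : (R : ℝ) ^ α ≤ (R : ℝ) ^ (1 : ℝ) := Real.rpow_le_rpow_of_exponent_le hRr hα'.le
    rw [Real.rpow_one] at this
    exact_mod_cast hKle.trans this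
  have hainv : a * (R : ℝ) ^ α = 1 := by
    rw [ha, ← Real.rpow_add hR0]
    simp
  have haK : a * K ≤ 1 := by
    rw [← hainv]
    exact mul_le_mul_of_nonneg_left hKle ha0.le
  have haR : a * R = (R : ℝ) ^ (1 - α) := by
    rw [ha]
    nth_rewrite 2 [← Real.rpow_one (R : ℝ)]
    rw [← Real.rpow_add hR0]
    ring_nf
  set f := testFun G a R with hf
  set N := wip (pairWeight G) f f with hN
  have hn : (0 : ℝ) < Fintype.card V := card_pos_real
  have hNK := le_wip_testFun h hG ha0.le hKR haK hfar
  rw [← hf, ← hN] at hNK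
  have hN1 : Fintype.card V * Real.exp (-2) ≤ N := by
    refine le_trans ?_ hNK
    have h1 : (1 : ℝ) ≤ K := by exact_mod_cast hK1
    have : 0 < Real.exp (-2) := Real.exp_pos _
    nlinarith [mul_pos hn this]
  have hbε : b * Real.exp (-(2 * a * R)) ≤ c₀ := by
    rw [hb, mul_assoc, ← Real.exp_add]
    refine mul_le_of_le_one_right hc₀.le ?_
    rw [Real.exp_le_one_iff, mul_assoc, haR]
    have : 0 ≤ (R : ℝ) ^ (1 - α) := by positivity
    linarith
  -- Since `N` is at least of order `n * K`, hence of order `n / a`, the boundary errors of order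
  -- `n` are `O(a * N)`.
  have hX : a ^ 2 * N + Fintype.card V * Δ ^ 2 * (1 + b * Real.exp (-(2 * a * R))) ≤
      rayleighConst c₀ * a * N := by
    have h1 : a ^ 2 * N ≤ a * N := by
      have : 0 ≤ N := le_trans (by positivity) hN1
      nlinarith [mul_nonneg ha0.le this]
    have h2 : (Fintype.card V : ℝ) ≤ 2 * a * Real.exp 2 * N := by
      have e2 : Real.exp 2 * Real.exp (-2) = 1 := by rw [← Real.exp_add]; simp
      have h3 : 1 ≤ 2 * a * K := by
        have := mul_le_mul_of_nonneg_left hK2 ha0.le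
        rw [hainv] at this
        linarith
      calc (Fintype.card V : ℝ) ≤ Fintype.card V * (2 * a * K) := le_mul_of_one_le_right hn.le h3
        _ = Fintype.card V * (2 * a * K) * (Real.exp 2 * Real.exp (-2)) := by rw [e2, mul_one]
        _ = 2 * a * Real.exp 2 * (Fintype.card V * (K * Real.exp (-2))) := by ring
        _ ≤ _ := mul_le_mul_of_nonneg_left hNK (by positivity)
    have h4 : Fintype.card V * Δ ^ 2 * (1 + b * Real.exp (-(2 * a * R))) ≤
        (2 * a * Real.exp 2 * N) * Δ ^ 2 * (1 + c₀) := by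
      have hN0 : 0 ≤ N := le_trans (by positivity) hN1
      gcongr
    rw [rayleighConst, ← hΔ]
    nlinarith
  have hL : -((2 * θ + 2 * (rayleighConst c₀ * a)) * N) ≤ wip (pairWeight G) f (pairGen G θ f) := by
    have := wip_pairGen_testFun_ge h hG hb0.le hdeg ha0.le hball
    rw [← hf, ← hN] at this
    linarith
  have hκ0 : 0 ≤ (1 - θ) / (2 * Δ) := div_nonneg (sub_nonneg.mpr h.le_one) (by positivity)
  have hκ1 : (1 - θ) / (2 * Δ) ≤ 1 := by
    rw [div_le_one (by positivity)]
    linarith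
  have hsum : ∀ u, ∑ v, (G.degree v : ℝ) * f (u, v) ≤ Δ * b := by
    intro u
    calc ∑ v, (G.degree v : ℝ) * f (u, v) ≤ ∑ v, if v ∈ ball G u R then Δ else 0 := by
          refine Finset.sum_le_sum fun v _ => ?_
          split_ifs with hv
          · have h1 := hdeg v
            have h2 := profile_le_one ha0.le R (G.dist u v)
            have h3 := profile_nonneg a R (G.dist u v)
            have h4 : (0 : ℝ) ≤ G.degree v := by positivity
            simp only [hf, testFun]
            nlinarith
          · rw [mem_ball] at hv
            simp only [hf, testFun, profile]
            rw [if_neg (by omega), mul_zero]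
      _ = (ball G u R).card * Δ := by simp
      _ ≤ Δ * b := by rw [mul_comm]; exact mul_le_mul_of_nonneg_left (hball u) hΔ0.le
  refine tvDist_ge_of_pair h hμ hdeg x₀ (f := f) (c := 1 / 2 * ((1 - θ) / (2 * Δ)) ^ R) (β := Δ * b)
    (L := 2 * θ + 2 * (rayleighConst c₀ * a)) (by positivity) (fun p => profile_nonneg _ _ _)
    (fun u => by simp [hf, testFun, profile]) (fun p _ => ?_) hsum (fun v => ?_) hL ht hS
    (hS'.trans ?_)
  · have h1 := hμ.le_expect_agree h hG hdeg p.1 p.2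
    refine le_trans ?_ h1
    rw [mul_assoc]
    refine mul_le_mul_of_nonneg_left ?_ (by norm_num)
    simp only [hf, testFun, profile]
    split_ifs with hp
    · have h2 := profile_le_one ha0.le R (G.dist p.1 p.2)
      rw [profile, if_pos hp] at h2
      refine (mul_le_of_le_one_right (by positivity) h2).trans ?_
      exact pow_le_pow_of_le_one hκ0 hκ1 hp.2
    · rw [mul_zero]
      positivity
  · refine le_trans (le_of_eq ?_) (hsum v)
    exact Finset.sum_congr rfl fun u _ => by simp only [hf, testFun, G.dist_comm]
  · refine sub_le_sub ?_ ?_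
    · refine mul_le_mul_of_nonneg_left ?_ (by positivity)
      exact mul_le_mul_of_nonneg_right hN1 (Real.exp_pos _).le
    · refine mul_le_mul_of_nonneg_left ?_ (by positivity)
      exact mul_le_mul_of_nonneg_right (sum_degree_le hdeg) (autocorrelation_nonneg h x₀ t)

end Growth

/-! ### The lower bound on the mixing time -/

lemma exists_forall_mul_rpow_lt (M : ℝ) {β : ℝ} (hβ : 0 < β) :
    ∃ l₀ : ℝ, 1 ≤ l₀ ∧ ∀ l, l₀ ≤ l → M * l ^ (1 - β) < l := by
  have h1 : Tendsto (fun l : ℝ => M * l ^ (-β)) atTop (𝓝 (M * 0)) :=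
    (tendsto_rpow_neg_atTop hβ).const_mul M
  rw [mul_zero] at h1
  obtain ⟨a, ha⟩ := eventually_atTop.mp (h1.eventually (gt_mem_nhds zero_lt_one))
  refine ⟨max a 1, le_max_right _ _, fun l hl => ?_⟩
  have hl1 : 0 < l := lt_of_lt_of_le zero_lt_one ((le_max_right _ _).trans hl)
  have h2 := mul_lt_mul_of_pos_right (ha l ((le_max_left _ _).trans hl)) hl1
  rwa [one_mul, mul_assoc, ← Real.rpow_add_one hl1.ne', show -β + 1 = 1 - β by ring] at h2

section LowerBound

variable {G : SimpleGraph V} [DecidableRel G.Adj] {q : ℕ} {θ c₀ α ε : ℝ}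

lemma Admissible.of_connected (hq : 2 ≤ q) (hθ : 0 < θ) (hθ' : θ ≤ 1) (hG : G.Connected)
    (hV : 2 ≤ Fintype.card V) : Admissible G q θ := by
  have : Nontrivial V := Fintype.one_lt_card_iff_nontrivial.mp hV
  exact ⟨hq, hθ, hθ', fun u => hG.preconnected.degree_pos_of_nontrivial u⟩

variable [Nonempty V]

/-- The value of `n` times the autocorrelation above which the walk is far from equilibrium. -/
def autocorrelationLevel (q : ℕ) (θ c₀ ε : ℝ) : ℝ :=
  4 * (c₀ * Real.exp 1) ^ 2 * q / (θ * (1 - ε))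

lemma le_tvDist_of_autocorrelationLevel_le (h : Admissible G q θ) (hG : G.Connected)
    {μ : (V → Fin q) → ℝ} (hμ : IsStationary G q θ μ) (hc₀ : 0 < c₀) (hε : ε < 1)
    (hgr : SubexpGrowth G c₀ α) (x₀ : V → Fin q) {t : ℝ} (ht : 0 ≤ t)
    (hK : autocorrelationLevel q θ c₀ ε ≤ Fintype.card V * autocorrelation G q θ x₀ t) :
    ε ≤ tvDist (transition G q θ t x₀) μ := by
  have hθ := h.pos
  have hq : (0 : ℝ) < q := by have := h.two_le; positivity
  have hε' : 0 < 1 - ε := by linarith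
  have hK0 : 0 < autocorrelationLevel q θ c₀ ε := by rw [autocorrelationLevel]; positivity
  have hn := card_pos_real (V := V)
  have hA : 0 < autocorrelation G q θ x₀ t := by
    by_contra hc
    push Not at hc
    nlinarith
  refine le_trans ?_ (tvDist_ge_of_autocorrelation h hμ (hgr.degree_le hG) x₀ ht hA)
  have h1 : 4 * (c₀ * Real.exp 1) ^ 2 * q / (θ * (Fintype.card V * autocorrelation G q θ x₀ t)) ≤
      1 - ε := by
    rw [div_le_iff₀ (by positivity)]
    rw [autocorrelationLevel, div_le_iff₀ (by positivity)] at hK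
    linarith
  linarith

/-- After `t` the autocorrelation decays at rate `2 * θ`, and `K * exp (-K) ≤ 1`, so waiting `K / (2
* θ)` brings it down to `1 / n`. -/
lemma autocorrelationTime_le_add (h : Admissible G q θ) (x₀ : V → Fin q) {t K : ℝ} (ht : 0 ≤ t)
    (hK : 0 ≤ K) (hA : Fintype.card V * autocorrelation G q θ x₀ t ≤ K) :
    autocorrelationTime G q θ x₀ ≤ t + K / (2 * θ) := by
  have hθ := h.pos
  have hn := card_pos_real (V := V)
  by_contra hc
  push Not at hc
  have hc0 : 0 ≤ K / (2 * θ) := by positivity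
  have h1 := lt_autocorrelation_of_lt x₀ (by linarith) hc
  have h2 := autocorrelation_le_exp_mul h x₀ (show t ≤ t + K / (2 * θ) by linarith)
  rw [add_sub_cancel_left, mul_div_cancel₀ _ (by positivity)] at h2
  have h3 : 1 < Fintype.card V * autocorrelation G q θ x₀ (t + K / (2 * θ)) := by
    rw [div_lt_iff₀ hn] at h1
    linarith
  have h4 : Fintype.card V * autocorrelation G q θ x₀ (t + K / (2 * θ)) ≤ Real.exp (-K) * K := by
    calc _ ≤ Fintype.card V * (Real.exp (-K) * autocorrelation G q θ x₀ t) :=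
          mul_le_mul_of_nonneg_left h2 hn.le
      _ = Real.exp (-K) * (Fintype.card V * autocorrelation G q θ x₀ t) := by ring
      _ ≤ _ := mul_le_mul_of_nonneg_left hA (Real.exp_pos _).le
  have h5 : K ≤ Real.exp K := by linarith [Real.add_one_le_exp K]
  have h6 : Real.exp (-K) * K ≤ 1 := by
    rw [Real.exp_neg, inv_mul_le_iff₀ (Real.exp_pos _)]
    linarith
  linarith

/-- For `θ = 1` the lower bound on stationary pair correlations at distinct vertices is zero. But
the autocorrelation decays no faster than `exp (-2t)`, so up to time `log n / 4` the first
obstruction persists. -/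
lemma le_tvDist_of_noise_eq_one (h : Admissible G q 1) (hG : G.Connected)
    {μ : (V → Fin q) → ℝ} (hμ : IsStationary G q 1 μ) (hc₀ : 0 < c₀) (hε : ε < 1)
    (hgr : SubexpGrowth G c₀ α) (x₀ : V → Fin q) {t : ℝ} (ht : 0 ≤ t)
    (ht' : t ≤ Real.log (Fintype.card V) / 4)
    (hl : 4 * autocorrelationLevel q 1 c₀ ε ≤ Real.log (Fintype.card V)) :
    ε ≤ tvDist (transition G q 1 t x₀) μ := by
  have hn := card_pos_real (V := V)
  refine le_tvDist_of_autocorrelationLevel_le h hG hμ hc₀ hε hgr x₀ ht ?_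
  have h1 := exp_mul_le_autocorrelation h x₀ ht
  have h2 := half_le_autocorrelation_zero h x₀
  set l := Real.log (Fintype.card V) with hldef
  have h3 : Real.exp (-(l / 2)) * (1 / 2) ≤ autocorrelation G q 1 x₀ t := by
    refine le_trans ?_ h1
    refine mul_le_mul (Real.exp_le_exp.mpr ?_) h2 (by norm_num) (Real.exp_pos _).le
    linarith
  have h4 : (Fintype.card V : ℝ) * Real.exp (-(l / 2)) = Real.exp (l / 2) := by
    rw [← Real.exp_log hn, ← hldef, ← Real.exp_add]
    ring_nf
  have h5 := mul_le_mul_of_nonneg_left h3 hn.le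
  rw [← mul_assoc, h4] at h5
  linarith [Real.add_one_le_exp (l / 2)]

set_option maxHeartbeats 1000000 in
-- The pair statistic is used at a radius `R` of order `x = l ^ (1 - α / 2)`. The correlation at
-- distance `R`, the ball sizes, and the excess of the Rayleigh quotient over the time `t` each lose
-- a factor `exp (O(x))`. Being `C * x` early gains `exp (2 * θ * C * x)`, and `C` is chosen to win.
lemma le_tvDist_of_noise_lt_one (h : Admissible G q θ) (hG : G.Connected)
    {μ : (V → Fin q) → ℝ} (hμ : IsStationary G q θ μ) (hθ1 : θ < 1) (hc₀ : 0 < c₀) (hε : ε < 1)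
    (hα : 0 < α) (hα' : α < 1)
    (hgr : SubexpGrowth G c₀ α) (x₀ : V → Fin q) {t C l x K Q M lam : ℝ} (ht : 0 ≤ t) (hK : 0 ≤ K)
    (hl : l = Real.log (Fintype.card V)) (hl1 : 1 ≤ l) (hx : x = l ^ (1 - α / 2))
    (hA : Fintype.card V * autocorrelation G q θ x₀ t ≤ K)
    (hQ : Q = √(16 * (c₀ * Real.exp 1) ^ 5 / (θ * (1 - ε))))
    (hM : M = 2 * Real.exp 2 * c₀ * (Q + (c₀ * Real.exp 1) ^ 2 * K))
    (hlam : lam = -Real.log ((1 - θ) / (2 * (c₀ * Real.exp 1))))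
    (hC : M + 2 + 2 * lam + rayleighConst c₀ / (2 * θ) ≤ 2 * θ * C)
    (ht' : t ≤ l / (4 * θ) - C * x) (hfarl : (c₀ + 2) * x < l) :
    ε ≤ tvDist (transition G q θ t x₀) μ := by
  have hθ := h.pos
  have hε' : 0 < 1 - ε := by linarith
  have hn := card_pos_real (V := V)
  have hnl : (Fintype.card V : ℝ) = Real.exp l := by rw [hl, Real.exp_log hn]
  have hl0 : 0 < l := by linarith
  have hx1 : 1 ≤ x := by rw [hx]; exact Real.one_le_rpow hl1 (by linarith)
  set Δ : ℝ := c₀ * Real.exp 1 with hΔ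
  have hΔ0 : 0 < Δ := by positivity
  have hΔ1 : 1 ≤ Δ := le_trans (by exact_mod_cast h.degree_pos (Classical.arbitrary V))
    (hgr.degree_le hG (Classical.arbitrary V))
  set R : ℕ := ⌈x⌉₊ with hR
  have hxR : x ≤ R := Nat.le_ceil x
  have hR2 : (R : ℝ) ≤ 2 * x := by linarith [Nat.ceil_lt_add_one (show 0 ≤ x by linarith)]
  have hR1r : (1 : ℝ) ≤ R := hx1.trans hxR
  have hR1 : 1 ≤ R := by exact_mod_cast hR1r
  have hRα : (R : ℝ) ^ (1 - α) ≤ 2 * x := by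
    refine le_trans (Real.rpow_le_rpow_of_exponent_le hR1r (show 1 - α ≤ 1 by linarith)) ?_
    rwa [Real.rpow_one]
  have hb2 : c₀ * Real.exp ((R : ℝ) ^ (1 - α)) ≤ c₀ * Real.exp (2 * x) :=
    mul_le_mul_of_nonneg_left (Real.exp_le_exp.mpr hRα) hc₀.le
  -- If a ball of radius `R` contained every vertex, the growth condition would bound `n` by `exp
  -- (c₀ + 2 * x)`, which is less than `exp l`.
  have hfar : ∀ u, ∃ v, R ≤ G.dist u v := by
    intro u
    by_contra hc
    push Not at hc
    have h1 : ball G u R = Finset.univ := by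
      ext v
      simpa [mem_ball] using (hc v).le
    have h2 := hgr.card_ball_le hG u hR1
    rw [h1, Finset.card_univ, hnl] at h2
    have h3 : c₀ * Real.exp (2 * x) ≤ Real.exp (c₀ + 2 * x) := by
      rw [Real.exp_add]
      exact mul_le_mul_of_nonneg_right (by linarith [Real.add_one_le_exp c₀]) (Real.exp_pos _).le
    have h4 := Real.exp_le_exp.mp ((h2.trans hb2).trans h3)
    have h5 := le_mul_of_one_le_right hc₀.le hx1
    linarith
  have hQ0 : 0 < Q := by rw [hQ]; positivity
  have hQ2 : Q ^ 2 = 16 * Δ ^ 5 / (θ * (1 - ε)) := by rw [hQ, Real.sq_sqrt (by positivity)]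
  set b : ℝ := c₀ * Real.exp ((R : ℝ) ^ (1 - α)) with hb
  have hb0 : 0 < b := by positivity
  have hsq : Real.exp (l / 2) ^ 2 = Real.exp l := by
    rw [← Real.exp_nat_mul]
    push_cast
    ring_nf
  set ρ := rayleighConst c₀ with hρ
  have hρ0 : 0 < ρ := by rw [hρ, rayleighConst]; positivity
  -- The exponents balance: `x ^ (-α) * l = l ^ (1 - α + α ^ 2 / 2)` is at most `x` because `α < 1`.
  have hRt : (R : ℝ) ^ (-α) * t ≤ x / (4 * θ) := by
    have h1 : (R : ℝ) ^ (-α) ≤ x ^ (-α) :=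
      Real.rpow_le_rpow_of_nonpos (by linarith) hxR (by linarith)
    have hC0 : 0 ≤ C := by
      have hM0 : 0 ≤ M := by rw [hM]; positivity
      have hlam0 : 0 ≤ lam := by
        rw [hlam, neg_nonneg]
        refine Real.log_nonpos (div_nonneg (by linarith) (by positivity)) ?_
        rw [div_le_one (by positivity)]
        linarith
      have : 0 ≤ ρ / (2 * θ) := by positivity
      have h3 : 0 ≤ 2 * θ * C := by linarith
      exact nonneg_of_mul_nonneg_right h3 (by positivity)
    have h2 : t ≤ l / (4 * θ) := ht'.trans (sub_le_self _ (mul_nonneg hC0 (by linarith)))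
    have h3 : x ^ (-α) * l ≤ x := by
      rw [hx, ← Real.rpow_mul hl0.le, ← Real.rpow_add_one hl0.ne']
      refine Real.rpow_le_rpow_of_exponent_le hl1 ?_
      have := mul_le_mul_of_nonneg_left hα'.le hα.le
      linarith
    calc (R : ℝ) ^ (-α) * t ≤ x ^ (-α) * (l / (4 * θ)) := by
          refine mul_le_mul h1 h2 ht (by positivity)
      _ = x ^ (-α) * l / (4 * θ) := by ring
      _ ≤ _ := by gcongr
  have hκ : Real.exp (-(lam * (2 * x))) ≤ ((1 - θ) / (2 * Δ)) ^ R := by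
    have hκ0 : 0 < (1 - θ) / (2 * Δ) := div_pos (by linarith) (by positivity)
    have hκ1 : (1 - θ) / (2 * Δ) ≤ 1 := by
      rw [div_le_one (by positivity)]
      linarith
    have hlam0 : 0 ≤ lam := by rw [hlam, neg_nonneg]; exact Real.log_nonpos hκ0.le hκ1
    rw [← Real.exp_log (pow_pos hκ0 R), Real.log_pow]
    refine Real.exp_le_exp.mpr ?_
    have : Real.log ((1 - θ) / (2 * Δ)) = -lam := by rw [hlam, neg_neg]
    rw [this]
    have := mul_le_mul_of_nonneg_left hR2 hlam0
    linarith
  have hmain : Real.exp (l / 2) * b * (Q + Δ ^ 2 * K) ≤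
      1 / 2 * ((1 - θ) / (2 * Δ)) ^ R * (Fintype.card V * Real.exp (-2) *
        Real.exp (-((2 * θ + 2 * (ρ * (R : ℝ) ^ (-α))) * t))) := by
    have h1 : Real.exp (l / 2 + 2 * θ * C * x - ρ * x / (2 * θ)) ≤
        Fintype.card V * Real.exp (-((2 * θ + 2 * (ρ * (R : ℝ) ^ (-α))) * t)) := by
      rw [hnl, ← Real.exp_add]
      refine Real.exp_le_exp.mpr ?_
      have h2 : 2 * θ * t ≤ l / 2 - 2 * θ * C * x := by
        have := mul_le_mul_of_nonneg_left ht' (show 0 ≤ 2 * θ by positivity)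
        have e : 2 * θ * (l / (4 * θ) - C * x) = l / 2 - 2 * θ * C * x := by field_simp; ring
        linarith
      have h3 : 2 * ρ * ((R : ℝ) ^ (-α) * t) ≤ ρ * x / (2 * θ) := by
        have := mul_le_mul_of_nonneg_left hRt (show 0 ≤ 2 * ρ by positivity)
        refine this.trans (le_of_eq ?_)
        field_simp
        ring
      linarith
    have hMx : 2 * Real.exp 2 * c₀ * (Q + Δ ^ 2 * K) ≤ Real.exp (M * x) := by
      rw [← hM]
      have hM0 : 0 ≤ M := by rw [hM]; positivity
      linarith [Real.add_one_le_exp (M * x), le_mul_of_one_le_right hM0 hx1]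
    have hbQ : b * (Q + Δ ^ 2 * K) ≤ 1 / 2 * Real.exp (-2) * Real.exp ((M + 2) * x) := by
      have e2 : Real.exp (-2) * Real.exp 2 = 1 := by rw [← Real.exp_add]; simp
      calc b * (Q + Δ ^ 2 * K) ≤ c₀ * Real.exp (2 * x) * (Q + Δ ^ 2 * K) :=
            mul_le_mul_of_nonneg_right hb2 (by positivity)
        _ = Real.exp (-2) * Real.exp 2 * (c₀ * Real.exp (2 * x) * (Q + Δ ^ 2 * K)) := by
            rw [e2, one_mul]
        _ = 1 / 2 * Real.exp (-2) * (2 * Real.exp 2 * c₀ * (Q + Δ ^ 2 * K)) * Real.exp (2 * x) := by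
            ring
        _ ≤ 1 / 2 * Real.exp (-2) * Real.exp (M * x) * Real.exp (2 * x) := by gcongr
        _ = _ := by rw [mul_assoc (1 / 2 * Real.exp (-2)), ← Real.exp_add]; ring_nf
    calc Real.exp (l / 2) * b * (Q + Δ ^ 2 * K) = Real.exp (l / 2) * (b * (Q + Δ ^ 2 * K)) := by ring
      _ ≤ Real.exp (l / 2) * (1 / 2 * Real.exp (-2) * Real.exp ((M + 2) * x)) := by gcongr
      _ = 1 / 2 * Real.exp (-2) * Real.exp (l / 2 + (M + 2) * x) := by rw [Real.exp_add]; ring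
      _ ≤ 1 / 2 * Real.exp (-2) * Real.exp (-(lam * (2 * x)) +
            (l / 2 + 2 * θ * C * x - ρ * x / (2 * θ))) := by
          refine mul_le_mul_of_nonneg_left (Real.exp_le_exp.mpr ?_) (by positivity)
          have := mul_le_mul_of_nonneg_right hC (show 0 ≤ x by linarith)
          have e : (M + 2 + 2 * lam + ρ / (2 * θ)) * x =
            (M + 2) * x + lam * (2 * x) + ρ * x / (2 * θ) := by ring
          linarith
      _ = 1 / 2 * Real.exp (-(lam * (2 * x))) * (Real.exp (-2) *
            Real.exp (l / 2 + 2 * θ * C * x - ρ * x / (2 * θ))) := by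
          rw [Real.exp_add (-(lam * (2 * x)))]; ring
      _ ≤ 1 / 2 * ((1 - θ) / (2 * Δ)) ^ R * (Real.exp (-2) *
            (Fintype.card V * Real.exp (-((2 * θ + 2 * (ρ * (R : ℝ) ^ (-α))) * t)))) := by gcongr
      _ = _ := by ring
  -- `Q` is such that for this gap, `√n * b * Q`, the variance ratio in the lower bound is exactly
  -- `1 - ε`.
  have hS0 : 0 < Real.exp (l / 2) * b * Q := by positivity
  have hfin := tvDist_ge_of_radius h hG hμ hc₀ hα hα' hgr x₀ hR1 hfar ht hS0 hΔ hb (by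
    have h1 : Δ * b * (Fintype.card V * Δ * autocorrelation G q θ x₀ t) ≤
        Real.exp (l / 2) * b * (Δ ^ 2 * K) := by
      calc _ = b * Δ ^ 2 * (Fintype.card V * autocorrelation G q θ x₀ t) := by ring
        _ ≤ b * Δ ^ 2 * K := by gcongr
        _ = 1 * b * (Δ ^ 2 * K) := by ring
        _ ≤ _ := by
          gcongr
          exact Real.one_le_exp (by linarith)
    linarith [hmain])
  refine le_trans (le_of_eq ?_) hfin
  have : 16 * Δ ^ 3 * (Δ * b) ^ 2 * (Fintype.card V : ℝ) / (θ * (Real.exp (l / 2) * b * Q) ^ 2) =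
      1 - ε := by
    have e : (Real.exp (l / 2) * b * Q) ^ 2 = Real.exp (l / 2) ^ 2 * b ^ 2 * Q ^ 2 := by ring
    rw [e, hsq, hnl, hQ2]
    have := Real.exp_pos l
    field_simp
  rw [this]
  ring

end LowerBound

/-- Before the cutoff time, the distance to equilibrium is large. -/
theorem exists_lower_bound {θ : ℝ} (hθ : 0 < θ) (hθ' : θ ≤ 1) {q : ℕ} (hq : 2 ≤ q) {c₀ α ε : ℝ}
    (hc₀ : 0 < c₀) (hα : 0 < α) (hα' : α < 1) (hε : ε < 1) :
    ∃ C l₀ : ℝ, 0 ≤ C ∧ 1 ≤ l₀ ∧ ∀ (V : Type u) [Fintype V] [DecidableEq V] (G : SimpleGraph V)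
      [DecidableRel G.Adj], G.Connected → 2 ≤ Fintype.card V → SubexpGrowth G c₀ α →
      ∀ x₀ : V → Fin q, l₀ ≤ Real.log (Fintype.card V) → ∀ t, 0 ≤ t →
      t ≤ cutoffTime G q θ x₀ - C * Real.log (Fintype.card V) ^ (1 - α / 2) →
      ε ≤ tvDist (transition G q θ t x₀) (stationary G q θ) := by
  have hε' : 0 < 1 - ε := by linarith
  set K := autocorrelationLevel q θ c₀ ε with hK
  have hK0 : 0 ≤ K := by rw [hK, autocorrelationLevel]; positivity
  obtain ⟨l₁, hl₁, hfar⟩ := exists_forall_mul_rpow_lt (c₀ + 2) (half_pos hα)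
  set Q := √(16 * (c₀ * Real.exp 1) ^ 5 / (θ * (1 - ε))) with hQ
  set M := 2 * Real.exp 2 * c₀ * (Q + (c₀ * Real.exp 1) ^ 2 * K) with hM
  set lam := -Real.log ((1 - θ) / (2 * (c₀ * Real.exp 1))) with hlam
  set C₁ := (M + 2 + 2 * lam + rayleighConst c₀ / (2 * θ)) / (2 * θ) with hC₁
  have hKθ : 0 ≤ K / (2 * θ) := by positivity
  have hC0 : 0 ≤ max (K / (2 * θ) + 1) C₁ := le_max_of_le_left (by linarith)
  refine ⟨max (K / (2 * θ) + 1) C₁, max l₁ (4 * K), hC0, hl₁.trans (le_max_left _ _), ?_⟩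
  intro V _ _ G _ hG hV hgr x₀ hl t ht ht'
  have : Nonempty V := Fintype.card_pos_iff.mp (by omega)
  have h := Admissible.of_connected hq hθ hθ' hG hV
  have hμ := isStationary_stationary G q θ hq hθ hθ' hG hV
  -- Either the first obstruction is still active at time `t`, or the autocorrelation is already
  -- nearly `1 / n` and the second one has to act.
  by_cases hA : K ≤ Fintype.card V * autocorrelation G q θ x₀ t
  · exact le_tvDist_of_autocorrelationLevel_le h hG hμ hc₀ hε hgr x₀ ht hA
  push Not at hA
  set l := Real.log (Fintype.card V) with hldef
  have hl1 : 1 ≤ l := hl₁.trans ((le_max_left _ _).trans hl)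
  have hx1 : 1 ≤ l ^ (1 - α / 2) := Real.one_le_rpow hl1 (by linarith)
  have hT := autocorrelationTime_le_add h x₀ ht hK0 hA.le
  set C := max (K / (2 * θ) + 1) C₁ with hC
  have hCx : K / (2 * θ) + 1 ≤ C * l ^ (1 - α / 2) :=
    (le_max_left _ _).trans (le_mul_of_one_le_right hC0 hx1)
  -- The autocorrelation time is at most `t + K / (2 * θ)`, while `t` precedes the cutoff time by at
  -- least `K / (2 * θ) + 1`; so the maximum is attained by the other term.
  have hcut : cutoffTime G q θ x₀ = l / (4 * θ) := by
    rw [cutoffTime] at ht' ⊢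
    rw [← hldef, one_div_mul_eq_div] at ht' ⊢
    refine max_eq_right ?_
    by_contra hc
    push Not at hc
    rw [max_eq_left hc.le] at ht'
    linarith
  rw [hcut] at ht'
  rcases hθ'.eq_or_lt with rfl | hlt
  · refine le_tvDist_of_noise_eq_one h hG hμ hc₀ hε hgr x₀ ht ?_ ((le_max_right _ _).trans hl)
    rw [mul_one] at ht'
    linarith [mul_nonneg hC0 (zero_le_one.trans hx1)]
  · refine le_tvDist_of_noise_lt_one h hG hμ hlt hc₀ hε hα hα' hgr x₀ ht hK0 hldef hl1 rfl hA.le hQ hM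
      hlam ?_ ht' (hfar l ((le_max_left _ _).trans hl))
    have : C₁ ≤ C := le_max_right _ _
    rw [hC₁, div_le_iff₀ (by positivity)] at this
    linarith

/-! ### An inhomogeneous linear flow driven by the biases -/

/-- Duhamel's formula. With the inverse flow inside, the integrand does not depend on the final
time. -/
lemma hasDerivAt_duhamel {E : Type*} [NormedAddCommGroup E] [NormedSpace ℝ E] [CompleteSpace E]
    (Λ : E →L[ℝ] E) {F : ℝ → E} (hF : Continuous F) (t : ℝ) :
    HasDerivAt (fun t => semigroup Λ t (∫ s in (0 : ℝ)..t, semigroup Λ (-s) (F s)))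
      (Λ (semigroup Λ t (∫ s in (0 : ℝ)..t, semigroup Λ (-s) (F s))) + F t) t := by
  have hs : Continuous (semigroup Λ) :=
    continuous_iff_continuousAt.mpr fun s => (hasDerivAt_semigroup Λ s).continuousAt
  have hc : Continuous fun s => semigroup Λ (-s) (F s) := (hs.comp continuous_neg).clm_apply hF
  have h1 := (hc.integral_hasStrictDerivAt 0 t).hasDerivAt
  refine ((hasDerivAt_semigroup' Λ t).clm_apply h1).congr_deriv ?_
  rw [semigroup_neg_apply]
  rfl

section Correction

variable (G : SimpleGraph V) [DecidableRel G.Adj] (q : ℕ) (θ : ℝ)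

/-- The `ℓ¹` norm of the biases at a vertex. -/
def biasNorm (x₀ : V → Fin q) (t : ℝ) (v : V) : ℝ := ∑ c, |bias G q θ x₀ t (v, c)|

/-- The source term of the correction. -/
def correctionSource (x₀ : V → Fin q) (t : ℝ) (v : V) : ℝ :=
  (1 - θ) * walkAvg G (biasNorm G q θ x₀ t) v + θ * biasNorm G q θ x₀ t v

/-- The generator of the correction. -/
def correctionGen : (V → ℝ) →L[ℝ] (V → ℝ) :=
  LinearMap.toContinuousLinearMap
    { toFun := fun f v => (1 - θ) * walkAvg G f v - (1 + θ) * f v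
      map_add' := fun f g => by
        ext v
        simp only [Pi.add_apply]
        rw [show f + g = fun v => f v + g v from rfl, walkAvg_add]
        ring
      map_smul' := fun a f => by
        ext v
        simp only [Pi.smul_apply, smul_eq_mul, RingHom.id_apply]
        rw [show a • f = fun v => a * f v from rfl, walkAvg_const_mul]
        ring }

/-- The correction to the biases of several vertices, due to their interaction. -/
def correction (x₀ : V → Fin q) (t : ℝ) : V → ℝ :=
  semigroup (correctionGen G θ) t
    (∫ s in (0 : ℝ)..t, semigroup (correctionGen G θ) (-s) (correctionSource G q θ x₀ s))

variable {G q θ}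

lemma biasNorm_nonneg (x₀ : V → Fin q) (t : ℝ) (v : V) : 0 ≤ biasNorm G q θ x₀ t v :=
  Finset.sum_nonneg fun _ _ => abs_nonneg _

lemma walkAvg_nonneg {f : V → ℝ} (hf : ∀ v, 0 ≤ f v) (u : V) : 0 ≤ walkAvg G f u :=
  Finset.sum_nonneg fun v _ => mul_nonneg (by positivity) (hf v)

lemma correctionSource_nonneg (h : Admissible G q θ) (x₀ : V → Fin q) (t : ℝ) (v : V) :
    0 ≤ correctionSource G q θ x₀ t v :=
  add_nonneg (mul_nonneg (sub_nonneg.mpr h.le_one) (walkAvg_nonneg (biasNorm_nonneg x₀ t) v))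
    (mul_nonneg h.pos.le (biasNorm_nonneg x₀ t v))

lemma continuous_correctionSource (h : Admissible G q θ) (x₀ : V → Fin q) :
    Continuous (correctionSource G q θ x₀) := by
  have hb : Continuous (bias G q θ x₀) :=
    continuous_iff_continuousAt.mpr fun s => (hasDerivAt_bias h x₀ s).continuousAt
  have ha : ∀ v, Continuous fun t => biasNorm G q θ x₀ t v := fun v =>
    continuous_finsetSum _ fun c _ => ((continuous_apply (v, c)).comp hb).abs
  refine continuous_pi fun v => ?_
  simp only [correctionSource, walkAvg]
  refine (continuous_const.mul (continuous_finsetSum _ fun w _ => ?_)).add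
    (continuous_const.mul (ha v))
  exact continuous_const.mul (ha w)

lemma hasDerivAt_correction (h : Admissible G q θ) (x₀ : V → Fin q) (t : ℝ) (v : V) :
    HasDerivAt (fun t => correction G q θ x₀ t v)
      ((1 - θ) * walkAvg G (correction G q θ x₀ t) v - (1 + θ) * correction G q θ x₀ t v +
        correctionSource G q θ x₀ t v) t :=
  hasDerivAt_pi.mp (hasDerivAt_duhamel _ (continuous_correctionSource h x₀) t) v

lemma correction_zero (x₀ : V → Fin q) (v : V) : correction G q θ x₀ 0 v = 0 := by
  simp [correction]

lemma correction_nonneg (h : Admissible G q θ) (x₀ : V → Fin q) {t : ℝ} (ht : 0 ≤ t) (v : V) :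
    0 ≤ correction G q θ x₀ t v :=
  walk_nonneg h (c := 1 + θ) (T := t) (by linarith [h.pos])
    (fun s v => hasDerivAt_correction h x₀ s v) (fun v => (correction_zero x₀ v).ge)
    (fun s v _ _ => by linarith [correctionSource_nonneg h x₀ s v]) ht le_rfl v

lemma biasNorm_sq_le (x₀ : V → Fin q) (t : ℝ) (v : V) :
    biasNorm G q θ x₀ t v ^ 2 ≤ q * ∑ c, bias G q θ x₀ t (v, c) ^ 2 := by
  have := sq_sum_le_card_mul_sum_sq (s := Finset.univ) (f := fun c => |bias G q θ x₀ t (v, c)|)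
  simpa [biasNorm] using this

variable [Nonempty V]

lemma sum_degree_mul_biasNorm_sq_le (h : Admissible G q θ) {Δ : ℝ}
    (hΔ : ∀ v, (G.degree v : ℝ) ≤ Δ) (x₀ : V → Fin q) {t : ℝ} (ht : 0 ≤ t)
    (ht' : t ≤ cutoffTime G q θ x₀) :
    ∑ v, (G.degree v : ℝ) * biasNorm G q θ x₀ t v ^ 2 ≤
      q * Δ * Real.exp (4 * θ * (cutoffTime G q θ x₀ - t)) := by
  have hn := card_pos_real (V := V)
  have h1 : ∑ v, (G.degree v : ℝ) * biasNorm G q θ x₀ t v ^ 2 ≤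
      q * wip (degreeWeight G q) (bias G q θ x₀ t) (bias G q θ x₀ t) := by
    rw [wip, Fintype.sum_prod_type, Finset.mul_sum]
    refine Finset.sum_le_sum fun v _ => ?_
    refine (mul_le_mul_of_nonneg_left (biasNorm_sq_le x₀ t v) (by positivity)).trans (le_of_eq ?_)
    simp only [Finset.mul_sum, degreeWeight]
    exact Finset.sum_congr rfl fun c _ => by ring
  rw [sum_degree_mul_autocorrelation h] at h1
  refine h1.trans ?_
  rw [mul_assoc]
  refine mul_le_mul_of_nonneg_left ?_ (by positivity)
  calc (∑ v, (G.degree v : ℝ)) * autocorrelation G q θ x₀ t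
      ≤ (Fintype.card V * Δ) * (1 / (Fintype.card V : ℝ) *
        Real.exp (4 * θ * (cutoffTime G q θ x₀ - t))) := by
        refine mul_le_mul (sum_degree_le hΔ) (autocorrelation_le_before h x₀ ht ht')
          (autocorrelation_nonneg h x₀ t) ?_
        exact mul_nonneg hn.le (le_trans (by positivity) (hΔ (Classical.arbitrary V)))
    _ = Δ * Real.exp (4 * θ * (cutoffTime G q θ x₀ - t)) := by field_simp

/-- The source is a convex combination of the bias norm and its neighbour average, and averaging
contracts the degree-weighted `ℓ²` norm. -/
lemma sum_degree_mul_correctionSource_sq_le (h : Admissible G q θ) (x₀ : V → Fin q) (t : ℝ) :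
    ∑ v, (G.degree v : ℝ) * correctionSource G q θ x₀ t v ^ 2 ≤
      ∑ v, (G.degree v : ℝ) * biasNorm G q θ x₀ t v ^ 2 := by
  have hθ := h.pos
  have hθ1 : 0 ≤ 1 - θ := sub_nonneg.mpr h.le_one
  have h1 := sum_degree_mul_walkAvg_sq_le h.degree_pos (biasNorm G q θ x₀ t)
  calc ∑ v, (G.degree v : ℝ) * correctionSource G q θ x₀ t v ^ 2
      ≤ ∑ v, ((1 - θ) * ((G.degree v : ℝ) * walkAvg G (biasNorm G q θ x₀ t) v ^ 2) +
          θ * ((G.degree v : ℝ) * biasNorm G q θ x₀ t v ^ 2)) := by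
        refine Finset.sum_le_sum fun v _ => ?_
        rw [correctionSource]
        set p := walkAvg G (biasNorm G q θ x₀ t) v
        set r := biasNorm G q θ x₀ t v
        have : ((1 - θ) * p + θ * r) ^ 2 ≤ (1 - θ) * p ^ 2 + θ * r ^ 2 := by
          nlinarith [mul_nonneg (mul_nonneg hθ1 hθ.le) (sq_nonneg (p - r))]
        have := mul_le_mul_of_nonneg_left this (show (0 : ℝ) ≤ G.degree v by positivity)
        linarith
    _ ≤ _ := by
        rw [Finset.sum_add_distrib, ← Finset.mul_sum, ← Finset.mul_sum]
        nlinarith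

/-- At the cutoff time, the correction is small in the mean square. -/
lemma sum_degree_mul_correction_sq_le (h : Admissible G q θ) {Δ : ℝ}
    (hΔ : ∀ v, (G.degree v : ℝ) ≤ Δ) (x₀ : V → Fin q) (hpos : 0 < cutoffTime G q θ x₀) :
    ∑ v, (G.degree v : ℝ) * correction G q θ x₀ (cutoffTime G q θ x₀) v ^ 2 ≤
      Real.exp 1 * q * Δ * cutoffTime G q θ x₀ ^ 2 := by
  set T := cutoffTime G q θ x₀ with hT
  have hθ := h.pos
  set g := correction G q θ x₀ with hg
  set F := correctionSource G q θ x₀ with hF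
  set N : ℝ → ℝ := fun t => ∑ v, (G.degree v : ℝ) * g t v ^ 2 with hN
  set N' : ℝ → ℝ := fun t => ∑ v, (G.degree v : ℝ) *
    (2 * g t v * ((1 - θ) * walkAvg G (g t) v - (1 + θ) * g t v + F t v)) with hN'
  have hdN : ∀ t, HasDerivAt N (N' t) t := fun t => by
    refine HasDerivAt.fun_sum fun v _ => ?_
    refine (((hasDerivAt_correction h x₀ t v).pow 2).const_mul _).congr_deriv ?_
    simp [hg, hF]
  -- The squared norm of the correction decays at rate `2 * (1 + θ) - 2 * (1 - θ) = 4 * θ`. This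
  -- exactly offsets the bound `exp (4 * θ * (T - t))` on the squared source, so only a power of `T`
  -- survives.
  have hbound : ∀ t, N' t ≤ -(4 * θ) * N t + 1 / T * N t +
      T * ∑ v, (G.degree v : ℝ) * F t v ^ 2 := by
    intro t
    have h1 := (abs_le.mp (abs_sum_degree_mul_self_walkAvg_le h.degree_pos (g t))).2
    have h2 : ∀ v, 2 * g t v * F t v ≤ 1 / T * g t v ^ 2 + T * F t v ^ 2 := fun v => by
      have := two_mul_le_add_sq (g t v / √T) (√T * F t v)
      have e1 : 2 * (g t v / √T) * (√T * F t v) = 2 * g t v * F t v := by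
        have : √T ≠ 0 := (Real.sqrt_pos.mpr hpos).ne'
        field_simp
      rw [e1, div_pow, mul_pow, Real.sq_sqrt hpos.le] at this
      rw [one_div_mul_eq_div]
      exact this
    calc N' t ≤ ∑ v, (2 * (1 - θ) * ((G.degree v : ℝ) * (g t v * walkAvg G (g t) v)) -
          2 * (1 + θ) * ((G.degree v : ℝ) * g t v ^ 2) + (1 / T * ((G.degree v : ℝ) * g t v ^ 2) +
          T * ((G.degree v : ℝ) * F t v ^ 2))) := by
          refine Finset.sum_le_sum fun v _ => ?_
          have := mul_le_mul_of_nonneg_left (h2 v) (show (0 : ℝ) ≤ G.degree v by positivity)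
          linarith
      _ = 2 * (1 - θ) * ∑ v, (G.degree v : ℝ) * (g t v * walkAvg G (g t) v) -
          2 * (1 + θ) * N t + (1 / T * N t + T * ∑ v, (G.degree v : ℝ) * F t v ^ 2) := by
          simp only [hN, Finset.sum_add_distrib, Finset.sum_sub_distrib, Finset.mul_sum]
      _ ≤ _ := by
          have := mul_le_mul_of_nonneg_left h1 (show 0 ≤ 2 * (1 - θ) by linarith [h.le_one])
          simp only [hN] at this ⊢
          linarith
  -- The part `1 / T` of the integrating factor absorbs the Young inequality above; over the
  -- interval up to `T` it costs only a factor `exp 1`.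
  have he : ∀ r : ℝ, HasDerivAt (fun r => Real.exp ((4 * θ - 1 / T) * r))
      (Real.exp ((4 * θ - 1 / T) * r) * (4 * θ - 1 / T)) r :=
    fun r => by simpa using ((hasDerivAt_id r).const_mul (4 * θ - 1 / T)).exp
  set M := T * (q * Δ * Real.exp (4 * θ * T)) with hM
  have hlin : ∀ r : ℝ, HasDerivAt (fun r => M * r) M r := fun r => by
    simpa using (hasDerivAt_id r).const_mul M
  have hmono := le_of_hasDerivAt_nonpos hpos.le
    (fun r => ((he r).fun_mul (hdN r)).fun_sub (hlin r)) fun r hr hrT => by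
      have h1 := hbound r
      have h2 := (sum_degree_mul_correctionSource_sq_le h x₀ r).trans
        (sum_degree_mul_biasNorm_sq_le h hΔ x₀ hr hrT)
      rw [← hT] at h2
      set E := Real.exp ((4 * θ - 1 / T) * r) with hE
      have hE0 : 0 < E := Real.exp_pos _
      have h3 : E * (∑ v, (G.degree v : ℝ) * F r v ^ 2) ≤ q * Δ * Real.exp (4 * θ * T) := by
        have hΔ0 : 0 ≤ Δ := le_trans (by positivity) (hΔ (Classical.arbitrary V))
        calc _ ≤ E * (q * Δ * Real.exp (4 * θ * (T - r))) := mul_le_mul_of_nonneg_left h2 hE0.le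
          _ = q * Δ * Real.exp ((4 * θ - 1 / T) * r + 4 * θ * (T - r)) := by
            rw [Real.exp_add]; ring
          _ ≤ _ := by
            refine mul_le_mul_of_nonneg_left (Real.exp_le_exp.mpr ?_) (by positivity)
            have : 0 ≤ 1 / T * r := by positivity
            linarith
      have h4 := mul_le_mul_of_nonneg_left h1 hE0.le
      have h5 := mul_le_mul_of_nonneg_left h3 hpos.le
      rw [hM]
      linarith
  have hN0 : N 0 = 0 := by simp [hN, hg, correction_zero]
  simp only [hN0, mul_zero, sub_zero] at hmono
  have h6 : (4 * θ - 1 / T) * T = 4 * θ * T - 1 := by field_simp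
  rw [h6, Real.exp_sub, hM] at hmono
  have h7 : Real.exp (4 * θ * T) / Real.exp 1 * N T ≤
      T * (q * Δ * Real.exp (4 * θ * T)) * T := by linarith
  rw [div_mul_eq_mul_div, div_le_iff₀ (Real.exp_pos 1)] at h7
  have hE0 := Real.exp_pos (4 * θ * T)
  refine le_of_mul_le_mul_left (h7.trans (le_of_eq ?_)) hE0
  ring

end Correction

/-! ### The joint law of several vertices -/

section Potential

variable {G : SimpleGraph V} [DecidableRel G.Adj] {q : ℕ} {θ : ℝ}

/-- The bound for the deviation of the joint law of the vertices of `S` from equilibrium. -/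
def potential (e : ℝ) (g a : V → ℝ) (S : Finset V) : ℝ :=
  S.card * (S.card - 1) * e + (S.card - 1) * ∑ v ∈ S, g v + if S.card = 1 then ∑ v ∈ S, a v else 0

lemma potential_le {e : ℝ} {g a : V → ℝ} (ha : ∀ v, 0 ≤ a v) (S : Finset V) :
    potential e g a S ≤ S.card * (S.card - 1) * e + (S.card - 1) * ∑ v ∈ S, g v + ∑ v ∈ S, a v := by
  rw [potential]
  have := Finset.sum_nonneg fun v (_ : v ∈ S) => ha v
  split_ifs <;> linarith

/-- The bound is that of a set with one more point. If `w` already lies in `S`, two lineages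
coalesce; the term `a w` is needed precisely when `S = {w}`, where a pair becomes a single vertex
whose deviation is its bias. -/
lemma potential_insert_le {e : ℝ} {g a : V → ℝ} (he : 0 ≤ e) (hg : ∀ v, 0 ≤ g v) (ha : ∀ v, 0 ≤ a v)
    {S : Finset V} (hS : S.Nonempty) (w : V) :
    potential e g a (insert w S) ≤ (S.card + 1) * S.card * e + S.card * (∑ v ∈ S, g v + g w) + a w := by
  have hc : (1 : ℝ) ≤ S.card := by exact_mod_cast hS.card_pos
  have hs := Finset.sum_nonneg fun v (_ : v ∈ S) => hg v
  by_cases hw : w ∈ S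
  · rw [Finset.insert_eq_of_mem hw, potential]
    have h1 : (if S.card = 1 then ∑ v ∈ S, a v else 0) ≤ a w := by
      split_ifs with h1
      · obtain ⟨v, rfl⟩ := Finset.card_eq_one.mp h1
        rw [Finset.mem_singleton] at hw
        simp [hw]
      · exact ha w
    have h2 : (S.card : ℝ) * (S.card - 1) * e ≤ (S.card + 1) * S.card * e :=
      mul_le_mul_of_nonneg_right (by nlinarith) he
    have h3 := mul_nonneg (by linarith : (0 : ℝ) ≤ S.card) (hg w)
    linarith
  · rw [potential, Finset.card_insert_of_notMem hw, Finset.sum_insert hw,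
      if_neg (by have := hS.card_pos; omega)]
    push_cast
    linarith [ha w]

/-- The potential is a supersolution of the evolution of the ancestors. -/
lemma sum_potential_le (h : Admissible G q θ) {e : ℝ} {g a : V → ℝ} (he : 0 ≤ e) (hg : ∀ v, 0 ≤ g v)
    (ha : ∀ v, 0 ≤ a v) {T : Finset V} (hT : 2 ≤ T.card) :
    ∑ u ∈ T, (noisyAvg G q θ u (fun w => potential e g a (insert w (T.erase u)))
        (fun _ => potential e g a (T.erase u)) - potential e g a T) ≤
      -(2 * θ) * (T.card * (T.card - 1) * e) + (T.card - 1) * ∑ v ∈ T, ((1 - θ) * walkAvg G g v -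
        (1 + θ) * g v + ((1 - θ) * walkAvg G a v + θ * a v)) := by
  have hθ := h.pos
  have hθ1 : 0 ≤ 1 - θ := sub_nonneg.mpr h.le_one
  set m : ℝ := (T.card : ℝ) with hm
  have hm2 : 2 ≤ m := by rw [hm]; exact_mod_cast hT
  have hcard : ∀ u ∈ T, ((T.erase u).card : ℝ) = m - 1 := fun u hu => by
    rw [Finset.card_erase_of_mem hu, Nat.cast_sub (by omega)]
    simp [hm]
  have hsum : ∀ (f : V → ℝ), ∀ u ∈ T, ∑ v ∈ T.erase u, f v = ∑ v ∈ T, f v - f u := fun f u hu => by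
    rw [← Finset.add_sum_erase _ _ hu]
    ring
  set Sg := ∑ v ∈ T, g v with hSg
  set Sa := ∑ v ∈ T, a v with hSa
  -- With probability `1 - θ` the point `u` moves to a neighbour, possibly onto another point, and
  -- with probability `θ` it disappears. Summed over `u`, the coefficients of `e` combine to exactly
  -- `-2 * θ * m * (m - 1)`.
  have hterm : ∀ u ∈ T, noisyAvg G q θ u (fun w => potential e g a (insert w (T.erase u)))
        (fun _ => potential e g a (T.erase u)) - potential e g a T ≤
      (1 - θ) * (m * (m - 1) * e + (m - 1) * (Sg - g u) + (m - 1) * walkAvg G g u + walkAvg G a u) +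
      θ * ((m - 1) * (m - 2) * e + (m - 2) * (Sg - g u) + (Sa - a u)) -
      (m * (m - 1) * e + (m - 1) * Sg) := by
    intro u hu
    have hpT : potential e g a T = m * (m - 1) * e + (m - 1) * Sg := by
      rw [potential, if_neg (by omega), add_zero]
    have hd : potential e g a (T.erase u) ≤
        (m - 1) * (m - 2) * e + (m - 2) * (Sg - g u) + (Sa - a u) := by
      refine (potential_le ha _).trans (le_of_eq ?_)
      rw [hcard u hu, hsum g u hu, hsum a u hu]
      ring
    have hne : (T.erase u).Nonempty := by
      rw [← Finset.card_pos, Finset.card_erase_of_mem hu]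
      omega
    have hi : walkAvg G (fun w => potential e g a (insert w (T.erase u))) u ≤
        m * (m - 1) * e + (m - 1) * (Sg - g u) + (m - 1) * walkAvg G g u + walkAvg G a u := by
      have h1 : walkAvg G (fun w => potential e g a (insert w (T.erase u))) u ≤
          walkAvg G (fun w => (m * (m - 1) * e + (m - 1) * (Sg - g u)) + (m - 1) * g w + a w) u := by
        refine walkAvg_mono fun w _ => ?_
        refine (potential_insert_le he hg ha hne w).trans (le_of_eq ?_)
        rw [hcard u hu, hsum g u hu]
        ring
      rwa [walkAvg_add, walkAvg_add, walkAvg_const (h.degree_pos u), walkAvg_const_mul] at h1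
    have h2 := mul_le_mul_of_nonneg_left hi hθ1
    have h3 := mul_le_mul_of_nonneg_left hd hθ.le
    have h4 : ∑ _c : Fin q, 1 / (q : ℝ) * potential e g a (T.erase u) =
        potential e g a (T.erase u) := by
      have : (q : ℝ) ≠ 0 := by have := h.two_le; positivity
      simp only [Finset.sum_const, Finset.card_univ, Fintype.card_fin, nsmul_eq_mul]
      field_simp
    rw [noisyAvg, h4, hpT]
    linarith
  refine (Finset.sum_le_sum hterm).trans ?_
  set Wg := ∑ v ∈ T, walkAvg G g v with hWg
  set Wa := ∑ v ∈ T, walkAvg G a v with hWa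
  have hWa0 : 0 ≤ Wa := Finset.sum_nonneg fun v _ => walkAvg_nonneg ha v
  have e1 : ∑ u ∈ T, ((1 - θ) * (m * (m - 1) * e + (m - 1) * (Sg - g u) + (m - 1) * walkAvg G g u +
      walkAvg G a u) + θ * ((m - 1) * (m - 2) * e + (m - 2) * (Sg - g u) + (Sa - a u)) -
      (m * (m - 1) * e + (m - 1) * Sg)) =
      (1 - θ) * (m * (m * (m - 1) * e) + (m - 1) * (m * Sg - Sg) + (m - 1) * Wg + Wa) +
      θ * (m * ((m - 1) * (m - 2) * e) + (m - 2) * (m * Sg - Sg) + (m * Sa - Sa)) -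
      m * (m * (m - 1) * e + (m - 1) * Sg) := by
    simp only [Finset.sum_sub_distrib, Finset.sum_add_distrib, ← Finset.mul_sum, Finset.sum_const,
      nsmul_eq_mul, ← hm, ← hSg, ← hSa, ← hWg, ← hWa]
    ring
  have e2 : ∑ v ∈ T, ((1 - θ) * walkAvg G g v - (1 + θ) * g v + ((1 - θ) * walkAvg G a v + θ * a v)) =
      (1 - θ) * Wg - (1 + θ) * Sg + ((1 - θ) * Wa + θ * Sa) := by
    simp only [Finset.sum_sub_distrib, Finset.sum_add_distrib, ← Finset.mul_sum, ← hSg, ← hSa, ← hWg,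
      ← hWa]
  rw [e1, e2]
  have h5 : 0 ≤ (m - 2) * ((1 - θ) * Wa) := mul_nonneg (by linarith) (mul_nonneg hθ1 hWa0)
  linarith

end Potential

/-! ### Lineages extended backwards from a fixed target configuration -/

section Moves

variable {G : SimpleGraph V} [DecidableRel G.Adj] {q : ℕ} {θ : ℝ}

/-- All lineages at `u` move to `a`. -/
def Lineage.move (Φ : Lineage V q) (u : V) (a : V ⊕ Fin q) : Lineage V q :=
  fun v => if Φ v = Sum.inl u then a else Φ v

/-- An update of the initial configuration moves the far ends of the lineages, whereas
`Lineage.eval_update` acts at their near ends. -/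
lemma Lineage.eval_move (x : V → Fin q) (Φ : Lineage V q) (u : V) (a : V ⊕ Fin q) :
    (Φ.move u a).eval x = Φ.eval (Function.update x u (Sum.elim x id a)) := by
  ext v
  simp only [Lineage.eval, Lineage.move]
  rcases hv : Φ v with w | c
  · by_cases hw : w = u
    · simp [hw]
    · simp [hw]
  · simp

lemma mem_ancestors {Φ : Lineage V q} {w : V} : w ∈ ancestors Φ ↔ ∃ v, Φ v = Sum.inl w := by
  simp [ancestors]

lemma Lineage.move_of_notMem {Φ : Lineage V q} {u : V} (hu : u ∉ ancestors Φ) (a : V ⊕ Fin q) :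
    Φ.move u a = Φ := by
  ext v
  rw [Lineage.move, if_neg fun hv => hu (mem_ancestors.mpr ⟨v, hv⟩)]

/-- Coalescence: if `w` is already an ancestor, the set loses a point. -/
lemma ancestors_move_inl {Φ : Lineage V q} {u : V} (hu : u ∈ ancestors Φ) (w : V) :
    ancestors (Φ.move u (Sum.inl w)) = insert w ((ancestors Φ).erase u) := by
  obtain ⟨v₀, hv₀⟩ := mem_ancestors.mp hu
  ext z
  simp only [mem_ancestors, Finset.mem_insert, Finset.mem_erase, Lineage.move]
  constructor
  · rintro ⟨v, hv⟩
    split_ifs at hv with h1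
    · exact Or.inl (Sum.inl_injective hv).symm
    · exact Or.inr ⟨fun hz => h1 (by rw [hv, hz]), v, hv⟩
  · rintro (rfl | ⟨hz, v, hv⟩)
    · exact ⟨v₀, by rw [if_pos hv₀]⟩
    · exact ⟨v, by rw [if_neg (by rw [hv]; exact fun h => hz (Sum.inl_injective h)), hv]⟩

lemma ancestors_move_inr {Φ : Lineage V q} (u : V) (c : Fin q) :
    ancestors (Φ.move u (Sum.inr c)) = (ancestors Φ).erase u := by
  ext z
  simp only [mem_ancestors, Finset.mem_erase, Lineage.move]
  constructor
  · rintro ⟨v, hv⟩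
    split_ifs at hv with h1
    · exact ⟨fun hz => h1 (by rw [hv, hz]), v, hv⟩
  · rintro ⟨hz, v, hv⟩
    exact ⟨v, by rw [if_neg (by rw [hv]; exact fun h => hz (Sum.inl_injective h)), hv]⟩

lemma Lineage.eval_congr {Φ : Lineage V q} {x y : V → Fin q} (h : ∀ v ∈ ancestors Φ, x v = y v) :
    Φ.eval x = Φ.eval y := by
  ext v
  simp only [Lineage.eval]
  rcases hv : Φ v with w | c
  · simp [h w (mem_ancestors.mpr ⟨v, hv⟩)]
  · simp

/-- The event that the lineages lead to the configuration `y`. -/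
def leadsTo (y : V → Fin q) (Φ : Lineage V q) (x : V → Fin q) : ℝ := if Φ.eval x = y then 1 else 0

lemma generator_mulVec_leadsTo (y : V → Fin q) (Φ : Lineage V q) (x : V → Fin q) :
    (generator G q θ *ᵥ leadsTo y Φ) x = ∑ u, (noisyAvg G q θ u
      (fun w => leadsTo y (Φ.move u (Sum.inl w)) x) (fun c => leadsTo y (Φ.move u (Sum.inr c)) x) -
        leadsTo y Φ x) := by
  rw [generator_mulVec_eq_noisyAvg]
  simp only [leadsTo, Lineage.eval_move, Sum.elim_inl, Sum.elim_inr, id]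

lemma expect_noisyAvg {S : Type*} [Fintype S] (w : S → ℝ) (u : V) (A : V → S → ℝ)
    (B : Fin q → S → ℝ) : expect w (fun x => noisyAvg G q θ u (fun v => A v x) (fun c => B c x)) =
      noisyAvg G q θ u (fun v => expect w (A v)) (fun c => expect w (B c)) := by
  simp only [noisyAvg, walkAvg, expect_add, expect_const_mul, expect_sum]

/-- The deviation of the law at time `t` from equilibrium. -/
def deviation (G : SimpleGraph V) [DecidableRel G.Adj] (q : ℕ) (θ : ℝ) (μ : (V → Fin q) → ℝ)
    (x₀ : V → Fin q) (t : ℝ) (f : (V → Fin q) → ℝ) : ℝ :=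
  expect (fun x => transition G q θ t x₀ x - μ x) f

lemma deviation_eq (μ : (V → Fin q) → ℝ) (x₀ : V → Fin q) (t : ℝ) (f : (V → Fin q) → ℝ) :
    deviation G q θ μ x₀ t f = expect (transition G q θ t x₀) f - expect μ f := by
  simp only [deviation, expect, sub_mul, Finset.sum_sub_distrib]

variable {μ : (V → Fin q) → ℝ}

/-- By the forward equation, with the stationary part dropping out, the deviations of all the events
`leadsTo y Φ` form a closed linear system indexed by `Φ`. -/
lemma hasDerivAt_deviation_leadsTo (hμ : IsStationary G q θ μ) (x₀ y : V → Fin q) (t : ℝ)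
    (Φ : Lineage V q) :
    HasDerivAt (fun t => deviation G q θ μ x₀ t (leadsTo y Φ))
      (∑ u, (noisyAvg G q θ u (fun w => deviation G q θ μ x₀ t (leadsTo y (Φ.move u (Sum.inl w))))
        (fun c => deviation G q θ μ x₀ t (leadsTo y (Φ.move u (Sum.inr c)))) -
          deviation G q θ μ x₀ t (leadsTo y Φ))) t := by
  have h1 : (fun t => deviation G q θ μ x₀ t (leadsTo y Φ)) = fun t =>
      (transition G q θ t *ᵥ leadsTo y Φ) x₀ - expect μ (leadsTo y Φ) := by
    ext t
    exact deviation_eq μ x₀ t _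
  rw [h1]
  refine ((hasDerivAt_transition_mulVec (leadsTo y Φ) x₀ t).1.sub_const _).congr_deriv ?_
  have h2 : (transition G q θ t *ᵥ (generator G q θ *ᵥ leadsTo y Φ)) x₀ =
      deviation G q θ μ x₀ t (generator G q θ *ᵥ leadsTo y Φ) := by
    rw [deviation_eq, hμ.expect_generator, sub_zero]
    rfl
  have h3 : generator G q θ *ᵥ leadsTo y Φ = fun x => ∑ u, (noisyAvg G q θ u
      (fun w => leadsTo y (Φ.move u (Sum.inl w)) x) (fun c => leadsTo y (Φ.move u (Sum.inr c)) x) -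
        leadsTo y Φ x) := by
    ext x
    exact generator_mulVec_leadsTo y Φ x
  rw [h2, h3]
  simp only [deviation, expect_sum, expect_sub, expect_noisyAvg]

lemma abs_deviation_le_one (h : Admissible G q θ) (hμ : IsStationary G q θ μ) (x₀ : V → Fin q)
    {t : ℝ} (ht : 0 ≤ t) {f : (V → Fin q) → ℝ} (hf0 : ∀ x, 0 ≤ f x) (hf1 : ∀ x, f x ≤ 1) :
    |deviation G q θ μ x₀ t f| ≤ 1 := by
  rw [deviation_eq, abs_le]
  have h1 : 0 ≤ expect (transition G q θ t x₀) f :=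
    Finset.sum_nonneg fun x _ => mul_nonneg (transition_nonneg h _ _ ht) (hf0 x)
  have h2 : 0 ≤ expect μ f := Finset.sum_nonneg fun x _ => mul_nonneg (hμ.nonneg x) (hf0 x)
  have h3 : expect (transition G q θ t x₀) f ≤ 1 := by
    rw [← expect_const (sum_transition h x₀ ht) 1]
    exact expect_mono (fun x => transition_nonneg h _ _ ht) hf1
  have h4 : expect μ f ≤ 1 := by
    rw [← expect_const hμ.sum_eq_one 1]
    exact expect_mono hμ.nonneg hf1
  constructor <;> linarith

/-- Without ancestors the event is deterministic. With one ancestor its indicator is a sum of colour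
indicators at that vertex, so its deviation is a partial sum of biases. -/
lemma abs_deviation_leadsTo_le_of_card_le (h : Admissible G q θ) (hμ : IsStationary G q θ μ)
    (x₀ y : V → Fin q) {t : ℝ} (ht : 0 ≤ t) {e : ℝ} {g : V → ℝ} {Φ : Lineage V q}
    (hΦ : (ancestors Φ).card ≤ 1) :
    |deviation G q θ μ x₀ t (leadsTo y Φ)| ≤
      potential e g (biasNorm G q θ x₀ t) (ancestors Φ) := by
  rcases Nat.le_one_iff_eq_zero_or_eq_one.mp hΦ with h0 | h1
  · have hc : leadsTo y Φ = fun _ => leadsTo y Φ x₀ := by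
      ext x
      simp only [leadsTo]
      rw [Lineage.eval_congr (x := x) (y := x₀) fun v hv => by
        rw [Finset.card_eq_zero.mp h0] at hv; simp at hv]
    rw [hc, deviation_eq, expect_const (sum_transition h x₀ ht), expect_const hμ.sum_eq_one]
    simp [potential, Finset.card_eq_zero.mp h0]
  · obtain ⟨v, hv⟩ := Finset.card_eq_one.mp h1
    have hf : leadsTo y Φ = fun x => ∑ c, leadsTo y Φ (fun _ => c) * hasColour v c x := by
      ext x
      simp only [hasColour, mul_ite, mul_one, mul_zero, Finset.sum_ite_eq, Finset.mem_univ, if_true]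
      simp only [leadsTo]
      rw [Lineage.eval_congr (x := x) (y := fun _ => x v) fun w hw => by
        rw [hv, Finset.mem_singleton] at hw; rw [hw]]
    have : Nonempty V := ⟨v⟩
    have hb : ∀ c, deviation G q θ μ x₀ t (hasColour v c) = bias G q θ x₀ t (v, c) := fun c => by
      rw [deviation_eq, hμ.expect_hasColour h, bias, marginal_eq_mulVec]
      rfl
    have hd : deviation G q θ μ x₀ t (leadsTo y Φ) =
        ∑ c, leadsTo y Φ (fun _ => c) * bias G q θ x₀ t (v, c) := by
      conv_lhs => rw [hf, deviation, expect_sum]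
      refine Finset.sum_congr rfl fun c _ => ?_
      rw [expect_const_mul, ← hb c, deviation]
    rw [hd, hv]
    simp only [potential, Finset.card_singleton, Nat.cast_one, sub_self, mul_zero, zero_mul, if_true,
      Finset.sum_singleton, zero_add, biasNorm]
    refine (Finset.abs_sum_le_sum_abs _ _).trans (Finset.sum_le_sum fun c _ => ?_)
    rw [abs_mul]
    refine mul_le_of_le_one_left (abs_nonneg _) ?_
    rw [leadsTo]
    split_ifs <;> simp

/-- The joint law of several lineages is close to equilibrium. -/
theorem abs_deviation_leadsTo_le (h : Admissible G q θ) (hμ : IsStationary G q θ μ)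
    (x₀ y : V → Fin q) {t : ℝ} (ht : 0 ≤ t) (Φ : Lineage V q) :
    |deviation G q θ μ x₀ t (leadsTo y Φ)| ≤ potential (Real.exp (-(2 * θ * t)))
      (correction G q θ x₀ t) (biasNorm G q θ x₀ t) (ancestors Φ) := by
  by_cases hΦ : (ancestors Φ).card ≤ 1
  · exact abs_deviation_leadsTo_le_of_card_le h hμ x₀ y ht hΦ
  have hθ := h.pos
  set U : ℝ → Lineage V q → ℝ := fun s Φ => potential (Real.exp (-(2 * θ * s)))
      (correction G q θ x₀ s) (biasNorm G q θ x₀ s) (ancestors Φ) with hU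
  set D : ℝ → Lineage V q → ℝ := fun s Φ => deviation G q θ μ x₀ s (leadsTo y Φ) with hD
  set D' : ℝ → Lineage V q → ℝ := fun s Φ => ∑ u, (noisyAvg G q θ u
    (fun w => D s (Φ.move u (Sum.inl w))) (fun c => D s (Φ.move u (Sum.inr c))) - D s Φ) with hD'
  set U' : ℝ → Lineage V q → ℝ := fun s Φ =>
    -(2 * θ) * ((ancestors Φ).card * ((ancestors Φ).card - 1) * Real.exp (-(2 * θ * s))) +
    ((ancestors Φ).card - 1) * ∑ v ∈ ancestors Φ, ((1 - θ) * walkAvg G (correction G q θ x₀ s) v -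
        (1 + θ) * correction G q θ x₀ s v + correctionSource G q θ x₀ s v) with hU'
  -- Both signs are compared with the supersolution. Maps with at most one ancestor serve as
  -- boundary and are covered by the explicit bound; there `z` is set to `0`.
  have key : ∀ σ : ℝ, |σ| ≤ 1 → σ * D t Φ ≤ U t Φ := by
    intro σ hσ
    set z : ℝ → Lineage V q → ℝ := fun s Φ =>
      if (ancestors Φ).card ≤ 1 then 0 else U s Φ - σ * D s Φ with hz
    have hsmall : ∀ s, 0 ≤ s → ∀ Φ, σ * D s Φ ≤ U s Φ - z s Φ := by
      intro s hs Φ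
      simp only [hz]
      split_ifs with hc
      · rw [sub_zero]
        refine (le_abs_self _).trans ?_
        rw [abs_mul]
        exact (mul_le_of_le_one_left (abs_nonneg _) hσ).trans
          (abs_deviation_leadsTo_le_of_card_le h hμ x₀ y hs hc)
      · linarith
    have hnn := nonneg_of_deriv_ge (K := Fintype.card V) (T := t) (z := z)
      (z' := fun s Φ => if (ancestors Φ).card ≤ 1 then 0 else U' s Φ - σ * D' s Φ)
      (fun s Φ => ?_) (fun Φ => ?_) (fun s hs hsT Φ m hm hall hneg => ?_) ht le_rfl Φ
    · simp only [hz, if_neg hΦ] at hnn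
      linarith
    · simp only [hz]
      split_ifs with hc
      · exact hasDerivAt_const s 0
      · refine HasDerivAt.fun_sub ?_ ((hasDerivAt_deviation_leadsTo hμ x₀ y s Φ).const_mul σ)
        simp only [hU, potential]
        have he : HasDerivAt (fun s => Real.exp (-(2 * θ * s)))
            (Real.exp (-(2 * θ * s)) * -(2 * θ)) s := by
          simpa using ((hasDerivAt_id s).const_mul (2 * θ)).fun_neg.exp
        have hg := HasDerivAt.fun_sum (u := ancestors Φ) fun v _ => hasDerivAt_correction h x₀ s v
        have hne : ¬ (ancestors Φ).card = 1 := by omega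
        simp only [if_neg hne, add_zero]
        refine ((he.const_mul _).fun_add (hg.const_mul _)).congr_deriv ?_
        simp only [hU']
        ring
    · simp only [hz]
      split_ifs with hc
      · exact le_rfl
      · have h1 : σ * D 0 Φ ≤ 1 := by
          refine (le_abs_self _).trans ?_
          rw [abs_mul]
          refine mul_le_one₀ hσ (abs_nonneg _) (abs_deviation_le_one h hμ x₀ le_rfl ?_ ?_) <;>
            intro x <;> rw [leadsTo] <;> split_ifs <;> simp
        -- Initially the term `m * (m - 1) ≥ 2` alone dominates any deviation of an indicator.
        have h2 : 1 ≤ U 0 Φ := by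
          have hc2 : (2 : ℝ) ≤ (ancestors Φ).card := by exact_mod_cast (by omega)
          have hne : ¬ (ancestors Φ).card = 1 := by omega
          simp only [hU, potential, correction_zero, mul_zero, neg_zero, Real.exp_zero, if_neg hne,
            Finset.sum_const_zero]
          nlinarith
        linarith
    · split_ifs with hc
      · have : 0 ≤ (Fintype.card V : ℝ) * m := by positivity
        linarith
      · have hT : 2 ≤ (ancestors Φ).card := by omega
        have hzΦ : U s Φ ≤ σ * D s Φ := by
          simp only [hz, if_neg hc] at hneg
          linarith
        have hle : ∀ Ψ, σ * D s Ψ ≤ U s Ψ + m := fun Ψ => by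
          linarith [hsmall s hs Ψ, hall Ψ]
        have h1 : σ * D' s Φ ≤ ∑ u ∈ ancestors Φ, (noisyAvg G q θ u
            (fun w => potential (Real.exp (-(2 * θ * s))) (correction G q θ x₀ s)
              (biasNorm G q θ x₀ s) (insert w ((ancestors Φ).erase u)))
            (fun _ => potential (Real.exp (-(2 * θ * s))) (correction G q θ x₀ s)
              (biasNorm G q θ x₀ s) ((ancestors Φ).erase u)) - U s Φ) +
            (ancestors Φ).card * m := by
          have h2 : D' s Φ = ∑ u ∈ ancestors Φ, (noisyAvg G q θ u
              (fun w => D s (Φ.move u (Sum.inl w))) (fun c => D s (Φ.move u (Sum.inr c))) -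
                D s Φ) := by
            refine (Finset.sum_subset (Finset.subset_univ _) fun u _ hu => ?_).symm
            simp only [Lineage.move_of_notMem hu]
            rw [noisyAvg_const h, sub_self]
          rw [h2, Finset.mul_sum, ← nsmul_eq_mul, ← Finset.sum_const, ← Finset.sum_add_distrib]
          refine Finset.sum_le_sum fun u hu => ?_
          rw [mul_sub, ← noisyAvg_const_mul]
          have h3 : noisyAvg G q θ u (fun w => σ * D s (Φ.move u (Sum.inl w)))
              (fun c => σ * D s (Φ.move u (Sum.inr c))) ≤
              noisyAvg G q θ u (fun w => U s (Φ.move u (Sum.inl w)) + m)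
              (fun c => U s (Φ.move u (Sum.inr c)) + m) :=
            noisyAvg_mono h (fun w _ => hle _) fun c => hle _
          rw [noisyAvg_add, noisyAvg_const h] at h3
          simp only [hU, ancestors_move_inl hu, ancestors_move_inr] at h3
          simp only [hU] at hzΦ ⊢
          linarith
        have h4 := sum_potential_le h (e := Real.exp (-(2 * θ * s))) (Real.exp_pos _).le
          (correction_nonneg h x₀ hs) (biasNorm_nonneg (G := G) (θ := θ) x₀ s) hT
        have h5 : ((ancestors Φ).card : ℝ) * m ≤ Fintype.card V * m := by
          refine mul_le_mul_of_nonneg_right ?_ hm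
          exact_mod_cast Finset.card_le_univ _
        simp only [hU, hU', correctionSource] at h1 ⊢
        linarith
  have h1 := key 1 (by simp)
  have h2 := key (-1) (by simp)
  rw [abs_le]
  constructor <;> linarith

/-- The event that the configuration agrees with `y` on `B`. -/
def cylinder (B : Finset V) (y x : V → Fin q) : ℝ := if ∀ v ∈ B, x v = y v then 1 else 0

/-- The joint law of the vertices in `B` is close to equilibrium. -/
lemma abs_deviation_cylinder_le (h : Admissible G q θ) (hμ : IsStationary G q θ μ)
    (x₀ y : V → Fin q) {t : ℝ} (ht : 0 ≤ t) (B : Finset V) :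
    |deviation G q θ μ x₀ t (cylinder B y)| ≤ potential (Real.exp (-(2 * θ * t)))
      (correction G q θ x₀ t) (biasNorm G q θ x₀ t) B := by
  -- Outside `B` the lineages end in the prescribed colour, so only the vertices of `B` impose a
  -- condition.
  set Φ : Lineage V q := fun v => if v ∈ B then Sum.inl v else Sum.inr (y v) with hΦ
  have h1 : ancestors Φ = B := by
    ext w
    simp only [mem_ancestors, hΦ]
    constructor
    · rintro ⟨v, hv⟩
      split_ifs at hv with hB
      rwa [← Sum.inl_injective hv]
    · exact fun hw => ⟨w, by rw [if_pos hw]⟩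
  have h2 : leadsTo y Φ = cylinder B y := by
    ext x
    rw [leadsTo, cylinder]
    refine if_congr ?_ rfl rfl
    rw [funext_iff]
    refine forall_congr' fun v => ?_
    by_cases hv : v ∈ B <;> simp [Lineage.eval, hΦ, hv]
  have := abs_deviation_leadsTo_le h hμ x₀ y ht Φ
  rwa [h1, h2] at this

end Moves

/-! ### Comparison of the law with equilibrium on sparse sets -/

section Cylinder

variable {G : SimpleGraph V} [DecidableRel G.Adj] {q : ℕ} {θ : ℝ} {μ ν : (V → Fin q) → ℝ}

lemma cylinder_nonneg (B : Finset V) (y x : V → Fin q) : 0 ≤ cylinder B y x := by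
  rw [cylinder]; split_ifs <;> simp

lemma cylinder_le_one (B : Finset V) (y x : V → Fin q) : cylinder B y x ≤ 1 := by
  rw [cylinder]; split_ifs <;> simp

lemma cylinder_update {B : Finset V} {u : V} (hu : u ∈ B) (y x : V → Fin q) (c : Fin q) :
    cylinder B y (Function.update x u c) = if c = y u then cylinder (B.erase u) y x else 0 := by
  have h1 : (∀ v ∈ B, Function.update x u c v = y v) ↔ c = y u ∧ ∀ v ∈ B.erase u, x v = y v := by
    constructor
    · intro h
      refine ⟨by simpa using h u hu, fun v hv => ?_⟩
      have := h v (Finset.mem_of_mem_erase hv)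
      rwa [Function.update_of_ne (Finset.ne_of_mem_erase hv)] at this
    · rintro ⟨h1, h2⟩ v hv
      by_cases hvu : v = u
      · subst hvu; simpa using h1
      · rw [Function.update_of_ne hvu]
        exact h2 v (Finset.mem_erase.mpr ⟨hvu, hv⟩)
  simp only [cylinder, h1, ite_and]

/-- Of the ways to enter the pattern only the noise is kept: a fresh colour at `u` is the right one
with probability `1 / q`. -/
lemma generator_mulVec_cylinder_ge (h : Admissible G q θ) (B : Finset V) (y x : V → Fin q) :
    ∑ u ∈ B, (θ / q * cylinder (B.erase u) y x - cylinder B y x) ≤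
      (generator G q θ *ᵥ cylinder B y) x := by
  rw [generator_mulVec_eq_noisyAvg]
  rw [← Finset.sum_subset (Finset.subset_univ B) fun u _ hu => ?_]
  · refine Finset.sum_le_sum fun u hu => sub_le_sub_right ?_ _
    rw [noisyAvg]
    have h1 : 0 ≤ (1 - θ) * walkAvg G (fun v => cylinder B y (Function.update x u (x v))) u :=
      mul_nonneg (sub_nonneg.mpr h.le_one) (walkAvg_nonneg (fun v => cylinder_nonneg _ _ _) u)
    have h2 : ∑ c, 1 / (q : ℝ) * cylinder B y (Function.update x u c) =
        1 / q * cylinder (B.erase u) y x := by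
      simp only [cylinder_update hu, mul_ite, mul_zero, Finset.sum_ite_eq', Finset.mem_univ, if_true]
    rw [h2]
    have : θ / q * cylinder (B.erase u) y x = θ * (1 / q * cylinder (B.erase u) y x) := by ring
    linarith
  · have h1 : ∀ c, cylinder B y (Function.update x u c) = cylinder B y x := fun c => by
      rw [cylinder, cylinder]
      refine if_congr (forall₂_congr fun v hv => ?_) rfl rfl
      rw [Function.update_of_ne (ne_of_mem_of_not_mem hv hu)]
    simp only [h1]
    rw [noisyAvg_const h, sub_self]

/-- Every local pattern has a substantial probability in equilibrium. -/
lemma IsStationary.pow_le_expect_cylinder (hμ : IsStationary G q θ μ) (h : Admissible G q θ)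
    (B : Finset V) (y : V → Fin q) : (θ / q) ^ B.card ≤ expect μ (cylinder B y) := by
  have hq : (0 : ℝ) < q := by have := h.two_le; positivity
  have hθ := h.pos
  induction hn : B.card generalizing B with
  | zero =>
    have : cylinder B y = fun _ => 1 := by
      ext x
      simp [cylinder, Finset.card_eq_zero.mp hn]
    rw [this, expect_const hμ.sum_eq_one, pow_zero]
  | succ n ih =>
    -- Stationarity makes the mean of the generator zero, so the pattern on `B` is at least `θ / q`
    -- times as likely as a typical pattern on `B` with one point removed.
    have h1 := expect_mono hμ.nonneg (generator_mulVec_cylinder_ge h B y)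
    rw [hμ.expect_generator, expect_sum] at h1
    simp only [expect_sub, expect_const_mul] at h1
    have h2 : ∑ u ∈ B, ((θ / q) ^ (n + 1) - expect μ (cylinder B y)) ≤ 0 := by
      refine le_trans (Finset.sum_le_sum fun u hu => sub_le_sub_right ?_ _) h1
      rw [pow_succ']
      refine mul_le_mul_of_nonneg_left (ih (B.erase u) ?_) (by positivity)
      rw [Finset.card_erase_of_mem hu, hn, Nat.add_sub_cancel]
    rw [Finset.sum_const, nsmul_eq_mul] at h2
    have h3 : (0 : ℝ) < B.card := by rw [hn]; positivity
    by_contra hc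
    push Not at hc
    have := mul_pos h3 (sub_pos.mpr hc)
    linarith

/-- The patterns on `B`, as configurations that agree with `x₀` outside `B`. -/
def patterns (B : Finset V) (x₀ : V → Fin q) : Finset (V → Fin q) :=
  Fintype.piFinset fun v => if v ∈ B then Finset.univ else {x₀ v}

lemma card_patterns (B : Finset V) (x₀ : V → Fin q) : (patterns B x₀).card = q ^ B.card := by
  rw [patterns, Fintype.card_piFinset]
  have : ∀ v, (if v ∈ B then (Finset.univ : Finset (Fin q)) else {x₀ v}).card =
      if v ∈ B then q else 1 := fun v => by split_ifs <;> simp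
  simp only [this]
  rw [Finset.prod_ite_mem, Finset.univ_inter, Finset.prod_const]

/-- Conditioning on the pattern on `B`: exactly one pattern is realised, and it may be substituted
into `f`. -/
lemma sum_cylinder_mul (B : Finset V) (x₀ : V → Fin q) (f : (V → Fin q) → ℝ) (x : V → Fin q) :
    ∑ y ∈ patterns B x₀, cylinder B y x * f (B.piecewise y x) = f x := by
  rw [Finset.sum_eq_single (B.piecewise x x₀)]
  · rw [cylinder, if_pos fun v hv => by simp [hv], one_mul]
    congr 1
    ext v
    by_cases hv : v ∈ B <;> simp [hv]
  · intro y hy hne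
    rw [cylinder, if_neg, zero_mul]
    intro hB
    refine hne (funext fun v => ?_)
    by_cases hv : v ∈ B
    · simp [hv, hB v hv]
    · have := Fintype.mem_piFinset.mp hy v
      rw [if_neg hv, Finset.mem_singleton] at this
      simp [hv, this]
  · intro hy
    refine absurd (Fintype.mem_piFinset.mpr fun v => ?_) hy
    by_cases hv : v ∈ B <;> simp [hv]

lemma sum_cylinder (B : Finset V) (x₀ x : V → Fin q) : ∑ y ∈ patterns B x₀, cylinder B y x = 1 := by
  simpa using sum_cylinder_mul B x₀ (fun _ => 1) x

lemma sum_expect_cylinder (hν1 : ∑ x, ν x = 1) (B : Finset V) (x₀ : V → Fin q) :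
    ∑ y ∈ patterns B x₀, expect ν (cylinder B y) = 1 := by
  rw [← expect_sum]
  simp only [sum_cylinder]
  exact expect_const hν1 1

/-- Distant sets of vertices are nearly independent. -/
lemma CovarianceDecay.abs_block_le (hν : CovarianceDecay G θ ν) (hθ : 0 < θ) {B R : Finset V} {r k : ℕ}
    (hBk : B.card ≤ k) (hdist : ∀ a ∈ B, ∀ b ∈ R \ B, r ≤ G.dist a b) (y : V → Fin q)
    {f : (V → Fin q) → ℝ} (hf1 : ∀ x, |f x| ≤ 1)
    (hfR : ∀ x x', (∀ v ∈ R, x v = x' v) → f x = f x') :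
    |expect ν (fun x => cylinder B y x * f (B.piecewise y x)) -
      expect ν (cylinder B y) * expect ν (fun x => f (B.piecewise y x))| ≤
      2 * k * Fintype.card V / (θ * decayBase θ ^ r) := by
  have hb : 1 ≤ decayBase θ := by rw [decayBase]; linarith
  have hb0 : 0 < decayBase θ := by linarith
  have h1 : HasInfluence (cylinder B y) fun a => if a ∈ B then 1 else 0 := by
    refine hasInfluence_of_dependsOn (fun x x' => ?_) fun x x' hx => ?_
    · rw [abs_le]
      constructor <;> linarith [cylinder_nonneg B y x, cylinder_nonneg B y x', cylinder_le_one B y x,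
        cylinder_le_one B y x']
    · rw [cylinder, cylinder]
      exact if_congr (forall₂_congr fun v hv => by rw [hx v hv]) rfl rfl
  have h2 : HasInfluence (fun x => f (B.piecewise y x)) fun a => if a ∈ R \ B then 2 else 0 := by
    refine hasInfluence_of_dependsOn (fun x x' => ?_) fun x x' hx => hfR _ _ fun v hv => ?_
    · refine (abs_sub _ _).trans ?_
      linarith [hf1 (B.piecewise y x), hf1 (B.piecewise y x')]
    · by_cases hvB : v ∈ B
      · simp [hvB]
      · simp [hvB, hx v (Finset.mem_sdiff.mpr ⟨hv, hvB⟩)]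
  refine (hν _ _ _ _ h1 h2).trans ?_
  rw [mul_comm θ, ← div_div]
  refine div_le_div_of_nonneg_right ?_ hθ.le
  calc ∑ a, ∑ b, (if a ∈ B then (1 : ℝ) else 0) * (if b ∈ R \ B then 2 else 0) *
        (decayBase θ ^ G.dist a b)⁻¹
      ≤ ∑ a, ∑ b : V, (if a ∈ B then (1 : ℝ) else 0) * (2 * (decayBase θ ^ r)⁻¹) := by
        refine Finset.sum_le_sum fun a _ => Finset.sum_le_sum fun b _ => ?_
        rw [mul_assoc]
        split_ifs with ha hb'
        · rw [one_mul, one_mul]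
          refine mul_le_mul_of_nonneg_left (inv_anti₀ (by positivity) ?_) (by norm_num)
          exact pow_le_pow_right₀ hb (hdist a ha b hb')
        · rw [one_mul, one_mul, zero_mul]
          positivity
        · simp
        · simp
    _ = B.card * (Fintype.card V * (2 * (decayBase θ ^ r)⁻¹)) := by
        simp only [Finset.sum_const, Finset.card_univ, nsmul_eq_mul, ite_mul, one_mul, zero_mul,
          mul_ite, mul_zero, Finset.sum_ite_mem, Finset.univ_inter]
    _ ≤ k * (Fintype.card V * (2 * (decayBase θ ^ r)⁻¹)) := by
        refine mul_le_mul_of_nonneg_right ?_ (by positivity)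
        exact_mod_cast hBk
    _ = 2 * k * Fintype.card V / decayBase θ ^ r := by
        rw [div_eq_mul_inv]
        ring

end Cylinder

/-! ### Sparse sets and their decomposition into blocks -/

section Sparse

variable {G : SimpleGraph V} [DecidableRel G.Adj] {q : ℕ} {θ : ℝ} {μ ν : (V → Fin q) → ℝ}

/-- No ball of radius `k r` contains `k` points of `R`. -/
def Sparse (G : SimpleGraph V) (k r : ℕ) (R : Finset V) : Prop :=
  ∀ v, (R ∩ ball G v (k * r)).card < k

lemma Sparse.mono {k r : ℕ} {R R' : Finset V} (hR : Sparse G k r R) (h : R' ⊆ R) : Sparse G k r R' :=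
  fun v => (Finset.card_le_card (Finset.inter_subset_inter_right h)).trans_lt (hR v)

/-- A sparse set contains a small part that is far from the remainder. -/
lemma Sparse.exists_block (hG : G.Connected) {k r : ℕ} {R : Finset V} (hs : Sparse G k r R)
    (hR : R.Nonempty) : ∃ B ⊆ R, B.Nonempty ∧ B.card ≤ k ∧ ∀ a ∈ B, ∀ b ∈ R \ B, r ≤ G.dist a b := by
  obtain ⟨v, hv⟩ := hR
  have hmono : ∀ i j, i ≤ j → R ∩ ball G v (i * r) ⊆ R ∩ ball G v (j * r) := fun i j hij =>
    Finset.inter_subset_inter_left fun w hw => by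
      rw [mem_ball] at hw ⊢
      exact hw.trans (Nat.mul_le_mul_right r hij)
  -- Pigeonhole over the radii `i * r`: if each of the `k` annuli around `v` met `R`, the ball of
  -- radius `k * r` would contain more than `k` points of `R`. An empty annulus isolates the block
  -- inside it.
  have hex : ∃ i < k, R ∩ ball G v ((i + 1) * r) = R ∩ ball G v (i * r) := by
    by_contra hc
    push Not at hc
    have hgrow : ∀ i ≤ k, i + 1 ≤ (R ∩ ball G v (i * r)).card := by
      intro i
      induction i with
      | zero =>
        intro _
        refine Finset.card_pos.mpr ⟨v, Finset.mem_inter.mpr ⟨hv, mem_ball.mpr (by simp)⟩⟩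
      | succ i ih =>
        intro hi
        have h1 := ih (by omega)
        have h2 : (R ∩ ball G v (i * r)).card < (R ∩ ball G v ((i + 1) * r)).card :=
          Finset.card_lt_card ((hmono i (i + 1) (by omega)).ssubset_of_ne (hc i (by omega)).symm)
        omega
    have := hgrow k le_rfl
    have := hs v
    omega
  obtain ⟨i, hi, he⟩ := hex
  refine ⟨R ∩ ball G v (i * r), Finset.inter_subset_left,
    ⟨v, Finset.mem_inter.mpr ⟨hv, mem_ball.mpr (by simp)⟩⟩,
    (Finset.card_le_card (hmono i k hi.le)).trans (hs v).le, fun a ha b hb => ?_⟩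
  rw [Finset.mem_inter, mem_ball] at ha
  rw [← he, Finset.mem_sdiff, Finset.mem_inter, mem_ball] at hb
  have h1 : (i + 1) * r < G.dist v b := by
    by_contra hc
    exact hb.2 ⟨hb.1, by omega⟩
  have h2 := hG.dist_triangle (u := v) (v := a) (w := b)
  rw [add_mul, one_mul] at h1
  omega

/-- The error made in decoupling a block. -/
def blockError (q : ℕ) (θ : ℝ) (n k r : ℕ) : ℝ := q ^ k * (2 * k * n / (θ * decayBase θ ^ r))

lemma blockError_nonneg (hθ : 0 < θ) (n k r : ℕ) : 0 ≤ blockError q θ n k r := by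
  have hb : 0 < decayBase θ := by rw [decayBase]; linarith
  rw [blockError]
  positivity

/-- A second moment comparison of `ν` and `μ` on sparse sets, assuming it on small blocks. -/
theorem Sparse.sq_expect_le (hG : G.Connected) (hq : 1 ≤ q) (hθ : 0 < θ)
    (hν0 : ∀ x, 0 ≤ ν x) (hν1 : ∑ x, ν x = 1) (hμ1 : ∑ x, μ x = 1)
    (hν : CovarianceDecay G θ ν) (hμ : CovarianceDecay G θ μ) (x₀ : V → Fin q) {k r : ℕ} {h : V → ℝ}
    (hh : ∀ v, 0 ≤ h v) (hpos : ∀ B y, 0 < expect μ (cylinder B y))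
    (hblock : ∀ B : Finset V, B.Nonempty → B.card ≤ k →
      ∑ y ∈ patterns B x₀, expect ν (cylinder B y) ^ 2 / expect μ (cylinder B y) ≤
        Real.exp (∑ v ∈ B, h v))
    {R : Finset V} (hR : Sparse G k r R) {f : (V → Fin q) → ℝ} (hf1 : ∀ x, |f x| ≤ 1)
    (hfR : ∀ x x', (∀ v ∈ R, x v = x' v) → f x = f x') :
    expect ν f ^ 2 ≤ Real.exp (∑ v ∈ R, h v) * (expect μ (fun x => f x ^ 2) +
      3 * blockError q θ (Fintype.card V) k r * R.card) := by
  -- Blocks are removed one at a time, and the function is replaced by the functions `g y` obtained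
  -- from it by fixing the pattern on the block.
  induction R using Finset.strongInduction generalizing f with
  | H R ih =>
    rcases R.eq_empty_or_nonempty with rfl | hne
    · have hc : f = fun _ => f x₀ := by
        ext x
        exact hfR _ _ (by simp)
      rw [hc, expect_const hν1, expect_const hμ1]
      simp
    obtain ⟨B, hBR, hBne, hBk, hdist⟩ := hR.exists_block hG hne
    set δ := blockError q θ (Fintype.card V) k r with hδ
    have hδ0 : 0 ≤ δ := blockError_nonneg hθ _ _ _
    set P := patterns B x₀ with hP
    set g : (V → Fin q) → (V → Fin q) → ℝ := fun y x => f (B.piecewise y x) with hg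
    have hg1 : ∀ y x, |g y x| ≤ 1 := fun y x => hf1 _
    have hf2 : ∀ x, |f x ^ 2| ≤ 1 := fun x => by
      rw [abs_pow]
      exact pow_le_one₀ (abs_nonneg _) (hf1 x)
    have hcard : (P.card : ℝ) ≤ q ^ k := by
      rw [hP, card_patterns]
      push_cast
      exact pow_le_pow_right₀ (by exact_mod_cast hq) hBk
    have herr : ∀ (w : (V → Fin q) → ℝ), CovarianceDecay G θ w → ∀ F : (V → Fin q) → ℝ,
        (∀ x, |F x| ≤ 1) → (∀ x x', (∀ v ∈ R, x v = x' v) → F x = F x') →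
        |expect w F - ∑ y ∈ P, expect w (cylinder B y) * expect w (fun x => F (B.piecewise y x))| ≤
          δ := by
      intro w hw F hF1 hFR
      have e1 : expect w F = ∑ y ∈ P, expect w (fun x => cylinder B y x * F (B.piecewise y x)) := by
        rw [← expect_sum]
        simp only [hP, sum_cylinder_mul]
      rw [e1, ← Finset.sum_sub_distrib]
      refine (Finset.abs_sum_le_sum_abs _ _).trans ?_
      refine (Finset.sum_le_sum fun y _ => hw.abs_block_le hθ hBk hdist y hF1 hFR).trans ?_
      rw [Finset.sum_const, nsmul_eq_mul, hδ, blockError]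
      refine mul_le_mul_of_nonneg_right hcard ?_
      have hb : 0 < decayBase θ := by rw [decayBase]; linarith
      positivity
    set A := ∑ y ∈ P, expect ν (cylinder B y) * expect ν (g y) with hA
    have hA1 : |A| ≤ 1 := by
      refine (Finset.abs_sum_le_sum_abs _ _).trans ?_
      rw [← sum_expect_cylinder hν1 B x₀]
      refine Finset.sum_le_sum fun y _ => ?_
      have h0 : 0 ≤ expect ν (cylinder B y) :=
        Finset.sum_nonneg fun x _ => mul_nonneg (hν0 x) (cylinder_nonneg _ _ _)
      rw [abs_mul, abs_of_nonneg h0]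
      exact mul_le_of_le_one_right h0 (abs_expect_le hν0 hν1 (hg1 y))
    have hν1' : |expect ν f| ≤ 1 := abs_expect_le hν0 hν1 hf1
    -- `A` is the mean when block and remainder are decoupled. All means are at most `1` in absolute
    -- value, so squaring doubles the error.
    have h1 : expect ν f ^ 2 ≤ A ^ 2 + 2 * δ := by
      have h2 := herr ν hν f hf1 hfR
      have h3 : |(expect ν f - A) * (expect ν f + A)| ≤ δ * 2 := by
        rw [abs_mul]
        refine mul_le_mul h2 ((abs_add_le _ _).trans (by linarith)) (abs_nonneg _) hδ0
      have := (abs_le.mp h3).2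
      linarith
    set cB := Real.exp (∑ v ∈ B, h v) with hcB
    set cR := Real.exp (∑ v ∈ R \ B, h v) with hcR
    have hc : Real.exp (∑ v ∈ R, h v) = cB * cR := by
      rw [hcB, hcR, ← Real.exp_add, add_comm, Finset.sum_sdiff hBR]
    have hcB1 : 1 ≤ cB := Real.one_le_exp (Finset.sum_nonneg fun v _ => hh v)
    have hcR1 : 1 ≤ cR := Real.one_le_exp (Finset.sum_nonneg fun v _ => hh v)
    have hss : R \ B ⊂ R := Finset.sdiff_ssubset hBR hBne
    have hind : ∀ y, expect ν (g y) ^ 2 ≤ cR * (expect μ (fun x => g y x ^ 2) +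
        3 * δ * (R \ B).card) := fun y => by
      refine ih (R \ B) hss (hR.mono hss.1) (hg1 y) fun x x' hx => hfR _ _ fun v hv => ?_
      by_cases hvB : v ∈ B
      · simp [hvB]
      · simp [hvB, hx v (Finset.mem_sdiff.mpr ⟨hv, hvB⟩)]
    -- Cauchy-Schwarz with weights `expect μ (cylinder B y)` splits off the chi-square factor of the
    -- block.
    have hCS : A ^ 2 ≤ cB * ∑ y ∈ P, expect μ (cylinder B y) * expect ν (g y) ^ 2 := by
      refine le_trans (Finset.sum_sq_le_sum_mul_sum_of_sq_le_mul P
        (f := fun y => expect ν (cylinder B y) ^ 2 / expect μ (cylinder B y))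
        (g := fun y => expect μ (cylinder B y) * expect ν (g y) ^ 2)
        (fun y _ => div_nonneg (sq_nonneg _) (hpos B y).le)
        (fun y _ => mul_nonneg (hpos B y).le (sq_nonneg _)) fun y _ => ?_) ?_
      · have := (hpos B y).ne'
        refine le_of_eq ?_
        field_simp
      · refine mul_le_mul_of_nonneg_right (hblock B hBne hBk) ?_
        exact Finset.sum_nonneg fun y _ => mul_nonneg (hpos B y).le (sq_nonneg _)
    have hsumμ : ∑ y ∈ P, expect μ (cylinder B y) * expect ν (g y) ^ 2 ≤
        cR * (expect μ (fun x => f x ^ 2) + δ + 3 * δ * (R \ B).card) := by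
      have h2 := (abs_le.mp (herr μ hμ (fun x => f x ^ 2) hf2 fun x x' hx => by
        rw [hfR x x' hx])).1
      calc ∑ y ∈ P, expect μ (cylinder B y) * expect ν (g y) ^ 2
          ≤ ∑ y ∈ P, expect μ (cylinder B y) * (cR * (expect μ (fun x => g y x ^ 2) +
            3 * δ * (R \ B).card)) :=
            Finset.sum_le_sum fun y _ => mul_le_mul_of_nonneg_left (hind y) (hpos B y).le
        _ = cR * (∑ y ∈ P, expect μ (cylinder B y) * expect μ (fun x => g y x ^ 2) +
            3 * δ * (R \ B).card * ∑ y ∈ P, expect μ (cylinder B y)) := by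
            rw [Finset.mul_sum, ← Finset.sum_add_distrib, Finset.mul_sum]
            exact Finset.sum_congr rfl fun y _ => by ring
        _ ≤ _ := by
            rw [sum_expect_cylinder hμ1, mul_one]
            refine mul_le_mul_of_nonneg_left ?_ (by linarith)
            linarith
    -- Each block costs an error `3 * δ`, twice `δ` for `ν` and once for `μ`; as the block is
    -- nonempty, `R` loses at least one point to pay for it.
    have hcardR : ((R \ B).card : ℝ) + 1 ≤ R.card := by
      exact_mod_cast Finset.card_lt_card hss
    rw [hc]
    have h3 := mul_le_mul_of_nonneg_left hsumμ (by linarith : (0 : ℝ) ≤ cB)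
    have hcc : 1 ≤ cB * cR := one_le_mul_of_one_le_of_one_le hcB1 hcR1
    calc expect ν f ^ 2 ≤ cB * (cR * (expect μ (fun x => f x ^ 2) + δ + 3 * δ * (R \ B).card)) +
          2 * δ := by linarith
      _ ≤ cB * cR * (expect μ (fun x => f x ^ 2) + δ + 3 * δ * (R \ B).card) +
          cB * cR * (2 * δ) := by
          rw [← mul_assoc]
          refine add_le_add_right (le_mul_of_one_le_left (by positivity) hcc) _
      _ = cB * cR * (expect μ (fun x => f x ^ 2) + 3 * δ * ((R \ B).card + 1)) := by ring
      _ ≤ _ := by gcongr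

end Sparse

/-! ### The upper bound on the distance to equilibrium -/

section UpperBound

variable {G : SimpleGraph V} [DecidableRel G.Adj] {q : ℕ} {θ : ℝ} {μ : (V → Fin q) → ℝ}

/-- A second moment comparison yields a comparison of means. -/
lemma abs_sub_le_of_sq_le {S : Type*} [Fintype S] {ν μ : S → ℝ} (hν0 : ∀ x, 0 ≤ ν x)
    (hν1 : ∑ x, ν x = 1) (hμ0 : ∀ x, 0 ≤ μ x) (hμ1 : ∑ x, μ x = 1) {p : (S → ℝ) → Prop} {H E : ℝ}
    (hH : 0 ≤ H) (hE : 0 ≤ E)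
    (hp : ∀ f, p f → (∀ x, |f x| ≤ 1) → expect ν f ^ 2 ≤ Real.exp H * (expect μ (fun x => f x ^ 2) + E))
    {f : S → ℝ} (hpf : ∀ a b : ℝ, p fun x => a * f x + b) (hf : ∀ x, |f x| ≤ 1) {lam : ℝ}
    (hlam : 0 < lam) (hlam1 : lam ≤ 1) :
    |expect ν f - expect μ f| ≤ lam + (8 * E + 6 * H) / lam := by
  have hνf := abs_expect_le hν0 hν1 hf
  have hμf := abs_expect_le hμ0 hμ1 hf
  have htriv : |expect ν f - expect μ f| ≤ 2 := (abs_sub _ _).trans (by linarith)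
  -- If the asserted error exceeds `2` there is nothing to prove; otherwise `H` and `E` are small
  -- enough to linearise the exponential.
  by_cases hbig : 2 * lam ≤ 8 * E + 6 * H
  · have : 2 ≤ (8 * E + 6 * H) / lam := by rwa [le_div_iff₀ hlam]
    linarith
  push Not at hbig
  have hH1 : H ≤ 1 := by linarith
  have hE1 : E ≤ 1 / 4 := by linarith
  have hexp : Real.exp H ≤ 1 + 2 * H := by
    have h1 := Real.abs_exp_sub_one_le (x := H) (by rwa [abs_of_nonneg hH])
    rw [abs_of_nonneg hH] at h1
    linarith [(abs_le.mp h1).2]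
  set m := expect μ f with hm
  have key : ∀ σ : ℝ, σ ^ 2 = 1 → σ * (expect ν f - m) ≤ lam + (8 * E + 6 * H) / lam := by
    intro σ hσ
    have hσ1 : |σ| = 1 := by rwa [← sq_eq_sq₀ (abs_nonneg _) zero_le_one, sq_abs, one_pow]
    -- A small perturbation of the constant `1 / 2` with mean `1 / 2` under `μ`. In the second
    -- moment inequality the constants cancel up to `H` and `E`, and the term linear in `lam`
    -- isolates the difference of the means.
    set F : S → ℝ := fun x => lam * σ / 4 * f x + (1 / 2 - lam * σ * m / 4) with hF
    have hdiff : ∀ x, |f x - m| ≤ 2 := fun x => (abs_sub _ _).trans (by linarith [hf x])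
    have hdσ : ∀ x, |σ * (f x - m)| ≤ 2 := fun x => by rw [abs_mul, hσ1, one_mul]; exact hdiff x
    have hF1 : ∀ x, |F x| ≤ 1 := fun x => by
      have e : F x = 1 / 2 + lam / 4 * (σ * (f x - m)) := by simp only [hF]; ring
      have h1 := abs_le.mp (hdσ x)
      rw [e, abs_le]
      constructor <;> nlinarith
    have h1 := hp F (hpf _ _) hF1
    have hνF : expect ν F = 1 / 2 + lam / 4 * (σ * (expect ν f - m)) := by
      simp only [hF, expect_add, expect_const_mul, expect_const hν1]
      ring
    have hμF : expect μ (fun x => F x ^ 2) ≤ (1 + lam ^ 2) / 4 := by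
      calc expect μ (fun x => F x ^ 2)
          ≤ expect μ (fun x => lam * σ / 4 * f x + ((1 + lam ^ 2) / 4 - lam * σ * m / 4)) := by
            refine expect_mono hμ0 fun x => ?_
            have e : F x ^ 2 = 1 / 4 + lam * (σ * (f x - m)) / 4 +
              lam ^ 2 * (σ * (f x - m)) ^ 2 / 16 := by simp only [hF]; ring
            have h2 : (σ * (f x - m)) ^ 2 ≤ 4 := by
              rw [← sq_abs]
              nlinarith [hdσ x, abs_nonneg (σ * (f x - m))]
            rw [e]
            nlinarith [mul_le_mul_of_nonneg_left h2 (sq_nonneg lam)]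
        _ = (1 + lam ^ 2) / 4 := by
            rw [expect_add, expect_const_mul, expect_const hμ1, ← hm]
            ring
    have h2 : (1 / 2 + lam / 4 * (σ * (expect ν f - m))) ^ 2 ≤
        (1 + 2 * H) * ((1 + lam ^ 2) / 4 + E) := by
      rw [← hνF]
      refine h1.trans ?_
      have h3 : 0 ≤ expect μ (fun x => F x ^ 2) :=
        Finset.sum_nonneg fun x _ => mul_nonneg (hμ0 x) (sq_nonneg _)
      refine mul_le_mul hexp (by linarith) (by linarith) (by linarith)
    have h3 : lam * (σ * (expect ν f - m)) ≤ lam ^ 2 + (8 * E + 6 * H) := by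
      have h4 : 0 ≤ (lam / 4 * (σ * (expect ν f - m))) ^ 2 := sq_nonneg _
      have h5 : lam ^ 2 ≤ 1 := pow_le_one₀ hlam.le hlam1
      have h6 : H * (lam ^ 2 + 4 * E) ≤ H * 2 := mul_le_mul_of_nonneg_left (by linarith) hH
      nlinarith
    have h4 : lam + (8 * E + 6 * H) / lam = (lam ^ 2 + (8 * E + 6 * H)) / lam := by field_simp
    rw [h4, le_div_iff₀ hlam]
    linarith
  rw [abs_le]
  have h1 := key 1 (by norm_num)
  have h2 := key (-1) (by norm_num)
  constructor <;> linarith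

/-- The bound is additive over the vertices of `B`, so that block bounds multiply to an exponential
of a sum over vertices. The power of `k` is generous. -/
lemma potential_sq_le {e : ℝ} {g a : V → ℝ} (he : 0 ≤ e) (hg : ∀ v, 0 ≤ g v) (ha : ∀ v, 0 ≤ a v)
    {B : Finset V} {k : ℕ} (hB : B.Nonempty) (hBk : B.card ≤ k) :
    potential e g a B ^ 2 ≤ 3 * k ^ 4 * ∑ v ∈ B, (e ^ 2 + g v ^ 2 + a v ^ 2) := by
  have hm1 : (1 : ℝ) ≤ B.card := by exact_mod_cast hB.card_pos
  have hmk : (B.card : ℝ) ≤ k := by exact_mod_cast hBk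
  have hk1 : (1 : ℝ) ≤ k := hm1.trans hmk
  set m : ℝ := (B.card : ℝ) with hm
  set Sg := ∑ v ∈ B, g v with hSg
  set Sa := ∑ v ∈ B, a v with hSa
  have hSg0 : 0 ≤ Sg := Finset.sum_nonneg fun v _ => hg v
  have hSa0 : 0 ≤ Sa := Finset.sum_nonneg fun v _ => ha v
  have h0 : 0 ≤ potential e g a B := by
    rw [potential]
    refine add_nonneg (add_nonneg ?_ ?_) ?_
    · exact mul_nonneg (mul_nonneg (by linarith) (by linarith)) he
    · exact mul_nonneg (by linarith) hSg0
    · split_ifs <;> simp [hSa0, ← hSa]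
  have h1 : potential e g a B ≤ k ^ 2 * e + k * Sg + Sa := by
    refine (potential_le ha B).trans ?_
    rw [← hm, ← hSg, ← hSa]
    have h2 : m * (m - 1) ≤ (k : ℝ) ^ 2 := by nlinarith
    have h3 := mul_le_mul_of_nonneg_right h2 he
    have h4 := mul_le_mul_of_nonneg_right (by linarith : m - 1 ≤ k) hSg0
    linarith
  have hk4 : (1 : ℝ) ≤ (k : ℝ) ^ 4 := one_le_pow₀ hk1
  have hg2 : Sg ^ 2 ≤ k * ∑ v ∈ B, g v ^ 2 :=
    (sq_sum_le_card_mul_sum_sq (s := B) (f := g)).trans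
      (mul_le_mul_of_nonneg_right hmk (Finset.sum_nonneg fun v _ => sq_nonneg _))
  have ha2 : Sa ^ 2 ≤ k * ∑ v ∈ B, a v ^ 2 :=
    (sq_sum_le_card_mul_sum_sq (s := B) (f := a)).trans
      (mul_le_mul_of_nonneg_right hmk (Finset.sum_nonneg fun v _ => sq_nonneg _))
  have hQg : 0 ≤ ∑ v ∈ B, g v ^ 2 := Finset.sum_nonneg fun v _ => sq_nonneg _
  have hQa : 0 ≤ ∑ v ∈ B, a v ^ 2 := Finset.sum_nonneg fun v _ => sq_nonneg _
  calc potential e g a B ^ 2 ≤ (k ^ 2 * e + k * Sg + Sa) ^ 2 := pow_le_pow_left₀ h0 h1 2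
    _ ≤ 3 * (k ^ 4 * e ^ 2 + k ^ 2 * Sg ^ 2 + Sa ^ 2) := by
        nlinarith [sq_nonneg ((k : ℝ) ^ 2 * e - k * Sg), sq_nonneg ((k : ℝ) ^ 2 * e - Sa),
          sq_nonneg ((k : ℝ) * Sg - Sa)]
    _ ≤ 3 * (k ^ 4 * (m * e ^ 2) + k ^ 4 * ∑ v ∈ B, g v ^ 2 + k ^ 4 * ∑ v ∈ B, a v ^ 2) := by
        have h2 : (k : ℝ) ^ 4 * e ^ 2 ≤ k ^ 4 * (m * e ^ 2) :=
          mul_le_mul_of_nonneg_left (le_mul_of_one_le_left (sq_nonneg e) hm1) (by positivity)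
        have h3 : (k : ℝ) ^ 2 * Sg ^ 2 ≤ k ^ 4 * ∑ v ∈ B, g v ^ 2 := by
          calc (k : ℝ) ^ 2 * Sg ^ 2 ≤ k ^ 2 * (k * ∑ v ∈ B, g v ^ 2) := by gcongr
            _ = k ^ 3 * ∑ v ∈ B, g v ^ 2 := by ring
            _ ≤ _ := mul_le_mul_of_nonneg_right (pow_le_pow_right₀ hk1 (by norm_num)) hQg
        have h4 : Sa ^ 2 ≤ k ^ 4 * ∑ v ∈ B, a v ^ 2 := by
          refine ha2.trans (mul_le_mul_of_nonneg_right ?_ hQa)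
          exact le_self_pow₀ hk1 (by norm_num)
        linarith
    _ = _ := by
        simp only [Finset.sum_add_distrib, Finset.sum_const, nsmul_eq_mul, ← hm]
        ring

/-- The contribution of a vertex to the discrepancy between the law at time `t` and equilibrium. -/
def blockWeight (G : SimpleGraph V) [DecidableRel G.Adj] (q : ℕ) (θ : ℝ) (x₀ : V → Fin q) (t : ℝ)
    (k : ℕ) (v : V) : ℝ :=
  3 * k ^ 4 * ((q : ℝ) ^ 2 / θ) ^ k * (Real.exp (-(2 * θ * t)) ^ 2 + correction G q θ x₀ t v ^ 2 +
    biasNorm G q θ x₀ t v ^ 2)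

lemma blockWeight_nonneg (hθ : 0 < θ) (x₀ : V → Fin q) (t : ℝ) (k : ℕ) (v : V) :
    0 ≤ blockWeight G q θ x₀ t k v := by
  rw [blockWeight]
  positivity

/-- With `a` and `b` the two probabilities of a pattern, `a ^ 2 / b = 2 * a - b + (a - b) ^ 2 / b`,
so the sum is one plus the chi-square distance. There are at most `q ^ k` patterns, each with `b ≥
(θ / q) ^ k`, and the numerator is bounded by the squared potential. -/
lemma sum_sq_div_le (h : Admissible G q θ) (hμ : IsStationary G q θ μ) (x₀ : V → Fin q) {t : ℝ}
    (ht : 0 ≤ t) {B : Finset V} {k : ℕ} (hB : B.Nonempty) (hBk : B.card ≤ k) :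
    ∑ y ∈ patterns B x₀, expect (transition G q θ t x₀) (cylinder B y) ^ 2 /
      expect μ (cylinder B y) ≤ Real.exp (∑ v ∈ B, blockWeight G q θ x₀ t k v) := by
  have hθ := h.pos
  have hq2 : (2 : ℝ) ≤ q := by exact_mod_cast h.two_le
  have hq0 : (0 : ℝ) < q := by linarith
  have hqθ : 1 ≤ q / θ := by
    rw [le_div_iff₀ hθ]
    linarith [h.le_one]
  set D := potential (Real.exp (-(2 * θ * t))) (correction G q θ x₀ t) (biasNorm G q θ x₀ t) B with hD
  have hμpos : ∀ y, 0 < expect μ (cylinder B y) := fun y =>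
    lt_of_lt_of_le (by positivity) (hμ.pow_le_expect_cylinder h B y)
  have hterm : ∀ y ∈ patterns B x₀, expect (transition G q θ t x₀) (cylinder B y) ^ 2 /
      expect μ (cylinder B y) ≤ 2 * expect (transition G q θ t x₀) (cylinder B y) -
        expect μ (cylinder B y) + D ^ 2 * (q / θ) ^ k := by
    intro y _
    set a := expect (transition G q θ t x₀) (cylinder B y)
    set b := expect μ (cylinder B y) with hb
    have hb0 : 0 < b := hμpos y
    have h1 : |a - b| ≤ D := by
      rw [← deviation_eq]
      exact abs_deviation_cylinder_le h hμ x₀ y ht B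
    have h2 : (a - b) ^ 2 ≤ D ^ 2 := sq_le_sq' (by linarith [(abs_le.mp h1).1]) (abs_le.mp h1).2
    have h3 : 1 ≤ (q / θ) ^ k * b := by
      have h4 := hμ.pow_le_expect_cylinder h B y
      calc (1 : ℝ) = (q / θ) ^ B.card * (θ / q) ^ B.card := by
            rw [← mul_pow, div_mul_div_comm, mul_comm (q : ℝ), div_self (by positivity), one_pow]
        _ ≤ (q / θ) ^ k * b :=
            mul_le_mul (pow_le_pow_right₀ hqθ hBk) h4 (by positivity) (by positivity)
    rw [div_le_iff₀ hb0]
    nlinarith [mul_le_mul_of_nonneg_left h3 (sq_nonneg D)]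
  refine (Finset.sum_le_sum hterm).trans ?_
  rw [Finset.sum_add_distrib, Finset.sum_sub_distrib, ← Finset.mul_sum,
    sum_expect_cylinder (sum_transition h x₀ ht), sum_expect_cylinder hμ.sum_eq_one, Finset.sum_const,
    nsmul_eq_mul, card_patterns]
  have h5 : ((q ^ B.card : ℕ) : ℝ) * (D ^ 2 * (q / θ) ^ k) ≤
      ∑ v ∈ B, blockWeight G q θ x₀ t k v := by
    calc ((q ^ B.card : ℕ) : ℝ) * (D ^ 2 * (q / θ) ^ k)
        ≤ (q : ℝ) ^ k * (D ^ 2 * (q / θ) ^ k) := by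
          refine mul_le_mul_of_nonneg_right ?_ (by positivity)
          push_cast
          exact pow_le_pow_right₀ (by linarith) hBk
      _ = (q ^ 2 / θ) ^ k * D ^ 2 := by
          rw [show (q : ℝ) ^ 2 / θ = q * (q / θ) by ring, mul_pow]
          ring
      _ ≤ (q ^ 2 / θ) ^ k * (3 * k ^ 4 * ∑ v ∈ B, (Real.exp (-(2 * θ * t)) ^ 2 +
          correction G q θ x₀ t v ^ 2 + biasNorm G q θ x₀ t v ^ 2)) := by
          refine mul_le_mul_of_nonneg_left ?_ (by positivity)
          exact potential_sq_le (Real.exp_pos _).le (correction_nonneg h x₀ ht)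
            (biasNorm_nonneg x₀ t) hB hBk
      _ = _ := by
          simp only [blockWeight, Finset.mul_sum]
          exact Finset.sum_congr rfl fun v _ => by ring
  linarith [Real.add_one_le_exp (∑ v ∈ B, blockWeight G q θ x₀ t k v)]

lemma Sparse.abs_deviation_le (h : Admissible G q θ) (hG : G.Connected) (hμ : IsStationary G q θ μ)
    (x₀ : V → Fin q) {t : ℝ} (ht : 0 ≤ t) {k r : ℕ} {R : Finset V} (hR : Sparse G k r R)
    {f : (V → Fin q) → ℝ} (hf1 : ∀ x, |f x| ≤ 1)
    (hfR : ∀ x x', (∀ v ∈ R, x v = x' v) → f x = f x') {lam : ℝ} (hlam : 0 < lam) (hlam1 : lam ≤ 1) :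
    |deviation G q θ μ x₀ t f| ≤ lam + (24 * blockError q θ (Fintype.card V) k r * Fintype.card V +
      6 * ∑ v ∈ R, blockWeight G q θ x₀ t k v) / lam := by
  have hθ := h.pos
  have hq : (0 : ℝ) < q := by have := h.two_le; positivity
  have hδ := blockError_nonneg (q := q) hθ (Fintype.card V) k r
  rw [deviation_eq]
  refine (abs_sub_le_of_sq_le (p := fun f => ∀ x x', (∀ v ∈ R, x v = x' v) → f x = f x')
    (fun x => transition_nonneg h x₀ x ht) (sum_transition h x₀ ht) hμ.nonneg hμ.sum_eq_one
    (H := ∑ v ∈ R, blockWeight G q θ x₀ t k v)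
    (E := 3 * blockError q θ (Fintype.card V) k r * R.card)
    (Finset.sum_nonneg fun v _ => blockWeight_nonneg hθ x₀ t k v) (by positivity) (fun f hf hf1 => ?_)
    (fun a b x x' hx => by simp only [hfR x x' hx]) hf1 hlam hlam1).trans ?_
  · exact Sparse.sq_expect_le hG (by have := h.two_le; omega) hθ
      (fun x => transition_nonneg h x₀ x ht) (sum_transition h x₀ ht) hμ.sum_eq_one
      (covarianceDecay_transition h hG ht x₀) (hμ.covarianceDecay h hG) x₀
      (fun v => blockWeight_nonneg hθ x₀ t k v)
      (fun B y => lt_of_lt_of_le (by positivity) (hμ.pow_le_expect_cylinder h B y))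
      (fun B hB hBk => sum_sq_div_le h hμ x₀ ht hB hBk) hR hf1 hf
  · have h1 : (R.card : ℝ) ≤ Fintype.card V := by exact_mod_cast Finset.card_le_univ R
    have h2 := mul_le_mul_of_nonneg_left h1 hδ
    refine add_le_add_right (div_le_div_of_nonneg_right ?_ hlam.le) _
    linarith

/-- The distance to equilibrium at time `t + s`. -/
theorem tvDist_transition_add_le (h : Admissible G q θ) (hG : G.Connected) (hμ : IsStationary G q θ μ)
    {Δ b : ℝ} (hΔ0 : 0 ≤ Δ) (hΔ : ∀ v, (G.degree v : ℝ) ≤ Δ) (x₀ : V → Fin q) {t s : ℝ} (ht : 0 ≤ t)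
    (hs : 0 ≤ s) {k r : ℕ} (hb : ∀ v, ((ball G v (k * r)).card : ℝ) ≤ b) {lam : ℝ} (hlam : 0 < lam)
    (hlam1 : lam ≤ 1) :
    tvDist (transition G q θ (t + s) x₀) μ ≤ (lam +
      (24 * blockError q θ (Fintype.card V) k r * Fintype.card V +
        6 * (Δ * Real.exp (-(θ * s)) * ∑ v, blockWeight G q θ x₀ t k v)) / lam +
      2 * (Fintype.card V * (b * (Δ * Real.exp (-(θ * s)))) ^ k)) / 2 := by
  classical
  have hθ := h.pos
  have hδ := blockError_nonneg (q := q) hθ (Fintype.card V) k r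
  set ξ := Δ * Real.exp (-(θ * s)) with hξ
  have hξ0 : 0 ≤ ξ := by positivity
  set δ := blockError q θ (Fintype.card V) k r * Fintype.card V with hδdef
  set w := blockWeight G q θ x₀ t k with hw
  have hw0 : ∀ v, 0 ≤ w v := fun v => blockWeight_nonneg hθ x₀ t k v
  refine tvDist_le_of_forall fun f hf => ?_
  -- The time is split: the first `t` enters through the law of the configuration, the last `s`
  -- through the lineages.
  have e1 : ∑ x, transition G q θ (t + s) x₀ x * f x - ∑ x, μ x * f x =
      lineageExp G q θ s fun Φ => deviation G q θ μ x₀ t fun x => f (Φ.eval x) := by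
    have h1 : ∑ x, transition G q θ (t + s) x₀ x * f x =
        expect (transition G q θ t x₀) (transition G q θ s *ᵥ f) := by
      change (transition G q θ (t + s) *ᵥ f) x₀ = (transition G q θ t *ᵥ (transition G q θ s *ᵥ f)) x₀
      rw [transition_add, Matrix.mulVec_mulVec]
    have h2 : ∑ x, μ x * f x = expect μ (transition G q θ s *ᵥ f) := (hμ.expect_transition hs f).symm
    rw [h1, h2, ← deviation_eq]
    simp only [deviation, expect, lineageExp_sum, lineageExp_const_mul]
    exact Finset.sum_congr rfl fun x _ => by rw [transition_mulVec_eq_lineageExp h f x hs]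
  rw [e1]
  -- This counts the sets of `k` ancestors in balls of radius `k * r`; it is at least one as soon as
  -- the ancestors fail to be sparse, and its mean is bounded by the product bound on ancestors.
  set bad : Lineage V q → ℝ := fun Φ => ∑ v, ∑ S ∈ (ball G v (k * r)).powersetCard k,
    if S ⊆ ancestors Φ then 1 else 0 with hbad
  have hbad0 : ∀ Φ, 0 ≤ bad Φ := fun Φ => Finset.sum_nonneg fun v _ => Finset.sum_nonneg fun S _ => by
    split_ifs <;> simp
  set W : Lineage V q → ℝ := fun Φ => ∑ v, w v * if {v} ⊆ ancestors Φ then 1 else 0 with hW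
  have hW' : ∀ Φ, W Φ = ∑ v ∈ ancestors Φ, w v := fun Φ => by
    simp only [hW, Finset.singleton_subset_iff, mul_ite, mul_one, mul_zero, Finset.sum_ite_mem,
      Finset.univ_inter]
  have hbound : ∀ Φ : Lineage V q, |deviation G q θ μ x₀ t fun x => f (Φ.eval x)| ≤
      (lam + 24 * δ / lam) + 6 / lam * W Φ + 2 * bad Φ := by
    intro Φ
    by_cases hsp : Sparse G k r (ancestors Φ)
    · have h1 := hsp.abs_deviation_le h hG hμ x₀ ht (f := fun x => f (Φ.eval x)) (fun x => hf _)
        (fun x x' hx => by rw [Lineage.eval_congr hx]) hlam hlam1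
      rw [← hW', mul_assoc, ← hδdef] at h1
      have e : (24 * δ + 6 * W Φ) / lam = 24 * δ / lam + 6 / lam * W Φ := by ring
      linarith [hbad0 Φ]
    · have h1 : |deviation G q θ μ x₀ t fun x => f (Φ.eval x)| ≤ 2 := by
        rw [deviation_eq]
        refine (abs_sub _ _).trans ?_
        have h2 := abs_expect_le (fun x => transition_nonneg h x₀ x ht) (sum_transition h x₀ ht)
          (f := fun x => f (Φ.eval x)) (M := 1) fun x => hf _
        have h3 := abs_expect_le hμ.nonneg hμ.sum_eq_one (f := fun x => f (Φ.eval x)) (M := 1)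
          fun x => hf _
        linarith
      have h2 : 1 ≤ bad Φ := by
        simp only [Sparse, not_forall, not_lt] at hsp
        obtain ⟨v, hv⟩ := hsp
        obtain ⟨S, hS, hcard⟩ := Finset.exists_subset_card_eq hv
        have hSm : S ∈ (ball G v (k * r)).powersetCard k :=
          Finset.mem_powersetCard.mpr ⟨hS.trans Finset.inter_subset_right, hcard⟩
        have hin : ∀ u, 0 ≤ ∑ S ∈ (ball G u (k * r)).powersetCard k,
            (if S ⊆ ancestors Φ then (1 : ℝ) else 0) := fun u => Finset.sum_nonneg fun S _ => by
          split_ifs <;> simp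
        refine le_trans ?_ (Finset.single_le_sum (f := fun v => ∑ S ∈ (ball G v (k * r)).powersetCard k,
          (if S ⊆ ancestors Φ then (1 : ℝ) else 0)) (fun u _ => hin u) (Finset.mem_univ v))
        refine le_trans ?_ (Finset.single_le_sum (f := fun S => if S ⊆ ancestors Φ then (1 : ℝ) else 0)
          (fun S _ => by split_ifs <;> simp) hSm)
        rw [if_pos (hS.trans Finset.inter_subset_left)]
      have h3 : 0 ≤ W Φ := by rw [hW']; exact Finset.sum_nonneg fun v _ => hw0 v
      have h4 : 0 ≤ δ := by positivity
      have h5 : 0 ≤ lam + 24 * δ / lam + 6 / lam * W Φ := by positivity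
      linarith
  refine (abs_lineageExp_le h hs hbound).trans ?_
  rw [lineageExp_add, lineageExp_add, lineageExp_const h, lineageExp_const_mul, lineageExp_const_mul]
  have hEW : lineageExp G q θ s W ≤ ξ * ∑ v, w v := by
    simp only [hW, lineageExp_sum, lineageExp_const_mul, Finset.mul_sum]
    refine Finset.sum_le_sum fun v _ => ?_
    rw [mul_comm ξ]
    refine mul_le_mul_of_nonneg_left ?_ (hw0 v)
    simpa using lineageExp_subset_ancestors_le h hΔ0 hΔ hs {v}
  have hEbad : lineageExp G q θ s bad ≤ Fintype.card V * (b * ξ) ^ k := by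
    simp only [hbad, lineageExp_sum]
    have h1 : ∀ v ∈ (Finset.univ : Finset V), ∑ S ∈ (ball G v (k * r)).powersetCard k,
        lineageExp G q θ s (fun Φ => if S ⊆ ancestors Φ then 1 else 0) ≤ (b * ξ) ^ k := by
      intro v _
      calc _ ≤ ∑ S ∈ (ball G v (k * r)).powersetCard k, ξ ^ k := by
            refine Finset.sum_le_sum fun S hS => ?_
            rw [← (Finset.mem_powersetCard.mp hS).2]
            exact lineageExp_subset_ancestors_le h hΔ0 hΔ hs S
        _ = ((ball G v (k * r)).card.choose k : ℝ) * ξ ^ k := by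
            rw [Finset.sum_const, Finset.card_powersetCard, nsmul_eq_mul]
        _ ≤ b ^ k * ξ ^ k := by
            refine mul_le_mul_of_nonneg_right ?_ (by positivity)
            calc ((ball G v (k * r)).card.choose k : ℝ) ≤ ((ball G v (k * r)).card : ℝ) ^ k := by
                  exact_mod_cast Nat.choose_le_pow _ _
              _ ≤ b ^ k := pow_le_pow_left₀ (by positivity) (hb v) k
        _ = (b * ξ) ^ k := (mul_pow b ξ k).symm
    have := Finset.sum_le_card_nsmul _ _ _ h1
    simpa using this
  have h6 := mul_le_mul_of_nonneg_left hEW (show 0 ≤ 6 / lam by positivity)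
  have e : (24 * blockError q θ (Fintype.card V) k r * Fintype.card V + 6 * (ξ * ∑ v, w v)) / lam =
      24 * δ / lam + 6 / lam * (ξ * ∑ v, w v) := by rw [hδdef]; ring
  linarith

end UpperBound

/-! ### The upper bound on the mixing time -/

section Parameters

lemma pow_le_exp_mul {a : ℝ} (ha : 0 ≤ a) (k : ℕ) : a ^ k ≤ Real.exp (a * k) := by
  rw [mul_comm, Real.exp_nat_mul]
  exact pow_le_pow_left₀ ha (by linarith [Real.add_one_le_exp a]) k

/-- The radius is chosen so that `decayBase θ ^ r ≥ exp ((2 * q + 4) * l)`, which beats `q ^ k ≤ exp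
(2 * q * l)` together with the factors `k`, `n` and `n`, leaving `exp (-l)`. -/
lemma blockError_mul_le {q : ℕ} {θ l : ℝ} (hθ : 0 < θ) {n k r : ℕ}
    (hn : (n : ℝ) = Real.exp l) (hk : (k : ℝ) ≤ 2 * l)
    (hr : (2 * q + 4) / Real.log (decayBase θ) * l ≤ r) :
    blockError q θ n k r * n ≤ 4 / θ * Real.exp (-l) := by
  have hb : 1 < decayBase θ := by rw [decayBase]; linarith
  have hlog : 0 < Real.log (decayBase θ) := Real.log_pos hb
  have h1 : (q : ℝ) ^ k ≤ Real.exp (2 * q * l) := by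
    refine (pow_le_exp_mul (Nat.cast_nonneg q) k).trans (Real.exp_le_exp.mpr ?_)
    have := mul_le_mul_of_nonneg_left hk (Nat.cast_nonneg q : (0 : ℝ) ≤ q)
    linarith
  have h2 : Real.exp ((2 * q + 4) * l) ≤ decayBase θ ^ r := by
    rw [← Real.exp_log (pow_pos (by linarith : 0 < decayBase θ) r), Real.log_pow]
    refine Real.exp_le_exp.mpr ?_
    have := mul_le_mul_of_nonneg_right hr hlog.le
    refine le_trans (le_of_eq ?_) this
    field_simp
  have h3 : (k : ℝ) ≤ 2 * Real.exp l := by linarith [Real.add_one_le_exp l]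
  rw [blockError, hn]
  calc (q : ℝ) ^ k * (2 * k * Real.exp l / (θ * decayBase θ ^ r)) * Real.exp l
      ≤ Real.exp (2 * q * l) * (2 * (2 * Real.exp l) * Real.exp l /
        (θ * Real.exp ((2 * q + 4) * l))) * Real.exp l := by gcongr
    _ = 4 / θ * (Real.exp (2 * q * l) * Real.exp l * Real.exp l * Real.exp l /
        Real.exp ((2 * q + 4) * l)) := by
        have := Real.exp_pos ((2 * q + 4) * l)
        field_simp
        ring
    _ = 4 / θ * Real.exp (-l) := by
        rw [← Real.exp_add, ← Real.exp_add, ← Real.exp_add, ← Real.exp_sub]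
        ring_nf

/-- Each of the `k` factors is at most `exp (-(2 * x))`, and `k * x ≥ y * x = l`, so the power is at
most `exp (-(2 * l))`. -/
lemma card_mul_pow_le {c₀ Δ a θ C l x y b : ℝ} (hc₀ : 0 < c₀) (hΔ : 0 < Δ) {n k : ℕ}
    (hn : (n : ℝ) = Real.exp l) (hx : 1 ≤ x) (hyk : y ≤ k) (hxy : x * y = l)
    (hb0 : 0 ≤ b) (hb : b ≤ c₀ * Real.exp (a * x)) (hC : c₀ * Δ + a + 2 ≤ θ * C) :
    n * (b * (Δ * Real.exp (-(θ * (C * x))))) ^ k ≤ Real.exp (-l) := by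
  have h1 : b * (Δ * Real.exp (-(θ * (C * x)))) ≤ Real.exp (-(2 * x)) := by
    have hcΔ : c₀ * Δ ≤ Real.exp (c₀ * Δ * x) := by
      have h2 : 0 < c₀ * Δ := by positivity
      linarith [Real.add_one_le_exp (c₀ * Δ * x), le_mul_of_one_le_right h2.le hx]
    calc b * (Δ * Real.exp (-(θ * (C * x))))
        ≤ c₀ * Real.exp (a * x) * (Δ * Real.exp (-(θ * (C * x)))) := by gcongr
      _ = c₀ * Δ * (Real.exp (a * x) * Real.exp (-(θ * (C * x)))) := by ring
      _ ≤ Real.exp (c₀ * Δ * x) * (Real.exp (a * x) * Real.exp (-(θ * (C * x)))) := by gcongr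
      _ = Real.exp (c₀ * Δ * x + (a * x + -(θ * (C * x)))) := by rw [Real.exp_add, Real.exp_add]
      _ ≤ Real.exp (-(2 * x)) := by
        refine Real.exp_le_exp.mpr ?_
        have := mul_le_mul_of_nonneg_right hC (by linarith : 0 ≤ x)
        linarith
  calc n * (b * (Δ * Real.exp (-(θ * (C * x))))) ^ k
      ≤ Real.exp l * Real.exp (-(2 * x)) ^ k := by
        rw [hn]
        gcongr
    _ = Real.exp (l + k * -(2 * x)) := by rw [Real.exp_add, Real.exp_nat_mul]
    _ ≤ Real.exp (-l) := by
        refine Real.exp_le_exp.mpr ?_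
        have := mul_le_mul_of_nonneg_left hyk (by linarith : 0 ≤ x)
        linarith

variable {G : SimpleGraph V} [DecidableRel G.Adj] {q : ℕ} {θ : ℝ} [Nonempty V]

/-- At the cutoff time `n * exp (-(4 * θ * T)) ≤ 1`, the correction is bounded by `T ^ 2` up to a
constant, and the biases by a constant since the autocorrelation is at most `1 / n`. -/
lemma sum_blockWeight_le (h : Admissible G q θ) {Δ : ℝ} (hΔ : ∀ v, (G.degree v : ℝ) ≤ Δ)
    (x₀ : V → Fin q) (hl : 0 < Real.log (Fintype.card V)) (k : ℕ) :
    ∑ v, blockWeight G q θ x₀ (cutoffTime G q θ x₀) k v ≤ 3 * k ^ 4 * ((q : ℝ) ^ 2 / θ) ^ k *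
      (1 + Real.exp 1 * q * Δ * (Real.log (Fintype.card V) / (2 * θ)) ^ 2 + q * Δ) := by
  have hθ := h.pos
  have hn := card_pos_real (V := V)
  have hΔ0 : 0 ≤ Δ := le_trans (by positivity) (hΔ (Classical.arbitrary V))
  have hlog := log_card_le_cutoffTime h x₀
  have hle := cutoffTime_le h x₀
  have h0 := cutoffTime_nonneg (G := G) (θ := θ) x₀
  set T := cutoffTime G q θ x₀ with hT
  have hpos : 0 < T := by
    rcases h0.eq_or_lt with he | hlt
    · rw [← he] at hlog
      linarith
    · exact hlt
  have hd1 : ∀ v, (1 : ℝ) ≤ G.degree v := fun v => by exact_mod_cast h.degree_pos v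
  have hdrop : ∀ f : V → ℝ, ∑ v, f v ^ 2 ≤ ∑ v, (G.degree v : ℝ) * f v ^ 2 := fun f =>
    Finset.sum_le_sum fun v _ => le_mul_of_one_le_left (sq_nonneg _) (hd1 v)
  have h1 : ∑ _v : V, Real.exp (-(2 * θ * T)) ^ 2 ≤ 1 := by
    rw [Finset.sum_const, Finset.card_univ, nsmul_eq_mul, ← Real.exp_nat_mul, ← Real.exp_log hn,
      ← Real.exp_add, Real.exp_le_one_iff]
    push_cast
    linarith
  have h2 : ∑ v, correction G q θ x₀ T v ^ 2 ≤
      Real.exp 1 * q * Δ * (Real.log (Fintype.card V) / (2 * θ)) ^ 2 := by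
    refine (hdrop _).trans ((sum_degree_mul_correction_sq_le h hΔ x₀ hpos).trans ?_)
    refine mul_le_mul_of_nonneg_left (pow_le_pow_left₀ h0 hle 2) (by positivity)
  have h3 : ∑ v, biasNorm G q θ x₀ T v ^ 2 ≤ q * Δ := by
    refine (hdrop _).trans ((sum_degree_mul_biasNorm_sq_le h hΔ x₀ h0 le_rfl).trans (le_of_eq ?_))
    rw [← hT, sub_self, mul_zero, Real.exp_zero, mul_one]
  simp only [blockWeight]
  rw [← Finset.mul_sum, Finset.sum_add_distrib, Finset.sum_add_distrib]
  refine mul_le_mul_of_nonneg_left (by linarith) (by positivity)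

/-- The powers `k ^ 4` and `l ^ 2 ≤ x ^ 4` yield `x ^ 8 ≤ 40320 * exp x`, where `40320` is the
factorial of `8`. The decay `exp (-(θ * (C * x)))` outweighs this and the exponential in `k`. -/
lemma sum_blockWeight_mul_le (h : Admissible G q θ) {Δ : ℝ} (hΔ : ∀ v, (G.degree v : ℝ) ≤ Δ)
    (x₀ : V → Fin q) {l x C : ℝ} (hl : l = Real.log (Fintype.card V)) (hl1 : 1 ≤ l) (hx : 1 ≤ x)
    (hlx : l ≤ x ^ 2) {k : ℕ} (hk : (k : ℝ) ≤ 2 * x) (hC : 2 * (q ^ 2 / θ) + 2 ≤ θ * C) :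
    Δ * Real.exp (-(θ * (C * x))) * ∑ v, blockWeight G q θ x₀ (cutoffTime G q θ x₀) k v ≤
      Δ * (48 * (1 + Real.exp 1 * q * Δ / (2 * θ) ^ 2 + q * Δ) * 40320) * Real.exp (-x) := by
  have hθ := h.pos
  have hΔ0 : 0 ≤ Δ := le_trans (by positivity) (hΔ (Classical.arbitrary V))
  have h1 := sum_blockWeight_le h hΔ x₀ (by linarith) k
  rw [← hl] at h1
  set A := (q : ℝ) ^ 2 / θ with hA
  have hA0 : 0 ≤ A := by positivity
  have hx8 : x ^ 8 ≤ 40320 * Real.exp x := by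
    have := Real.pow_div_factorial_le_exp x (by linarith) 8
    rw [div_le_iff₀ (by positivity)] at this
    have e : ((Nat.factorial 8 : ℕ) : ℝ) = 40320 := by norm_num [Nat.factorial]
    rw [e] at this
    linarith
  have hAk : A ^ k ≤ Real.exp (2 * A * x) := by
    refine (pow_le_exp_mul hA0 k).trans (Real.exp_le_exp.mpr ?_)
    have := mul_le_mul_of_nonneg_left hk hA0
    linarith
  have hx4 : 1 ≤ x ^ 4 := one_le_pow₀ hx
  have hl2 : l ^ 2 ≤ x ^ 4 := by
    calc l ^ 2 ≤ (x ^ 2) ^ 2 := pow_le_pow_left₀ (by linarith) hlx 2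
      _ = x ^ 4 := by ring
  set D := 1 + Real.exp 1 * q * Δ / (2 * θ) ^ 2 + q * Δ with hD
  have hD0 : 0 ≤ D := by positivity
  have hlast : 1 + Real.exp 1 * q * Δ * (l / (2 * θ)) ^ 2 + q * Δ ≤ D * x ^ 4 := by
    have e : Real.exp 1 * q * Δ * (l / (2 * θ)) ^ 2 = Real.exp 1 * q * Δ / (2 * θ) ^ 2 * l ^ 2 := by
      rw [div_pow]; ring
    have h2 := mul_le_mul_of_nonneg_left hl2 (show 0 ≤ Real.exp 1 * q * Δ / (2 * θ) ^ 2 by positivity)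
    have h3 := mul_le_mul_of_nonneg_left hx4 (show 0 ≤ (q : ℝ) * Δ by positivity)
    rw [e, hD]
    linarith
  have hw : ∑ v, blockWeight G q θ x₀ (cutoffTime G q θ x₀) k v ≤
      48 * D * 40320 * Real.exp ((2 * A + 1) * x) := by
    refine h1.trans ?_
    calc 3 * (k : ℝ) ^ 4 * A ^ k * (1 + Real.exp 1 * q * Δ * (l / (2 * θ)) ^ 2 + q * Δ)
        ≤ 3 * (2 * x) ^ 4 * Real.exp (2 * A * x) * (D * x ^ 4) := by gcongr
      _ = 48 * D * x ^ 8 * Real.exp (2 * A * x) := by ring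
      _ ≤ 48 * D * (40320 * Real.exp x) * Real.exp (2 * A * x) := by gcongr
      _ = 48 * D * 40320 * (Real.exp (2 * A * x) * Real.exp x) := by ring
      _ = _ := by rw [← Real.exp_add]; ring_nf
  calc Δ * Real.exp (-(θ * (C * x))) * ∑ v, blockWeight G q θ x₀ (cutoffTime G q θ x₀) k v
      ≤ Δ * Real.exp (-(θ * (C * x))) * (48 * D * 40320 * Real.exp ((2 * A + 1) * x)) := by gcongr
    _ = Δ * (48 * D * 40320) * (Real.exp (-(θ * (C * x))) * Real.exp ((2 * A + 1) * x)) := by ring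
    _ ≤ Δ * (48 * D * 40320) * Real.exp (-x) := by
        refine mul_le_mul_of_nonneg_left ?_ (by positivity)
        rw [← Real.exp_add]
        refine Real.exp_le_exp.mpr ?_
        have := mul_le_mul_of_nonneg_right hC (by linarith : 0 ≤ x)
        linarith

end Parameters

set_option maxHeartbeats 1000000 in
/-- Shortly after the cutoff time, the distance to equilibrium is small. -/
theorem exists_upper_bound {θ : ℝ} (hθ : 0 < θ) (hθ' : θ ≤ 1) {q : ℕ} (hq : 2 ≤ q) {c₀ α ε : ℝ}
    (hc₀ : 0 < c₀) (hα : 0 < α) (hα' : α < 1) (hε : 0 < ε) (hε' : ε < 1) :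
    ∃ C l₀ : ℝ, 0 ≤ C ∧ 1 ≤ l₀ ∧ ∀ (V : Type u) [Fintype V] [DecidableEq V] (G : SimpleGraph V)
      [DecidableRel G.Adj], G.Connected → 2 ≤ Fintype.card V → SubexpGrowth G c₀ α →
      ∀ x₀ : V → Fin q, l₀ ≤ Real.log (Fintype.card V) →
      tvDist (transition G q θ (cutoffTime G q θ x₀ + C * Real.log (Fintype.card V) ^ (1 - α / 2)) x₀)
        (stationary G q θ) < ε := by
  set Δ := c₀ * Real.exp 1 with hΔ
  have hΔ0 : 0 < Δ := by positivity
  have hb1 : 1 < decayBase θ := by rw [decayBase]; linarith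
  have hlogb : 0 < Real.log (decayBase θ) := Real.log_pos hb1
  set cr := (2 * q + 4) / Real.log (decayBase θ) with hcr
  have hcr0 : 0 < cr := by positivity
  set a := 2 * (cr + 1) with ha
  have ha1 : 1 ≤ a := by linarith
  have hA0 : 0 ≤ (q : ℝ) ^ 2 / θ := by positivity
  set D := 48 * (1 + Real.exp 1 * q * Δ / (2 * θ) ^ 2 + q * Δ) * 40320 with hD
  have hD0 : 0 ≤ D := by positivity
  set Z := (24 * (4 / θ) + 6 * (Δ * D)) / (ε / 4) + 2 with hZ
  have hZ0 : 0 ≤ Z := by positivity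
  -- The sum of what `card_mul_pow_le` and `sum_blockWeight_mul_le` require, so that both conditions
  -- hold.
  set C := (c₀ * Δ + a + 2 + (2 * (q ^ 2 / θ) + 2)) / θ with hC
  have hC0 : 0 ≤ C := by positivity
  have hθC : θ * C = c₀ * Δ + a + 2 + (2 * (q ^ 2 / θ) + 2) := by
    rw [hC]; field_simp
  refine ⟨C, max 1 ((Z / ε) ^ 2), hC0, le_max_left _ _, ?_⟩
  intro V _ _ G _ hG hV hgr x₀ hl
  have : Nonempty V := Fintype.card_pos_iff.mp (by omega)
  have h := Admissible.of_connected hq hθ hθ' hG hV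
  have hμ := isStationary_stationary G q θ hq hθ hθ' hG hV
  have hn := card_pos_real (V := V)
  set l := Real.log (Fintype.card V) with hldef
  have hl1 : 1 ≤ l := (le_max_left _ _).trans hl
  have hl0 : 0 < l := by linarith
  have hnl : (Fintype.card V : ℝ) = Real.exp l := by rw [hldef, Real.exp_log hn]
  -- The scales balance: blocks of `k ≈ y` points at separation `r ≈ cr * l` involve balls of radius
  -- of order `l ^ (1 + α / 2)`. Since `(1 + α / 2) * (1 - α) ≤ 1 - α / 2`, their sizes are only
  -- `exp (O(x))`, which the extra time `C * x` overcomes.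
  set x := l ^ (1 - α / 2) with hx
  set y := l ^ (α / 2) with hy
  have hx1 : 1 ≤ x := Real.one_le_rpow hl1 (by linarith)
  have hy1 : 1 ≤ y := Real.one_le_rpow hl1 (by linarith)
  have hxy : x * y = l := by
    rw [hx, hy, ← Real.rpow_add hl0]
    norm_num
  have hyx : y ≤ x := Real.rpow_le_rpow_of_exponent_le hl1 (by linarith)
  have hlx : l ≤ x ^ 2 := by
    rw [← hxy, sq]
    exact mul_le_mul_of_nonneg_left hyx (by linarith)
  have hxl : x ≤ l := by
    rw [← hxy]
    exact le_mul_of_one_le_right (by linarith) hy1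
  have hyl : y ≤ l := hyx.trans hxl
  have hxZ : Z / ε ≤ x :=
    le_of_sq_le_sq (((le_max_right _ _).trans hl).trans hlx) (by linarith)
  set k := ⌈y⌉₊ with hk
  have hyk : y ≤ k := Nat.le_ceil y
  have hk2 : (k : ℝ) ≤ 2 * y := by linarith [Nat.ceil_lt_add_one (show 0 ≤ y by linarith)]
  set r := ⌈cr * l⌉₊ with hr
  have hrl : cr * l ≤ r := Nat.le_ceil _
  have hr2 : (r : ℝ) ≤ (cr + 1) * l := by
    linarith [Nat.ceil_lt_add_one (show 0 ≤ cr * l by positivity)]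
  have hk1 : 1 ≤ k := by
    have : (1 : ℝ) ≤ k := hy1.trans hyk
    exact_mod_cast this
  have hr1 : 1 ≤ r := Nat.ceil_pos.mpr (by positivity)
  have hkr : 1 ≤ k * r := Nat.mul_pos hk1 hr1
  set b := c₀ * Real.exp (((k * r : ℕ) : ℝ) ^ (1 - α)) with hb
  have hball : ∀ v, ((ball G v (k * r)).card : ℝ) ≤ b := fun v => hgr.card_ball_le hG v hkr
  have hbx : b ≤ c₀ * Real.exp (a * x) := by
    refine mul_le_mul_of_nonneg_left (Real.exp_le_exp.mpr ?_) hc₀.le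
    have h1 : ((k * r : ℕ) : ℝ) ≤ a * (y * l) := by
      push_cast
      calc (k : ℝ) * r ≤ 2 * y * ((cr + 1) * l) := by gcongr
        _ = a * (y * l) := by rw [ha]; ring
    calc ((k * r : ℕ) : ℝ) ^ (1 - α) ≤ (a * (y * l)) ^ (1 - α) :=
          Real.rpow_le_rpow (by positivity) h1 (by linarith)
      _ = a ^ (1 - α) * (y * l) ^ (1 - α) := Real.mul_rpow (by positivity) (by positivity)
      _ ≤ a * x := by
        refine mul_le_mul ?_ ?_ (by positivity) (by positivity)
        · calc a ^ (1 - α) ≤ a ^ (1 : ℝ) := Real.rpow_le_rpow_of_exponent_le ha1 (by linarith)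
            _ = a := Real.rpow_one a
        · rw [hy, ← Real.rpow_add_one hl0.ne', ← Real.rpow_mul hl0.le]
          refine Real.rpow_le_rpow_of_exponent_le hl1 ?_
          linarith [mul_pos hα hα]
  have hmain := tvDist_transition_add_le h hG hμ hΔ0.le (hgr.degree_le hG) x₀
    (cutoffTime_nonneg (G := G) (θ := θ) x₀) (s := C * x) (by positivity) hball (lam := ε / 4) (by positivity)
    (by linarith)
  refine lt_of_le_of_lt hmain ?_
  have hexpx : Real.exp (-l) ≤ Real.exp (-x) := Real.exp_le_exp.mpr (by linarith)
  have t1 : blockError q θ (Fintype.card V) k r * Fintype.card V ≤ 4 / θ * Real.exp (-x) :=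
    (blockError_mul_le hθ hnl (by linarith) hrl).trans
      (mul_le_mul_of_nonneg_left hexpx (by positivity))
  have t2 := sum_blockWeight_mul_le h (hgr.degree_le hG) x₀ hldef hl1 hx1 hlx (k := k) (by linarith)
    (C := C) (by rw [hθC]; linarith [mul_pos hc₀ hΔ0])
  have t3 : Fintype.card V * (b * (Δ * Real.exp (-(θ * (C * x))))) ^ k ≤ Real.exp (-x) :=
    (card_mul_pow_le hc₀ hΔ0 hnl hx1 hyk hxy (by positivity) hbx (by rw [hθC]; linarith)).trans hexpx
  rw [← hΔ, ← hD] at t2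
  have hZx : Z * Real.exp (-x) ≤ ε := by
    rw [Real.exp_neg, ← div_eq_mul_inv, div_le_iff₀ (Real.exp_pos _)]
    rw [div_le_iff₀ hε] at hxZ
    linarith [mul_le_mul_of_nonneg_left (Real.add_one_le_exp x) hε.le]
  have hsum : (24 * blockError q θ (Fintype.card V) k r * Fintype.card V + 6 *
      (Δ * Real.exp (-(θ * (C * x))) * ∑ v, blockWeight G q θ x₀ (cutoffTime G q θ x₀) k v)) /
        (ε / 4) + 2 * (Fintype.card V * (b * (Δ * Real.exp (-(θ * (C * x))))) ^ k) ≤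
      Z * Real.exp (-x) := by
    have e : Z * Real.exp (-x) = (24 * (4 / θ * Real.exp (-x)) + 6 * (Δ * D * Real.exp (-x))) /
        (ε / 4) + 2 * Real.exp (-x) := by rw [hZ]; ring
    rw [e]
    refine add_le_add (div_le_div_of_nonneg_right ?_ (by positivity)) (by linarith)
    linarith
  linarith

/-! ### The mixing time -/

section MixingTime

variable {G : SimpleGraph V} [DecidableRel G.Adj] {q : ℕ} {θ ε : ℝ} {μ : (V → Fin q) → ℝ}

/-- A crude bound, uniform for bounded `n`, which handles graphs too small for the asymptotic
estimates. -/
lemma tvDist_le_card_mul_exp (h : Admissible G q θ) (hμ : IsStationary G q θ μ) (x₀ : V → Fin q) {t : ℝ}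
    (ht : 0 ≤ t) : tvDist (transition G q θ t x₀) μ ≤ Fintype.card V * Real.exp (-(θ * t)) := by
  have h1 : tvDist (transition G q θ t x₀) μ ≤ Real.exp (-(θ * t)) * (Fintype.card V * 2) / 2 := by
    refine tvDist_le_of_forall fun f hf => ?_
    have hinf : HasInfluence f fun _ => 2 := fun x a c =>
      (abs_sub _ _).trans (by linarith [hf x, hf (Function.update x a c)])
    have := hμ.abs_sub_expect_le h hinf ht x₀
    rw [Finset.sum_const, Finset.card_univ, nsmul_eq_mul] at this
    exact this
  linarith

lemma tmix_nonneg (x₀ : V → Fin q) : 0 ≤ tmix G q θ x₀ ε := Real.sInf_nonneg fun _ ht => ht.1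

lemma tmix_le {x₀ : V → Fin q} {t : ℝ} (ht : 0 ≤ t)
    (htv : tvDist (transition G q θ t x₀) (stationary G q θ) < ε) : tmix G q θ x₀ ε ≤ t :=
  csInf_le ⟨0, fun _ h => h.1⟩ ⟨ht, htv⟩

/-- A time `t` at which the chain is mixed has to be supplied, since the infimum of the empty set is
`0`. -/
lemma le_tmix {x₀ : V → Fin q} {s t : ℝ} (ht : 0 ≤ t)
    (htv : tvDist (transition G q θ t x₀) (stationary G q θ) < ε)
    (hs : ∀ r, 0 ≤ r → r ≤ s → ε ≤ tvDist (transition G q θ r x₀) (stationary G q θ)) :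
    s ≤ tmix G q θ x₀ ε := by
  refine le_csInf ⟨t, ht, htv⟩ fun r hr => ?_
  by_contra hc
  push Not at hc
  exact absurd hr.2 (not_lt.mpr (hs r hr.1 hc.le))

end MixingTime

/-- The mixing time is the cutoff time, up to a small relative error. -/
theorem exists_tmix_eq {θ : ℝ} (hθ : 0 < θ) (hθ' : θ ≤ 1) {q : ℕ} (hq : 2 ≤ q) {c₀ α ε : ℝ}
    (hc₀ : 0 < c₀) (hα : 0 < α) (hα' : α < 1) (hε : 0 < ε) (hε' : ε < 1) :
    ∃ C : ℝ, ∀ (V : Type u) [Fintype V] [DecidableEq V] (G : SimpleGraph V) [DecidableRel G.Adj],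
      G.Connected → 2 ≤ Fintype.card V → SubexpGrowth G c₀ α → ∀ x₀ : V → Fin q,
      ∃ δ : ℝ, |δ| ≤ C * Real.log (Fintype.card V) ^ (-(α / 2)) ∧
        tmix G q θ x₀ ε = (1 + δ) * cutoffTime G q θ x₀ := by
  obtain ⟨C₁, l₁, hC₁, hl₁, hlow⟩ := exists_lower_bound.{u} hθ hθ' hq hc₀ hα hα' hε'
  obtain ⟨C₂, l₂, hC₂, hl₂, hup⟩ := exists_upper_bound.{u} hθ hθ' hq hc₀ hα hα' hε hε'
  set l₀ := max l₁ l₂ with hl₀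
  have hl₀1 : 1 ≤ l₀ := hl₁.trans (le_max_left _ _)
  set M := (l₀ + Real.log (2 / ε)) / θ with hM
  have hlogε : 0 ≤ Real.log (2 / ε) := Real.log_nonneg (by rw [le_div_iff₀ hε]; linarith)
  have hM0 : 0 ≤ M := div_nonneg (by linarith) hθ.le
  have hlog2 : 0 < Real.log 2 := Real.log_pos (by norm_num)
  set K := 4 * θ * M / Real.log 2 + 1 with hK
  have hK0 : 0 ≤ K := by positivity
  refine ⟨max (4 * θ * max C₁ C₂) (K * l₀ ^ (α / 2)), ?_⟩
  intro V _ _ G _ hG hV hgr x₀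
  have : Nonempty V := Fintype.card_pos_iff.mp (by omega)
  have h := Admissible.of_connected hq hθ hθ' hG hV
  have hμ := isStationary_stationary G q θ hq hθ hθ' hG hV
  have hn := card_pos_real (V := V)
  have hT := log_card_le_cutoffTime h x₀
  set l := Real.log (Fintype.card V) with hldef
  have hl2 : Real.log 2 ≤ l := Real.log_le_log (by norm_num) (by exact_mod_cast hV)
  have hl0 : 0 < l := hlog2.trans_le hl2
  set T := cutoffTime G q θ x₀ with hTdef
  have hT0 : 0 < T := by
    by_contra hc
    push Not at hc
    nlinarith
  set m := tmix G q θ x₀ ε with hm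
  have hlα : 0 < l ^ (-(α / 2)) := by positivity
  refine ⟨(m - T) / T, ?_, by field_simp; ring⟩
  by_cases hll : l₀ ≤ l
  · have hx : l ^ (1 - α / 2) = l * l ^ (-(α / 2)) := by
      rw [← Real.rpow_one_add' hl0.le (by linarith)]
      ring_nf
    have hx0 : 0 ≤ l ^ (1 - α / 2) := by positivity
    have h1 := hup V G hG hV hgr x₀ ((le_max_right _ _).trans hll)
    have ht1 : 0 ≤ T + C₂ * l ^ (1 - α / 2) := by positivity
    have h2 := tmix_le ht1 h1
    have h3 := le_tmix ht1 h1 (hlow V G hG hV hgr x₀ ((le_max_left _ _).trans hll))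
    rw [← hm] at h2 h3
    have h4 : |m - T| ≤ max C₁ C₂ * l ^ (1 - α / 2) := by
      have h5 := mul_le_mul_of_nonneg_right (le_max_left C₁ C₂) hx0
      have h6 := mul_le_mul_of_nonneg_right (le_max_right C₁ C₂) hx0
      rw [abs_le]
      constructor <;> linarith
    rw [abs_div, abs_of_pos hT0, div_le_iff₀ hT0]
    refine h4.trans ?_
    have hCC : 0 ≤ max C₁ C₂ := hC₁.trans (le_max_left _ _)
    -- The cutoff time is at least `l / (4 * θ)`, which turns the additive window into a relative
    -- error.
    calc max C₁ C₂ * l ^ (1 - α / 2) = max C₁ C₂ * l ^ (-(α / 2)) * l := by rw [hx]; ring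
      _ ≤ max C₁ C₂ * l ^ (-(α / 2)) * (4 * θ * T) :=
          mul_le_mul_of_nonneg_left hT (by positivity)
      _ = 4 * θ * max C₁ C₂ * l ^ (-(α / 2)) * T := by ring
      _ ≤ _ := by gcongr; exact le_max_left _ _
  -- For small graphs the mixing time is at most `M` and the cutoff time is bounded away from `0`
  -- because `l ≥ log 2`. The relative error is then at most `K`, and the factor `l₀ ^ (α / 2)`
  -- compensates the decreasing power of `l`.
  · push Not at hll
    have h1 : tvDist (transition G q θ M x₀) (stationary G q θ) < ε := by
      refine lt_of_le_of_lt (tvDist_le_card_mul_exp h hμ x₀ hM0) ?_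
      rw [← Real.exp_log hn, ← hldef, ← Real.exp_add, hM, mul_div_cancel₀ _ hθ.ne']
      calc Real.exp (l + -(l₀ + Real.log (2 / ε))) ≤ Real.exp (-Real.log (2 / ε)) :=
            Real.exp_le_exp.mpr (by linarith)
        _ = ε / 2 := by rw [Real.exp_neg, Real.exp_log (by positivity), inv_div]
        _ < ε := by linarith
    have h2 : m ≤ M := tmix_le hM0 h1
    have h3 : 0 ≤ m := tmix_nonneg x₀
    have h4 : |m - T| ≤ K * T := by
      have h5 : M ≤ 4 * θ * M / Real.log 2 * T := by
        rw [div_mul_eq_mul_div, le_div_iff₀ hlog2]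
        calc M * Real.log 2 ≤ M * (4 * θ * T) := mul_le_mul_of_nonneg_left (hl2.trans hT) hM0
          _ = 4 * θ * M * T := by ring
      have h6 : 0 ≤ 4 * θ * M / Real.log 2 * T := by positivity
      rw [abs_le, hK, add_mul, one_mul]
      constructor <;> linarith
    have h5 : 1 ≤ l₀ ^ (α / 2) * l ^ (-(α / 2)) := by
      rw [Real.rpow_neg hl0.le, ← div_eq_mul_inv, le_div_iff₀ (by positivity), one_mul]
      exact Real.rpow_le_rpow hl0.le hll.le (by linarith)
    rw [abs_div, abs_of_pos hT0, div_le_iff₀ hT0]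
    refine h4.trans (mul_le_mul_of_nonneg_right ?_ hT0.le)
    calc K ≤ K * (l₀ ^ (α / 2) * l ^ (-(α / 2))) := le_mul_of_one_le_right hK0 h5
      _ = K * l₀ ^ (α / 2) * l ^ (-(α / 2)) := by ring
      _ ≤ _ := by gcongr; exact le_max_right _ _

/-- Cutoff at the cutoff time. -/
theorem hasCutoffAt_cutoffTime {θ : ℝ} (hθ : 0 < θ) (hθ' : θ ≤ 1) {q : ℕ} (hq : 2 ≤ q) {c₀ α : ℝ}
    (hc₀ : 0 < c₀) (hα : 0 < α) (hα' : α < 1) (V : ℕ → Type u) [∀ k, Fintype (V k)]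
    [∀ k, DecidableEq (V k)] (G : ∀ k, SimpleGraph (V k)) [∀ k, DecidableRel (G k).Adj]
    (hG : ∀ k, (G k).Connected) (hgr : ∀ k, SubexpGrowth (G k) c₀ α)
    (hV : Tendsto (fun k => Fintype.card (V k)) atTop atTop) (x₀ : ∀ k, V k → Fin q) :
    HasCutoffAt (fun k ε => tmix (G k) q θ (x₀ k) ε) fun k => cutoffTime (G k) q θ (x₀ k) := by
  intro ε hε hε'
  obtain ⟨C, hC⟩ := exists_tmix_eq.{u} hθ hθ' hq hc₀ hα hα' hε hε'
  have hlim : Tendsto (fun k => C * Real.log (Fintype.card (V k)) ^ (-(α / 2))) atTop (𝓝 0) := by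
    have h1 : Tendsto (fun k => Real.log (Fintype.card (V k) : ℝ)) atTop atTop :=
      Real.tendsto_log_atTop.comp (tendsto_natCast_atTop_atTop.comp hV)
    simpa using ((tendsto_rpow_neg_atTop (half_pos hα)).comp h1).const_mul C
  rw [tendsto_iff_norm_sub_tendsto_zero]
  refine squeeze_zero' (Eventually.of_forall fun _ => norm_nonneg _) ?_ hlim
  filter_upwards [hV.eventually_ge_atTop 2] with k hk
  obtain ⟨δ, hδ, he⟩ := hC (V k) (G k) (hG k) hk (hgr k) (x₀ k)
  have : Nonempty (V k) := Fintype.card_pos_iff.mp (by omega)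
  have hT := log_card_le_cutoffTime (Admissible.of_connected hq hθ hθ' (hG k) hk) (x₀ k)
  have hl : 0 < Real.log (Fintype.card (V k)) := Real.log_pos (by exact_mod_cast hk)
  have hT0 : cutoffTime (G k) q θ (x₀ k) ≠ 0 := fun h0 => by
    rw [h0, mul_zero] at hT
    linarith
  rw [he, mul_div_cancel_right₀ _ hT0, add_sub_cancel_left, Real.norm_eq_abs]
  exact hδ

end

end NoisyVoter

/-! ### The theorem -/

theorem theorem1p1 (θ : ℝ) (hθ : 0 < θ) (hθ' : θ ≤ 1) (q : ℕ) (hq : 2 ≤ q)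
    (c₀ α : ℝ) (hc₀ : 0 < c₀) (hα : 0 < α) (hα' : α < 1) :
    (∀ ε : ℝ, 0 < ε → ε < 1 → ∃ C : ℝ, ∀ (V : Type u) [Fintype V] [DecidableEq V]
      (G : SimpleGraph V) [DecidableRel G.Adj], G.Connected → 2 ≤ Fintype.card V →
      NoisyVoter.SubexpGrowth G c₀ α → ∀ x₀ : V → Fin q,
      ∃ δ : ℝ, |δ| ≤ C * Real.log (Fintype.card V) ^ (-(α / 2)) ∧
        NoisyVoter.tmix G q θ x₀ ε = (1 + δ) * NoisyVoter.cutoffTime G q θ x₀) ∧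
    (∀ (V : ℕ → Type u) [∀ k, Fintype (V k)] [∀ k, DecidableEq (V k)]
      (G : ∀ k, SimpleGraph (V k)) [∀ k, DecidableRel (G k).Adj],
      (∀ k, (G k).Connected) → (∀ k, NoisyVoter.SubexpGrowth (G k) c₀ α) →
      Filter.Tendsto (fun k => Fintype.card (V k)) Filter.atTop Filter.atTop →
      ∀ x₀ : ∀ k, V k → Fin q,
      NoisyVoter.HasCutoffAt (fun k ε => NoisyVoter.tmix (G k) q θ (x₀ k) ε)
        (fun k => NoisyVoter.cutoffTime (G k) q θ (x₀ k))) := by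
  refine ⟨fun ε hε hε' => NoisyVoter.exists_tmix_eq hθ hθ' hq hc₀ hα hα' hε hε', ?_⟩
  intro V _ _ G _ hG hgr hV x₀
  exact NoisyVoter.hasCutoffAt_cutoffTime hθ hθ' hq hc₀ hα hα' V G hG hgr hV x₀
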